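/- Let $n\ge 1$ be an integer, $\alpha\in(0,1)$, $\mathbb R^{1+n}_+=(0,\infty)\times\mathbb R^n$, and for $t>0$, $x\in\mathbb R^n$ let $$K_t^{(\alpha)}(x)=(2\pi)^{-n}\int_{\mathbb R^n}e^{ix\cdot y-t|y|^{2\alpha}}\,dy$$ be the kernel of the semigroup $e^{-t(-\Delta)^\alpha}$. For real-valued $f$ on $\mathbb R^n$ and $F$ on $\mathbb R^{1+n}_+$ put $$R_\alpha f(t,x)=\int_{\mathbb R^n}K^{(\alpha)}_t(x-y)f(y)\,dy,\qquad S_\alpha F(t,x)=\int_0^t\int_{\mathbb R^n}K^{(\alpha)}_{t-s}(x-y)F(s,y)\,dy\,ds,$$ $$\|F\|_{L^q_tL^p_x}=\Big(\int_0^\infty\Big[\int_{\mathbb R^n}|F(t,x)|^p\,dx\Big]^{q/p}dt\Big)^{1/q},\qquad B_r^{(\alpha)}(t_0,x_0)=\{(t,x)\in\mathbb R^{1+n}_+:\ |t-t_0|<r^{2\alpha},\ |x-x_0|<r\}.$$ (i) If $p\in[1,\infty]$ and $f\in L^p(\mathbb R^n)$, then the integral defining $R_\alpha f$ converges absolutely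 at every point of $\mathbb R^{1+n}_+$, and $R_\alpha f$ is continuous on $\mathbb R^{1+n}_+$. (ii) Let $1\le p<\infty$, $1<q<\infty$ and $\frac np+\frac{2\alpha}q=2\alpha$. There are constants $C,A>0$, depending only on $n,\alpha,p,q$, such that for every measurable $F$ with $0<\|F\|_{L^q_tL^p_x}<\infty$ and every $(t_0,x_0)\in\mathbb R^{1+n}_+$, with $r_0=t_0^{1/(2\alpha)}$, the integral defining $S_\alpha F$ converges absolutely at almost every point of $B_{r_0}^{(\alpha)}(t_0,x_0)$ and $$\frac1{|B_{r_0}^{(\alpha)}(t_0,x_0)|}\iint_{B_{r_0}^{(\alpha)}(t_0,x_0)}\exp\left(\left(\frac{|S_\alpha F(t,x)|}{C\|F\|_{L^q_tL^p_x}}\right)^{\frac q{q-1}}\right)dx\,dt\le A .$$ (iii) Let $1\le p<\infty$, $1<q<\infty$, $\frac np+\frac{2\alpha}q<2\alpha$, and put $\theta=2\alpha-\frac np-\frac{2\alpha}q>0$. For every measurable $F$ with $\|F\|_{L^q_tL^p_x}<\infty$ the integral defining $S_\alpha F$ converges absolutely at every point of $\mathbb R^{1+n}_+$, and $S_\alpha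 F$ is Hölder continuous in the following sense. If $\theta<1$, there is $C>0$, depending only on $n,\alpha,p,q$, such that for all such $F$ and all $(t,x),(t_0,x_0)\in\mathbb R^{1+n}_+$ $$|S_\alpha F(t,x)-S_\alpha F(t_0,x_0)|\le C\Big(|t-t_0|^{\frac{\theta}{2\alpha}}+|x-x_0|^{\theta}\Big)\|F\|_{L^q_tL^p_x}.$$ If $\theta\ge1$, then for every $\gamma\in(0,1)$ and $T>0$ there is $C>0$, depending only on $n,\alpha,p,q,\gamma,T$, such that for all such $F$ and all $(t,x),(t_0,x_0)\in(0,T]\times\mathbb R^n$ $$|S_\alpha F(t,x)-S_\alpha F(t_0,x_0)|\le C\Big(|t-t_0|^{\frac{\theta}{2\alpha}}+|x-x_0|^{\gamma}\Big)\|F\|_{L^q_tL^p_x}.$$ -/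

import Mathlib

open MeasureTheory Set
open scoped ENNReal

noncomputable section

namespace FracDissipative

/-- The complex integral `(2π)^{-n} ∫ exp (i x·y - t |y|^{2α}) dy` over `ℝⁿ`. -/
def kernelIntegral {n : ℕ} (α t : ℝ) (x : EuclideanSpace ℝ (Fin n)) : ℂ :=
  (((2 * Real.pi) ^ n)⁻¹ : ℝ) *
    ∫ y : EuclideanSpace ℝ (Fin n),
      Complex.exp (Complex.I * ((inner ℝ x y : ℝ) : ℂ) - ((t * ‖y‖ ^ (2 * α) : ℝ) : ℂ))

/-- The kernel `K_t^{(α)}` of the semigroup `e^{-t(-Δ)^α}` on `ℝⁿ`, as a real function. It is the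
full complex integral, which is real: see `ofReal_kernel`. -/
def kernel {n : ℕ} (α t : ℝ) (x : EuclideanSpace ℝ (Fin n)) : ℝ :=
  (kernelIntegral α t x).re

/-- The complex integral that defines the kernel is real, so no information is lost in `kernel`. -/
theorem ofReal_kernel {n : ℕ} (α t : ℝ) (x : EuclideanSpace ℝ (Fin n)) :
    ((kernel α t x : ℝ) : ℂ) = kernelIntegral α t x := by
  have h : (starRingEnd ℂ) (kernelIntegral α t x) = kernelIntegral α t x := by
    unfold kernelIntegral
    rw [map_mul, Complex.conj_ofReal, ← integral_conj]
    congr 1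
    rw [← integral_neg_eq_self]
    congr 1
    ext y
    rw [← Complex.exp_conj]
    simp
  exact Complex.conj_eq_iff_re.mp h

/-- `R_α f (t, x) = (K_t^{(α)} ∗ f)(x)`. -/
def freeSol {n : ℕ} (α : ℝ) (f : EuclideanSpace ℝ (Fin n) → ℝ)
    (z : ℝ × EuclideanSpace ℝ (Fin n)) : ℝ :=
  ∫ y, kernel α z.1 (z.2 - y) * f y

/-- `S_α F (t, x) = ∫₀ᵗ (K_{t-s}^{(α)} ∗ F(s, ·))(x) ds`. -/
def duhamel {n : ℕ} (α : ℝ) (F : ℝ × EuclideanSpace ℝ (Fin n) → ℝ)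
    (z : ℝ × EuclideanSpace ℝ (Fin n)) : ℝ :=
  ∫ s in (0 : ℝ)..z.1, ∫ y, kernel α (z.1 - s) (z.2 - y) * F (s, y)

/-- The integral that defines `S_α F` at the point `z = (t, x)` converges absolutely on
`(0, t) × ℝⁿ`. -/
def DuhamelConverges {n : ℕ} (α : ℝ) (F : ℝ × EuclideanSpace ℝ (Fin n) → ℝ)
    (z : ℝ × EuclideanSpace ℝ (Fin n)) : Prop :=
  IntegrableOn
    (fun w : ℝ × EuclideanSpace ℝ (Fin n) => kernel α (z.1 - w.1) (z.2 - w.2) * F w)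
    (Ioo 0 z.1 ×ˢ univ)

/-- The upper half space `ℝ₊ × ℝⁿ`. -/
def upperHalf (n : ℕ) : Set (ℝ × EuclideanSpace ℝ (Fin n)) :=
  Ioi 0 ×ˢ univ

/-- The mixed norm of `L^q_t L^p_x (ℝ₊ × ℝⁿ)`, for finite exponents, with values in `[0, ∞]`. -/
def mixedNorm {n : ℕ} (p q : ℝ) (F : ℝ × EuclideanSpace ℝ (Fin n) → ℝ) : ℝ≥0∞ :=
  (∫⁻ t in Ioi (0 : ℝ), (∫⁻ x, ‖F (t, x)‖ₑ ^ p) ^ (q / p)) ^ (1 / q)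

/-- `F` belongs to `L^q_t L^p_x (ℝ₊ × ℝⁿ)`. -/
def MemMixed {n : ℕ} (p q : ℝ) (F : ℝ × EuclideanSpace ℝ (Fin n) → ℝ) : Prop :=
  AEStronglyMeasurable F (volume.restrict (upperHalf n)) ∧ mixedNorm p q F < ∞

/-- The parabolic ball `B_r^{(α)}(t₀, x₀)`. -/
def parabolicBall {n : ℕ} (α r t₀ : ℝ) (x₀ : EuclideanSpace ℝ (Fin n)) :
    Set (ℝ × EuclideanSpace ℝ (Fin n)) :=
  {z | z ∈ upperHalf n ∧ |z.1 - t₀| < r ^ (2 * α) ∧ ‖z.2 - x₀‖ < r}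

/-- The spatial regularity exponent `2α - n/p - 2α/q`. -/
def exponent (n : ℕ) (α p q : ℝ) : ℝ :=
  2 * α - n / p - 2 * α / q

end FracDissipative

end

/-! The proof never uses the pointwise decay of the kernel. It uses that K = K_1 is nonnegative,
radially nonincreasing, bounded, Lipschitz and of mass at most 1, that K_t is a rescaling of K, and
that space and time increments of K are O(|h|) and O(h) in L¹.

Positivity and monotonicity come from the Lévy–Khintchine formula: |y|^{2α} is a constant multiple
of ∫ (1 - e^{-s|y|²}) s^{-1-α} ds. Cutting off at s > ε makes e^{-t|y|^{2α}} a limit of constants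
times exp of a Gaussian mixture. Expanding this exponential gives sums of products of Gaussians,
whose transforms are Gaussians, hence positive and radially nonincreasing (`posDecr_exp_neg_rpow`,
`cosInt_exp_neg_rpow_nonneg_antitone`). For a radially nonincreasing K the sign of K(x+h) - K(x) is
known on each side of a hyperplane. The L¹ norm of a translation increment therefore reduces to the
mass of a slab of width |h|, which is O(|h|) because the characteristic function e^{-|ξ|^{2α}} is
integrable (`integral_abs_kernel_translate_sub_le`). Dilations give the time increment
(`integral_abs_kernel_time_sub_le`).

All estimates on K_τ and its increments are stored as `KernelBound`: L¹ norm at most a, sup norm at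
most ab, with b = τ^{-n/(2α)}. Young's inequality then costs a b^{1/p} from L^p to L^∞, and a from
L^p to L^p. The first cost gives the continuity of R_α f. Put r = q' and e = n/(2αp), so that θ =
2α(1/r - e). For θ > 0, Hölder in time against weights min(1, (σ/τ)^κ) τ^{-e} gives the Hölder
bounds, because the L^r norm of such a weight scales like σ^{1/r-e} (`lintegral_min_rpow_le`).

For θ = 0 the weight τ^{-1/r} just fails to be in L^r, and a Hedberg-type argument takes over. Times
with t - s ≥ δ contribute at most C ‖F‖ log(t/δ)^{1/r}. Nearer times are bounded by a positive power
of δ times a power of `potential`, a function whose integral is controlled by the L^p to L^p bound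
(`lintegral_convNorm_far_le`, `lintegral_convNorm_near_le`). Optimising δ bounds |S_α F| by ‖F‖ (1 +
log⁺ potential)^{1/r} up to normalisation (`lintegral_convNorm_le_log`). The exponential of the r-th
power is then linear in the potential and can be integrated (`exp_integrability_of_critical`). -/

noncomputable section

namespace FracDissipative

open Filter Topology FourierTransform

/-! ### Gaussian mixtures with a cut-off at small parameters. -/

section GaussMix

variable {E : Type*} [NormedAddCommGroup E]

/-- The function `y ↦ ∫_ε^∞ w(s) exp(-s|y|²) ds`. -/
def gaussMix (ε : ℝ) (w : ℝ → ℝ) (y : E) : ℝ :=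
  ∫ s in Ioi ε, w s * Real.exp (-(s * ‖y‖ ^ 2))

theorem measurable_gaussMix [MeasurableSpace E] [BorelSpace E] {ε : ℝ} {w : ℝ → ℝ}
    (hw : Measurable w) : Measurable (gaussMix (E := E) ε w) := by
  have : StronglyMeasurable fun q : E × ℝ => w q.2 * Real.exp (-(q.2 * ‖q.1‖ ^ 2)) :=
    Measurable.stronglyMeasurable (by fun_prop)
  exact this.integral_prod_right.measurable

theorem integrable_gaussMix_integrand {ε : ℝ} (hε : 0 < ε) {w : ℝ → ℝ}
    (hi : IntegrableOn w (Ioi ε)) (y : E) :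
    IntegrableOn (fun s => w s * Real.exp (-(s * ‖y‖ ^ 2))) (Ioi ε) := by
  refine hi.mul_bdd (c := 1) (by fun_prop) ?_
  filter_upwards [ae_restrict_mem measurableSet_Ioi] with s hs
  have : 0 < s := hε.trans hs
  rw [Real.norm_eq_abs, abs_of_pos (Real.exp_pos _), Real.exp_le_one_iff]
  simp only [Left.neg_nonpos_iff]; positivity

theorem gaussMix_nonneg {ε : ℝ} (hε : 0 < ε) {w : ℝ → ℝ} (hw0 : ∀ s, 0 < s → 0 ≤ w s) (y : E) :
    0 ≤ gaussMix ε w y :=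
  setIntegral_nonneg measurableSet_Ioi fun s hs =>
    mul_nonneg (hw0 s (hε.trans hs)) (Real.exp_pos _).le

theorem gaussMix_le {ε : ℝ} (hε : 0 < ε) {w : ℝ → ℝ} (hw0 : ∀ s, 0 < s → 0 ≤ w s)
    (hi : IntegrableOn w (Ioi ε)) (y : E) : gaussMix ε w y ≤ ∫ s in Ioi ε, w s := by
  refine setIntegral_mono_on (integrable_gaussMix_integrand hε hi y) hi measurableSet_Ioi ?_
  intro s hs
  have hs0 : 0 < s := hε.trans hs
  refine mul_le_of_le_one_right (hw0 s hs0) ?_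
  rw [Real.exp_le_one_iff]
  simp only [Left.neg_nonpos_iff]; positivity

end GaussMix

/-! ### Functions whose cosine transform is positive and radially nonincreasing. -/

section CosTransform

variable {E : Type*} [NormedAddCommGroup E] [InnerProductSpace ℝ E] [FiniteDimensional ℝ E]
  [MeasurableSpace E] [BorelSpace E]

theorem integrable_norm_rpow_mul_exp_neg [Nontrivial E] {a c t : ℝ} (ha : 0 < a) (hc : 0 ≤ c)
    (ht : 0 < t) : Integrable (fun y : E => ‖y‖ ^ c * Real.exp (-(t * ‖y‖ ^ a))) := by
  have hf := integrable_fun_norm_addHaar (E := E) volume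
    (f := fun r : ℝ => r ^ c * Real.exp (-(t * r ^ a)))
  rw [hf]
  set d := Module.finrank ℝ E - 1
  refine (integrableOn_rpow_mul_exp_neg_mul_rpow (s := d + c) (by linarith [d.cast_nonneg (α := ℝ)])
    ha ht).congr_fun ?_ measurableSet_Ioi
  intro r hr
  have hr : 0 < r := hr
  simp only [smul_eq_mul]
  rw [Real.rpow_add hr, Real.rpow_natCast, neg_mul]
  ring

theorem integrable_exp_neg_norm_rpow [Nontrivial E] {a t : ℝ} (ha : 0 < a) (ht : 0 < t) :
    Integrable (fun y : E => Real.exp (-(t * ‖y‖ ^ a))) := by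
  simpa using integrable_norm_rpow_mul_exp_neg (E := E) ha le_rfl ht

theorem integrable_exp_neg_mul_norm_sq {b : ℝ} (hb : 0 < b) :
    Integrable (fun y : E => Real.exp (-(b * ‖y‖ ^ 2))) := by
  have h := (GaussianFourier.integrable_cexp_neg_mul_sq_norm_add (V := E) (b := (b : ℂ))
    (by simpa using hb) 0 0).re
  refine h.congr (Eventually.of_forall fun y => ?_)
  have : (-(b : ℂ) * (‖y‖ : ℂ) ^ 2 + 0 * ((inner ℝ (0 : E) y : ℝ) : ℂ))
      = ((-(b * ‖y‖ ^ 2) : ℝ) : ℂ) := by push_cast; ring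
  simp only [this, ← Complex.ofReal_exp]
  exact Complex.ofReal_re _

/-- The cosine transform `x ↦ ∫ cos ⟪x, y⟫ φ(y) dy`. -/
def cosInt (φ : E → ℝ) (x : E) : ℝ := ∫ y, Real.cos (inner ℝ x y) * φ y

theorem integrable_cos_mul {φ : E → ℝ} (hφ : Integrable φ) (x : E) :
    Integrable (fun y => Real.cos (inner ℝ x y) * φ y) := by
  refine hφ.bdd_mul (c := 1) (by fun_prop) (Eventually.of_forall fun y => ?_)
  simpa using Real.abs_cos_le_one _

theorem cosInt_gaussian {b : ℝ} (hb : 0 < b) (x : E) :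
    cosInt (fun y => Real.exp (-(b * ‖y‖ ^ 2))) x =
      (Real.pi / b) ^ ((Module.finrank ℝ E : ℝ) / 2) * Real.exp (-(‖x‖ ^ 2 / (4 * b))) := by
  have hb' : 0 < (b : ℂ).re := by simpa using hb
  have h := GaussianFourier.integral_cexp_neg_mul_sq_norm_add hb' Complex.I x
  have hi := GaussianFourier.integrable_cexp_neg_mul_sq_norm_add hb' Complex.I x
  have h2 := congrArg Complex.re h
  rw [← RCLike.re_eq_complex_re, ← integral_re hi] at h2
  rw [cosInt]
  convert h2 using 1
  · congr 1
    ext y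
    rw [RCLike.re_eq_complex_re, Complex.exp_re]
    simp [mul_comm, ← Complex.ofReal_pow]
  · have e1 : ((Real.pi : ℂ) / b) ^ ((Module.finrank ℝ E : ℂ) / 2) =
        (((Real.pi / b) ^ ((Module.finrank ℝ E : ℝ) / 2) : ℝ) : ℂ) := by
      rw [Complex.ofReal_cpow (by positivity)]; push_cast; rfl
    have e2 : Complex.exp (Complex.I ^ 2 * (‖x‖ : ℂ) ^ 2 / (4 * b)) =
        ((Real.exp (-(‖x‖ ^ 2 / (4 * b))) : ℝ) : ℂ) := by
      rw [Complex.ofReal_exp]; congr 1; push_cast; rw [Complex.I_sq]; ring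
    rw [RCLike.re_eq_complex_re, e1, e2, ← Complex.ofReal_mul, Complex.ofReal_re]

/-- All Gaussian regularisations of `φ` have a nonnegative, radially nonincreasing
cosine transform. -/
def PosDecr (φ : E → ℝ) : Prop :=
  ∀ δ : ℝ, 0 < δ → ∀ x x' : E, ‖x‖ ≤ ‖x'‖ →
    0 ≤ cosInt (fun y => Real.exp (-(δ * ‖y‖ ^ 2)) * φ y) x' ∧
      cosInt (fun y => Real.exp (-(δ * ‖y‖ ^ 2)) * φ y) x' ≤
        cosInt (fun y => Real.exp (-(δ * ‖y‖ ^ 2)) * φ y) x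

theorem integrable_gaussian_mul {φ : E → ℝ} {M δ : ℝ} (hδ : 0 < δ) (hm : Measurable φ)
    (hb : ∀ y, |φ y| ≤ M) : Integrable (fun y => Real.exp (-(δ * ‖y‖ ^ 2)) * φ y) :=
  (integrable_exp_neg_mul_norm_sq hδ).mul_bdd hm.aestronglyMeasurable (Eventually.of_forall hb)

/-- The transform of a Gaussian is a positive multiple of a Gaussian. This is the only explicit
example; the others follow from closure properties. The Gaussian factor in `PosDecr` is what makes
sense of the transform of non-integrable functions such as this one. -/
theorem posDecr_one : PosDecr (fun _ : E => (1 : ℝ)) := by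
  intro δ hδ x x' hxx
  simp only [mul_one, cosInt_gaussian hδ]
  refine ⟨by positivity, ?_⟩
  gcongr

theorem PosDecr.add {φ ψ : E → ℝ} {M N : ℝ} (hφ : PosDecr φ) (hψ : PosDecr ψ)
    (mφ : Measurable φ) (mψ : Measurable ψ) (bφ : ∀ y, |φ y| ≤ M) (bψ : ∀ y, |ψ y| ≤ N) :
    PosDecr (fun y => φ y + ψ y) := by
  intro δ hδ x x' hxx
  have key : ∀ z, cosInt (fun y => Real.exp (-(δ * ‖y‖ ^ 2)) * (φ y + ψ y)) z =
      cosInt (fun y => Real.exp (-(δ * ‖y‖ ^ 2)) * φ y) z +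
      cosInt (fun y => Real.exp (-(δ * ‖y‖ ^ 2)) * ψ y) z := by
    intro z
    rw [cosInt, cosInt, cosInt, ← integral_add
      (integrable_cos_mul (integrable_gaussian_mul hδ mφ bφ) z)
      (integrable_cos_mul (integrable_gaussian_mul hδ mψ bψ) z)]
    congr 1; ext y; ring
  simp only [key]
  have h1 := hφ δ hδ x x' hxx
  have h2 := hψ δ hδ x x' hxx
  constructor <;> linarith [h1.1, h1.2, h2.1, h2.2]

theorem PosDecr.const_mul {φ : E → ℝ} (hφ : PosDecr φ) {c : ℝ} (hc : 0 ≤ c) :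
    PosDecr (fun y => c * φ y) := by
  intro δ hδ x x' hxx
  have key : ∀ z, cosInt (fun y => Real.exp (-(δ * ‖y‖ ^ 2)) * (c * φ y)) z =
      c * cosInt (fun y => Real.exp (-(δ * ‖y‖ ^ 2)) * φ y) z := by
    intro z
    rw [cosInt, cosInt, ← integral_const_mul]
    congr 1; ext y; ring
  simp only [key]
  have h1 := hφ δ hδ x x' hxx
  exact ⟨mul_nonneg hc h1.1, mul_le_mul_of_nonneg_left h1.2 hc⟩

theorem tendsto_cosInt {φ : ℕ → E → ℝ} {ψ g : E → ℝ} (mφ : ∀ N, Measurable (φ N))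
    (hg : Integrable g) (bφ : ∀ N y, |φ N y| ≤ g y)
    (hlim : ∀ y, Tendsto (fun N => φ N y) atTop (𝓝 (ψ y))) (x : E) :
    Tendsto (fun N => cosInt (φ N) x) atTop (𝓝 (cosInt ψ x)) := by
  refine tendsto_integral_of_dominated_convergence g (fun N => ?_) hg
    (fun N => Eventually.of_forall fun y => ?_) (Eventually.of_forall fun y => ?_)
  · exact ((by fun_prop : Continuous fun y : E => Real.cos (inner ℝ x y)).measurable.mul
      (mφ N)).aestronglyMeasurable
  · rw [norm_mul]
    calc ‖Real.cos (inner ℝ x y)‖ * ‖φ N y‖ ≤ 1 * g y :=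
          mul_le_mul (by simpa using Real.abs_cos_le_one _) (bφ N y) (norm_nonneg _) zero_le_one
      _ = g y := one_mul _
  · exact (hlim y).const_mul _

theorem PosDecr.of_tendsto {φ : ℕ → E → ℝ} {ψ : E → ℝ} {M : ℝ} (hφ : ∀ N, PosDecr (φ N))
    (mφ : ∀ N, Measurable (φ N)) (bφ : ∀ N y, |φ N y| ≤ M)
    (hlim : ∀ y, Tendsto (fun N => φ N y) atTop (𝓝 (ψ y))) : PosDecr ψ := by
  intro δ hδ x x' hxx
  have key := tendsto_cosInt (φ := fun N y => Real.exp (-(δ * ‖y‖ ^ 2)) * φ N y)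
    (ψ := fun y => Real.exp (-(δ * ‖y‖ ^ 2)) * ψ y)
    (g := fun y => Real.exp (-(δ * ‖y‖ ^ 2)) * M) (fun N => by have := mφ N; fun_prop)
    ((integrable_exp_neg_mul_norm_sq hδ).mul_const M)
    (fun N y => by
      rw [abs_mul, abs_of_pos (Real.exp_pos _)]
      exact mul_le_mul_of_nonneg_left (bφ N y) (Real.exp_pos _).le)
    (fun y => (hlim y).const_mul _)
  exact ⟨ge_of_tendsto' (key x') fun N => (hφ N δ hδ x x' hxx).1,
    le_of_tendsto_of_tendsto' (key x') (key x) fun N => (hφ N δ hδ x x' hxx).2⟩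

/-- By Fubini the transform of the product is a positive superposition over s of transforms of φ
regularised with δ + s in place of δ. This is why `PosDecr` asks for every δ. -/
theorem PosDecr.mul_gaussMix {φ : E → ℝ} {M : ℝ} (hφ : PosDecr φ) (mφ : Measurable φ)
    (bφ : ∀ y, |φ y| ≤ M) {ε : ℝ} (hε : 0 < ε) {w : ℝ → ℝ}
    (hw0 : ∀ s, 0 < s → 0 ≤ w s) (hi : IntegrableOn w (Ioi ε)) :
    PosDecr (fun y => φ y * gaussMix ε w y) := by
  intro δ hδ x x' hxx
  have key : ∀ z, cosInt (fun y => Real.exp (-(δ * ‖y‖ ^ 2)) * (φ y * gaussMix ε w y)) z =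
      ∫ s in Ioi ε, w s * cosInt (fun y : E => Real.exp (-((δ + s) * ‖y‖ ^ 2)) * φ y) z := by
    intro z
    have hint : Integrable (Function.uncurry fun (y : E) (s : ℝ) =>
        (Real.cos (inner ℝ z y) * (Real.exp (-(δ * ‖y‖ ^ 2)) * φ y)) *
          (w s * Real.exp (-(s * ‖y‖ ^ 2)))) (volume.prod (volume.restrict (Ioi ε))) := by
      have h0 := (integrable_cos_mul (integrable_gaussian_mul hδ mφ bφ) z).mul_prod hi
      have h1 : Integrable (fun q : E × ℝ =>
          (Real.cos (inner ℝ z q.1) * (Real.exp (-(δ * ‖q.1‖ ^ 2)) * φ q.1) * w q.2) *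
          Real.exp (-(q.2 * ‖q.1‖ ^ 2))) (volume.prod (volume.restrict (Ioi ε))) := by
        refine h0.mul_bdd (c := 1) (by fun_prop) ?_
        have h2 : ∀ᵐ q : E × ℝ ∂(volume.prod (volume.restrict (Ioi ε))), q.2 ∈ Ioi ε :=
          Measure.quasiMeasurePreserving_snd.ae (ae_restrict_mem measurableSet_Ioi)
        filter_upwards [h2] with q hq
        have : 0 < q.2 := hε.trans hq
        rw [Real.norm_eq_abs, abs_of_pos (Real.exp_pos _), Real.exp_le_one_iff]
        simp only [Left.neg_nonpos_iff]; positivity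
      refine h1.congr (Eventually.of_forall fun q => ?_)
      simp only [Function.uncurry]; ring
    have hsw := integral_integral_swap hint
    rw [cosInt]
    calc _ = ∫ y : E, ∫ s in Ioi ε, (Real.cos (inner ℝ z y) * (Real.exp (-(δ * ‖y‖ ^ 2)) * φ y)) *
          (w s * Real.exp (-(s * ‖y‖ ^ 2))) := by
          congr 1; ext y
          rw [integral_const_mul, gaussMix]; ring
      _ = _ := hsw
      _ = _ := by
          congr 1; ext s
          rw [cosInt, ← integral_const_mul]
          congr 1; ext y
          rw [add_mul, neg_add, Real.exp_add]; ring
  have hI : ∀ z, IntegrableOn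
      (fun s => w s * cosInt (fun y : E => Real.exp (-((δ + s) * ‖y‖ ^ 2)) * φ y) z) (Ioi ε) := by
    intro z
    refine hi.mul_bdd (c := ∫ y : E, Real.exp (-(δ * ‖y‖ ^ 2)) * M) ?_ ?_
    · have : StronglyMeasurable fun q : ℝ × E => Real.cos (inner ℝ z q.2) *
          (Real.exp (-((δ + q.1) * ‖q.2‖ ^ 2)) * φ q.2) :=
        Measurable.stronglyMeasurable (by fun_prop)
      exact this.integral_prod_right.aestronglyMeasurable
    · filter_upwards [ae_restrict_mem measurableSet_Ioi] with s hs
      have hs0 : 0 < s := hε.trans hs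
      refine norm_integral_le_of_norm_le
        ((integrable_exp_neg_mul_norm_sq (E := E) hδ).mul_const M)
        (Eventually.of_forall fun y => ?_)
      rw [norm_mul, norm_mul, ← one_mul (Real.exp (-(δ * ‖y‖ ^ 2)) * M)]
      refine mul_le_mul (by simpa using Real.abs_cos_le_one _) ?_ (by positivity) zero_le_one
      refine mul_le_mul ?_ (bφ y) (norm_nonneg _) (Real.exp_pos _).le
      rw [Real.norm_eq_abs, abs_of_pos (Real.exp_pos _)]
      gcongr; linarith
  simp only [key]
  constructor
  · exact setIntegral_nonneg measurableSet_Ioi fun s hs =>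
      mul_nonneg (hw0 s (hε.trans hs)) (hφ (δ + s) (add_pos hδ (hε.trans hs)) x x' hxx).1
  · exact setIntegral_mono_on (hI x') (hI x) measurableSet_Ioi fun s hs =>
      mul_le_mul_of_nonneg_left (hφ (δ + s) (add_pos hδ (hε.trans hs)) x x' hxx).2
        (hw0 s (hε.trans hs))

/-- Powers of the mixture are handled by induction with `PosDecr.mul_gaussMix`, and the exponential
is the limit of its Taylor sums. The coefficients are positive and the sums stay below exp of the
total mass of w. -/
theorem posDecr_exp_gaussMix {ε : ℝ} (hε : 0 < ε) {w : ℝ → ℝ} (hw : Measurable w)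
    (hw0 : ∀ s, 0 < s → 0 ≤ w s) (hi : IntegrableOn w (Ioi ε)) :
    PosDecr (fun y : E => Real.exp (gaussMix ε w y)) := by
  set A := ∫ s in Ioi ε, w s with hA
  have h0 := fun y : E => gaussMix_nonneg hε hw0 y
  have h1 := fun y : E => gaussMix_le hε hw0 hi y
  have mL := measurable_gaussMix (E := E) (ε := ε) hw
  have hpow : ∀ k : ℕ, PosDecr (fun y : E => gaussMix ε w y ^ k) := by
    intro k
    induction k with
    | zero => simpa using posDecr_one
    | succ k ih =>
      simp only [pow_succ]
      refine ih.mul_gaussMix (M := A ^ k) (by fun_prop) (fun y => ?_) hε hw0 hi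
      rw [abs_of_nonneg (pow_nonneg (h0 y) _)]
      exact pow_le_pow_left₀ (h0 y) (h1 y) k
  have hA0 : 0 ≤ A := (h0 0).trans (h1 0)
  have hexp : ∀ (N : ℕ) (u : ℝ), 0 ≤ u → ∑ k ∈ Finset.range N, u ^ k / k.factorial ≤ Real.exp u :=
    fun N u hu => Real.sum_le_exp_of_nonneg hu N
  have hsum0 : ∀ (N : ℕ) (u : ℝ), 0 ≤ u → 0 ≤ ∑ k ∈ Finset.range N, u ^ k / k.factorial :=
    fun N u hu => Finset.sum_nonneg fun k _ => by positivity
  have hsb : ∀ (N : ℕ) (y : E),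
      |∑ k ∈ Finset.range N, gaussMix ε w y ^ k / k.factorial| ≤ Real.exp A := fun N y => by
    rw [abs_of_nonneg (hsum0 N _ (h0 y))]
    exact (hexp N _ (h0 y)).trans (Real.exp_le_exp.2 (h1 y))
  refine PosDecr.of_tendsto
    (φ := fun N y => ∑ k ∈ Finset.range N, gaussMix ε w y ^ k / k.factorial)
    (M := Real.exp A) (fun N => ?_) (fun N => by fun_prop) hsb (fun y => ?_)
  · induction N with
    | zero => simpa using (posDecr_one (E := E)).const_mul le_rfl
    | succ N ih =>
      simp only [Finset.sum_range_succ]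
      refine ih.add (M := Real.exp A) (N := (N.factorial : ℝ)⁻¹ * A ^ N) ?_ (by fun_prop)
        (by fun_prop) (hsb N) (fun y => ?_)
      · simpa [div_eq_inv_mul] using (hpow N).const_mul (c := (N.factorial : ℝ)⁻¹) (by positivity)
      · rw [abs_of_nonneg (by have := h0 y; positivity), div_eq_inv_mul]
        have := h0 y
        have := h1 y
        gcongr
  · rw [Real.exp_eq_exp_ℝ]
    exact (NormedSpace.expSeries_div_hasSum_exp (gaussMix ε w y)).tendsto_sum_nat

end CosTransform

/-! ### The Lévy–Khintchine formula for |y|^{2α}. -/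

theorem integrableOn_one_sub_exp_mul_rpow {α : ℝ} (hα₀ : 0 < α) (hα₁ : α < 1) :
    IntegrableOn (fun s : ℝ => (1 - Real.exp (-s)) * s ^ (-1 - α)) (Ioi 0) := by
  rw [← Ioc_union_Ioi_eq_Ioi zero_le_one]
  refine IntegrableOn.union ?_ ?_
  · have h : IntegrableOn (fun s : ℝ => s ^ (-α)) (Ioc 0 1) :=
      (intervalIntegrable_iff_integrableOn_Ioc_of_le zero_le_one).1
        (intervalIntegral.intervalIntegrable_rpow' (by linarith))
    refine h.mono' (by fun_prop) ?_
    filter_upwards [ae_restrict_mem measurableSet_Ioc] with s hs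
    have h1 : 0 ≤ 1 - Real.exp (-s) := by
      have := Real.exp_le_one_iff.2 (by linarith [hs.1] : -s ≤ 0); linarith
    have h2 : 1 - Real.exp (-s) ≤ s := by linarith [Real.add_one_le_exp (-s)]
    have h3 : 0 ≤ s ^ (-1 - α) := Real.rpow_nonneg hs.1.le _
    rw [Real.norm_eq_abs, abs_of_nonneg (mul_nonneg h1 h3)]
    calc _ ≤ s * s ^ (-1 - α) := mul_le_mul_of_nonneg_right h2 h3
      _ = s ^ (-α) := by
        rw [← Real.rpow_one_add' hs.1.le (by linarith)]; congr 1; ring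
  · have h : IntegrableOn (fun s : ℝ => s ^ (-1 - α)) (Ioi 1) :=
      integrableOn_Ioi_rpow_of_lt (by linarith) zero_lt_one
    refine h.mono' (by fun_prop) ?_
    filter_upwards [ae_restrict_mem measurableSet_Ioi] with s hs
    have hs0 : 0 < s := zero_lt_one.trans hs
    have h1 : 0 ≤ 1 - Real.exp (-s) := by
      have := Real.exp_le_one_iff.2 (by linarith : -s ≤ 0); linarith
    have h3 : 0 ≤ s ^ (-1 - α) := Real.rpow_nonneg hs0.le _
    rw [Real.norm_eq_abs, abs_of_nonneg (mul_nonneg h1 h3)]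
    exact mul_le_of_le_one_left h3 (by linarith [Real.exp_pos (-s)])

/-- The constant `∫₀^∞ (1 - e^{-s}) s^{-1-α} ds`. -/
def levyConst (α : ℝ) : ℝ := ∫ s in Ioi (0 : ℝ), (1 - Real.exp (-s)) * s ^ (-1 - α)

theorem levyConst_pos {α : ℝ} (hα₀ : 0 < α) (hα₁ : α < 1) : 0 < levyConst α := by
  have hpos : ∀ s : ℝ, 0 < s → 0 < (1 - Real.exp (-s)) * s ^ (-1 - α) := fun s hs =>
    mul_pos (by have := Real.exp_lt_one_iff.2 (by linarith : -s < 0); linarith)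
      (Real.rpow_pos_of_pos hs _)
  rw [levyConst, setIntegral_pos_iff_support_of_nonneg_ae
    (by filter_upwards [ae_restrict_mem measurableSet_Ioi] with s hs using (hpos s hs).le)
    (integrableOn_one_sub_exp_mul_rpow hα₀ hα₁)]
  have : Ioi (0 : ℝ) ⊆ Function.support (fun s : ℝ => (1 - Real.exp (-s)) * s ^ (-1 - α)) ∩ Ioi 0 :=
    fun s hs => ⟨(hpos s hs).ne', hs⟩
  exact lt_of_lt_of_le (by simp) (measure_mono this)

theorem levy_scaling {α : ℝ} (hα₀ : 0 < α) {l : ℝ} (hl : 0 ≤ l) :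
    ∫ s in Ioi (0 : ℝ), (1 - Real.exp (-(s * l))) * s ^ (-1 - α) = l ^ α * levyConst α := by
  rcases hl.eq_or_lt with rfl | hl
  · simp [Real.zero_rpow hα₀.ne']
  have h := integral_comp_mul_left_Ioi
    (fun s : ℝ => (1 - Real.exp (-s)) * s ^ (-1 - α)) 0 hl
  rw [mul_zero, smul_eq_mul] at h
  rw [levyConst]
  have e : ∀ s ∈ Ioi (0 : ℝ), (1 - Real.exp (-(s * l))) * s ^ (-1 - α) =
      l ^ (1 + α) * ((1 - Real.exp (-(l * s))) * (l * s) ^ (-1 - α)) := by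
    intro s hs
    rw [Real.mul_rpow hl.le (le_of_lt hs), mul_comm s l]
    have : l ^ (1 + α) * l ^ (-1 - α) = 1 := by
      rw [← Real.rpow_add hl]; simp
    linear_combination (-(1 - Real.exp (-(l * s))) * s ^ (-1 - α)) * this
  rw [setIntegral_congr_fun measurableSet_Ioi e, integral_const_mul, h, ← mul_assoc,
    Real.rpow_add hl, Real.rpow_one]
  field_simp

theorem integrableOn_levy {α : ℝ} (hα₀ : 0 < α) (hα₁ : α < 1) {l : ℝ} (hl : 0 ≤ l) :
    IntegrableOn (fun s : ℝ => (1 - Real.exp (-(s * l))) * s ^ (-1 - α)) (Ioi 0) := by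
  rcases hl.eq_or_lt with rfl | hl
  · simp
  -- A non-integrable function has integral 0 by convention, so the nonzero value from
  -- `levy_scaling` forces integrability.
  · refine not_imp_comm.1 integral_undef ?_
    rw [levy_scaling hα₀ hl.le]
    exact (mul_pos (Real.rpow_pos_of_pos hl _) (levyConst_pos hα₀ hα₁)).ne'

section

variable {E : Type*} [NormedAddCommGroup E] [InnerProductSpace ℝ E] [FiniteDimensional ℝ E]
  [MeasurableSpace E] [BorelSpace E]

/-- The density s^{-1-α} is not integrable at 0, hence the cut-offs ε_N → 0. With the cut-off,
exp(-mass) · exp(mixture) equals exp of minus the truncated Lévy–Khintchine integral, which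
increases to t|y|^{2α}. -/
theorem posDecr_exp_neg_rpow {α t : ℝ} (hα₀ : 0 < α) (hα₁ : α < 1) (ht : 0 < t) :
    PosDecr (fun y : E => Real.exp (-(t * ‖y‖ ^ (2 * α)))) := by
  have hI := levyConst_pos hα₀ hα₁
  set c := t / levyConst α with hc
  have hc0 : 0 < c := div_pos ht hI
  set w : ℝ → ℝ := fun s => c * s ^ (-1 - α) with hw
  have mw : Measurable w := by fun_prop
  have hw0 : ∀ s, 0 < s → 0 ≤ w s := fun s hs => by simp only [hw]; positivity
  set ε : ℕ → ℝ := fun N => 1 / ((N : ℝ) + 1) with hε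
  have hε0 : ∀ N, 0 < ε N := fun N => by simp only [hε]; positivity
  have hi : ∀ N, IntegrableOn w (Ioi (ε N)) := fun N =>
    (integrableOn_Ioi_rpow_of_lt (by linarith) (hε0 N)).const_mul c
  have hf : ∀ y : E, IntegrableOn
      (fun s => c * ((1 - Real.exp (-(s * ‖y‖ ^ 2))) * s ^ (-1 - α))) (Ioi 0) := fun y =>
    (integrableOn_levy hα₀ hα₁ (sq_nonneg ‖y‖)).const_mul c
  have hdiff : ∀ N (y : E), gaussMix (ε N) w y - (∫ s in Ioi (ε N), w s) =
      -∫ s in Ioi (ε N), c * ((1 - Real.exp (-(s * ‖y‖ ^ 2))) * s ^ (-1 - α)) := by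
    intro N y
    rw [gaussMix, ← integral_sub (integrable_gaussMix_integrand (hε0 N) (hi N) y) (hi N),
      ← integral_neg]
    congr 1; ext s; simp only [hw]; ring
  refine PosDecr.of_tendsto (M := 1) (φ := fun N y =>
    Real.exp (-∫ s in Ioi (ε N), w s) * Real.exp (gaussMix (ε N) w y))
    (fun N => (posDecr_exp_gaussMix (hε0 N) mw hw0 (hi N)).const_mul (Real.exp_pos _).le)
    (fun N => ((measurable_gaussMix mw).exp).const_mul _) (fun N y => ?_) (fun y => ?_)
  · rw [← Real.exp_add, abs_of_pos (Real.exp_pos _), Real.exp_le_one_iff]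
    linarith [gaussMix_le (hε0 N) hw0 (hi N) y]
  · have e : ∀ N, Real.exp (-∫ s in Ioi (ε N), w s) * Real.exp (gaussMix (ε N) w y) =
        Real.exp (-∫ s in Ioi (ε N), c * ((1 - Real.exp (-(s * ‖y‖ ^ 2))) * s ^ (-1 - α))) := by
      intro N
      rw [← hdiff, ← Real.exp_add]; congr 1; ring
    simp only [e]
    have hU : ⋃ N, Ioi (ε N) = Ioi (0 : ℝ) := by
      ext s
      simp only [mem_iUnion, mem_Ioi]
      exact ⟨fun ⟨N, h⟩ => (hε0 N).trans h, fun h => exists_nat_one_div_lt h⟩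
    have hmono : Monotone fun N => Ioi (ε N) := fun N N' hN =>
      Ioi_subset_Ioi (one_div_le_one_div_of_le (by positivity) (by simpa using hN))
    have hlim := tendsto_setIntegral_of_monotone (μ := volume) (fun N => measurableSet_Ioi) hmono
      (f := fun s => c * ((1 - Real.exp (-(s * ‖y‖ ^ 2))) * s ^ (-1 - α))) (by rw [hU]; exact hf y)
    rw [hU, integral_const_mul, levy_scaling hα₀ (sq_nonneg _)] at hlim
    have : t * ‖y‖ ^ (2 * α) = c * ((‖y‖ ^ 2) ^ α * levyConst α) := by
      rw [Real.rpow_mul (norm_nonneg y), Real.rpow_two, hc]; field_simp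
    rw [this]
    exact (Real.continuous_exp.tendsto _).comp hlim.neg

/-- Since e^{-t|y|^{2α}} is itself integrable, the Gaussian regularisation can be removed by
dominated convergence. -/
theorem cosInt_exp_neg_rpow_nonneg_antitone [Nontrivial E] {α t : ℝ} (hα₀ : 0 < α) (hα₁ : α < 1)
    (ht : 0 < t) {x x' : E} (hx : ‖x‖ ≤ ‖x'‖) :
    0 ≤ cosInt (fun y : E => Real.exp (-(t * ‖y‖ ^ (2 * α)))) x' ∧
      cosInt (fun y : E => Real.exp (-(t * ‖y‖ ^ (2 * α)))) x' ≤
        cosInt (fun y : E => Real.exp (-(t * ‖y‖ ^ (2 * α)))) x := by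
  have hp := posDecr_exp_neg_rpow (E := E) hα₀ hα₁ ht
  have hδ : ∀ N : ℕ, 0 < 1 / ((N : ℝ) + 1) := fun N => by positivity
  have key := tendsto_cosInt
    (φ := fun (N : ℕ) (y : E) => Real.exp (-(1 / ((N : ℝ) + 1) * ‖y‖ ^ 2)) *
      Real.exp (-(t * ‖y‖ ^ (2 * α))))
    (fun N => by fun_prop)
    (integrable_exp_neg_norm_rpow (E := E) (a := 2 * α) (by positivity) ht)
    (fun N y => by
      rw [abs_of_pos (by positivity)]
      refine mul_le_of_le_one_left (Real.exp_pos _).le (Real.exp_le_one_iff.2 ?_)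
      simp only [Left.neg_nonpos_iff]; positivity)
    (ψ := fun y : E => Real.exp (-(t * ‖y‖ ^ (2 * α))))
    (fun y => by
      have h := (tendsto_one_div_add_atTop_nhds_zero_nat (𝕜 := ℝ)).mul_const (‖y‖ ^ 2)
      have h2 := ((Real.continuous_exp.tendsto _).comp h.neg).mul_const
        (Real.exp (-(t * ‖y‖ ^ (2 * α))))
      simpa using h2)
  exact ⟨ge_of_tendsto' (key x') fun N => (hp _ (hδ N) x x' hx).1,
    le_of_tendsto_of_tendsto' (key x') (key x) fun N => (hp _ (hδ N) x x' hx).2⟩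

end

/-! ### The kernel: sign, monotonicity, scaling, pointwise regularity and mass. -/

section Kernel

variable {n : ℕ} [NeZero n] {α t : ℝ}

theorem kernel_eq_cosInt (hα₀ : 0 < α) (ht : 0 < t) (x : EuclideanSpace ℝ (Fin n)) :
    kernel α t x = ((2 * Real.pi) ^ n)⁻¹ *
      cosInt (fun y : EuclideanSpace ℝ (Fin n) => Real.exp (-(t * ‖y‖ ^ (2 * α)))) x := by
  have hi := integrable_exp_neg_norm_rpow (E := EuclideanSpace ℝ (Fin n)) (a := 2 * α)
    (by positivity) ht
  have e : ∀ y : EuclideanSpace ℝ (Fin n),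
      Complex.exp (Complex.I * ((inner ℝ x y : ℝ) : ℂ) - ((t * ‖y‖ ^ (2 * α) : ℝ) : ℂ)) =
      Complex.exp (Complex.I * ((inner ℝ x y : ℝ) : ℂ)) *
        ((Real.exp (-(t * ‖y‖ ^ (2 * α))) : ℝ) : ℂ) := by
    intro y
    rw [Complex.ofReal_exp, ← Complex.exp_add]; congr 1; push_cast; ring
  have hint : Integrable fun y : EuclideanSpace ℝ (Fin n) =>
      Complex.exp (Complex.I * ((inner ℝ x y : ℝ) : ℂ)) *
        ((Real.exp (-(t * ‖y‖ ^ (2 * α))) : ℝ) : ℂ) := by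
    refine hi.ofReal.bdd_mul (c := 1) (by fun_prop) (Eventually.of_forall fun y => ?_)
    rw [mul_comm, Complex.norm_exp_ofReal_mul_I]
  rw [kernel, kernelIntegral, Complex.re_ofReal_mul]
  congr 1
  simp only [e]
  rw [← RCLike.re_eq_complex_re, ← integral_re hint, cosInt]
  congr 1
  ext y
  rw [RCLike.re_eq_complex_re, Complex.re_mul_ofReal, mul_comm Complex.I,
    Complex.exp_ofReal_mul_I_re]

theorem kernel_nonneg (hα₀ : 0 < α) (hα₁ : α < 1) (ht : 0 < t) (x : EuclideanSpace ℝ (Fin n)) :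
    0 ≤ kernel α t x := by
  rw [kernel_eq_cosInt hα₀ ht]
  exact mul_nonneg (by positivity) (cosInt_exp_neg_rpow_nonneg_antitone hα₀ hα₁ ht le_rfl).1

theorem kernel_antitone (hα₀ : 0 < α) (hα₁ : α < 1) (ht : 0 < t) {x x' : EuclideanSpace ℝ (Fin n)}
    (hx : ‖x‖ ≤ ‖x'‖) : kernel α t x' ≤ kernel α t x := by
  rw [kernel_eq_cosInt hα₀ ht, kernel_eq_cosInt hα₀ ht]
  exact mul_le_mul_of_nonneg_left (cosInt_exp_neg_rpow_nonneg_antitone hα₀ hα₁ ht hx).2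
    (by positivity)

/-- Substitute y ↦ t^{-1/(2α)} y. The extra parameter u serves to write τ + h as τ(1 + h/τ), which
reduces time increments at τ to increments at 1. -/
theorem kernel_scaling (hα₀ : 0 < α) (ht : 0 < t) {u : ℝ} (hu : 0 < u)
    (x : EuclideanSpace ℝ (Fin n)) :
    kernel α (t * u) x = t ^ (-(n / (2 * α))) * kernel α u (t ^ (-(1 / (2 * α))) • x) := by
  set r : ℝ := t ^ (-(1 / (2 * α))) with hr
  have hr0 : 0 < r := Real.rpow_pos_of_pos ht _
  have hrα : r ^ (2 * α) = t⁻¹ := by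
    rw [hr, ← Real.rpow_mul ht.le, ← Real.rpow_neg_one]; congr 1; field_simp
  have hrn : r ^ n = t ^ (-(n / (2 * α))) := by
    rw [hr, ← Real.rpow_natCast, ← Real.rpow_mul ht.le]; congr 1; field_simp
  rw [kernel_eq_cosInt hα₀ (mul_pos ht hu), kernel_eq_cosInt hα₀ hu, cosInt, cosInt]
  have h := Measure.integral_comp_smul (volume : Measure (EuclideanSpace ℝ (Fin n)))
    (fun y => Real.cos (inner ℝ x y) * Real.exp (-(t * u * ‖y‖ ^ (2 * α)))) r
  rw [finrank_euclideanSpace_fin, abs_of_pos (by positivity), smul_eq_mul] at h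
  have e : ∀ y : EuclideanSpace ℝ (Fin n), Real.cos (inner ℝ (r • x) y) *
      Real.exp (-(u * ‖y‖ ^ (2 * α))) =
      Real.cos (inner ℝ x (r • y)) * Real.exp (-(t * u * ‖r • y‖ ^ (2 * α))) := by
    intro y
    rw [real_inner_smul_left, real_inner_smul_right, norm_smul, Real.norm_eq_abs,
      abs_of_pos hr0, Real.mul_rpow hr0.le (norm_nonneg y), hrα]
    congr 3; field_simp
  simp only [e]
  rw [h, ← hrn]
  field_simp

theorem kernel_eq_scaling (hα₀ : 0 < α) (ht : 0 < t) (x : EuclideanSpace ℝ (Fin n)) :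
    kernel α t x = t ^ (-(n / (2 * α))) * kernel α 1 (t ^ (-(1 / (2 * α))) • x) := by
  simpa using kernel_scaling hα₀ ht one_pos x

/-- The cosine is 1-Lipschitz and |y| e^{-|y|^{2α}} is integrable. -/
theorem abs_kernel_sub_le (hα₀ : 0 < α) : ∃ C : ℝ, 0 ≤ C ∧ ∀ x x' : EuclideanSpace ℝ (Fin n),
    |kernel α 1 x - kernel α 1 x'| ≤ C * ‖x - x'‖ := by
  have hi := integrable_norm_rpow_mul_exp_neg (E := EuclideanSpace ℝ (Fin n)) (a := 2 * α)
    (by positivity) zero_le_one one_pos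
  have hi0 := integrable_exp_neg_norm_rpow (E := EuclideanSpace ℝ (Fin n)) (a := 2 * α)
    (by positivity) one_pos
  refine ⟨((2 * Real.pi) ^ n)⁻¹ * ∫ y : EuclideanSpace ℝ (Fin n),
    ‖y‖ ^ (1 : ℝ) * Real.exp (-(1 * ‖y‖ ^ (2 * α))), by positivity, fun x x' => ?_⟩
  rw [kernel_eq_cosInt hα₀ one_pos, kernel_eq_cosInt hα₀ one_pos, ← mul_sub, abs_mul,
    abs_of_pos (by positivity : 0 < ((2 * Real.pi) ^ n)⁻¹), mul_assoc]
  refine mul_le_mul_of_nonneg_left ?_ (by positivity)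
  rw [cosInt, cosInt, ← integral_sub (integrable_cos_mul hi0 x) (integrable_cos_mul hi0 x'),
    ← integral_mul_const, ← Real.norm_eq_abs]
  refine norm_integral_le_of_norm_le (hi.mul_const _) (Eventually.of_forall fun y => ?_)
  rw [← sub_mul, norm_mul, Real.norm_eq_abs, Real.norm_eq_abs, abs_of_pos (Real.exp_pos _)]
  have h1 : |Real.cos (inner ℝ x y) - Real.cos (inner ℝ x' y)| ≤ ‖x - x'‖ * ‖y‖ :=
    calc _ ≤ |inner ℝ x y - inner ℝ x' y| := by
          have := Real.lipschitzWith_cos.dist_le_mul (inner ℝ x y) (inner ℝ x' y)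
          simpa [Real.dist_eq] using this
      _ = |inner ℝ (x - x') y| := by rw [inner_sub_left]
      _ ≤ _ := abs_real_inner_le_norm _ _
  calc _ ≤ ‖x - x'‖ * ‖y‖ * Real.exp (-(1 * ‖y‖ ^ (2 * α))) :=
        mul_le_mul_of_nonneg_right h1 (Real.exp_pos _).le
    _ = _ := by rw [Real.rpow_one]; ring

theorem continuous_kernel_one (hα₀ : 0 < α) :
    Continuous (kernel α 1 : EuclideanSpace ℝ (Fin n) → ℝ) := by
  obtain ⟨C, hC, h⟩ := abs_kernel_sub_le (n := n) hα₀
  exact (LipschitzWith.of_dist_le_mul (K := ⟨C, hC⟩) fun x y => by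
    rw [Real.dist_eq, dist_eq_norm]; exact h x y).continuous

theorem abs_kernel_time_sub_le (hα₀ : 0 < α) : ∃ C : ℝ, 0 ≤ C ∧ ∀ h : ℝ, 0 ≤ h →
    ∀ x : EuclideanSpace ℝ (Fin n), |kernel α (1 + h) x - kernel α 1 x| ≤ C * h := by
  have hi := integrable_norm_rpow_mul_exp_neg (E := EuclideanSpace ℝ (Fin n)) (a := 2 * α)
    (c := 2 * α) (by positivity) (by positivity) one_pos
  have hi0 := fun t (ht : 0 < t) =>
    integrable_exp_neg_norm_rpow (E := EuclideanSpace ℝ (Fin n)) (a := 2 * α)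
      (by positivity) (t := t) ht
  refine ⟨((2 * Real.pi) ^ n)⁻¹ * ∫ y : EuclideanSpace ℝ (Fin n),
    ‖y‖ ^ (2 * α) * Real.exp (-(1 * ‖y‖ ^ (2 * α))), by positivity, fun h hh x => ?_⟩
  have h1 : 0 < 1 + h := by linarith
  rw [kernel_eq_cosInt hα₀ h1, kernel_eq_cosInt hα₀ one_pos, ← mul_sub, abs_mul,
    abs_of_pos (by positivity : 0 < ((2 * Real.pi) ^ n)⁻¹), mul_assoc]
  refine mul_le_mul_of_nonneg_left ?_ (by positivity)
  rw [cosInt, cosInt, ← integral_sub (integrable_cos_mul (hi0 _ h1) x)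
    (integrable_cos_mul (hi0 1 one_pos) x), ← integral_mul_const, ← Real.norm_eq_abs]
  refine norm_integral_le_of_norm_le (hi.mul_const _) (Eventually.of_forall fun y => ?_)
  rw [← mul_sub, norm_mul]
  set R := ‖y‖ ^ (2 * α) with hR
  have hR0 : 0 ≤ R := by positivity
  have h2 : Real.exp (-((1 + h) * R)) = Real.exp (-(1 * R)) * Real.exp (-(h * R)) := by
    rw [← Real.exp_add]; congr 1; ring
  have h3 : |Real.exp (-((1 + h) * R)) - Real.exp (-(1 * R))| ≤ R * Real.exp (-(1 * R)) * h := by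
    have h4 : Real.exp (-(h * R)) ≤ 1 := Real.exp_le_one_iff.2 (by
      simp only [Left.neg_nonpos_iff]; positivity)
    rw [h2, abs_sub_comm, abs_of_nonneg (by
      nlinarith [Real.exp_pos (-(1 * R))])]
    nlinarith [Real.exp_pos (-(1 * R)), Real.add_one_le_exp (-(h * R))]
  calc _ ≤ 1 * (R * Real.exp (-(1 * R)) * h) :=
        mul_le_mul (by simpa using Real.abs_cos_le_one _) h3 (abs_nonneg _) zero_le_one
    _ = _ := one_mul _

/-- Fubini moves the Gaussian to the frequency side, where it becomes a Gaussian of total mass 1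
(with the factor (2π)^{-n} included) tested against e^{-|y|^{2α}} ≤ 1. -/
theorem integral_kernel_mul_gaussian_le (hα₀ : 0 < α) {ε : ℝ} (hε : 0 < ε) :
    ∫ x : EuclideanSpace ℝ (Fin n), kernel α 1 x * Real.exp (-(ε * ‖x‖ ^ 2)) ≤ 1 := by
  have hi0 := integrable_exp_neg_norm_rpow (E := EuclideanSpace ℝ (Fin n)) (a := 2 * α)
    (by positivity) one_pos
  have hg := integrable_exp_neg_mul_norm_sq (E := EuclideanSpace ℝ (Fin n)) hε
  have hint : Integrable (Function.uncurry fun x y : EuclideanSpace ℝ (Fin n) =>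
      Real.cos (inner ℝ y x) * (Real.exp (-(ε * ‖x‖ ^ 2)) * Real.exp (-(1 * ‖y‖ ^ (2 * α))))) := by
    refine (hg.mul_prod hi0).bdd_mul (c := 1) (by fun_prop) (Eventually.of_forall fun q => ?_)
    simpa using Real.abs_cos_le_one _
  have hsw := integral_integral_swap hint
  have hd := finrank_euclideanSpace_fin (𝕜 := ℝ) (n := n)
  have hε4 : 0 < 1 / (4 * ε) := by positivity
  have hg4 := integrable_exp_neg_mul_norm_sq (E := EuclideanSpace ℝ (Fin n)) hε4
  have hval : ∫ y : EuclideanSpace ℝ (Fin n), Real.exp (-(1 / (4 * ε) * ‖y‖ ^ 2)) =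
      (Real.pi / (1 / (4 * ε))) ^ ((n : ℝ) / 2) := by
    have := GaussianFourier.integral_rexp_neg_mul_sq_norm (V := EuclideanSpace ℝ (Fin n)) hε4
    rw [hd] at this
    simpa only [neg_mul] using this
  calc ∫ x : EuclideanSpace ℝ (Fin n), kernel α 1 x * Real.exp (-(ε * ‖x‖ ^ 2))
      = ((2 * Real.pi) ^ n)⁻¹ * ∫ x : EuclideanSpace ℝ (Fin n), ∫ y : EuclideanSpace ℝ (Fin n),
        Real.cos (inner ℝ y x) *
          (Real.exp (-(ε * ‖x‖ ^ 2)) * Real.exp (-(1 * ‖y‖ ^ (2 * α)))) := by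
        rw [← integral_const_mul]
        congr 1; ext x
        rw [kernel_eq_cosInt hα₀ one_pos, cosInt, mul_assoc, ← integral_mul_const]
        congr 2; ext y; rw [real_inner_comm]; ring
    _ = ((2 * Real.pi) ^ n)⁻¹ * ∫ y : EuclideanSpace ℝ (Fin n),
        (Real.pi / ε) ^ ((n : ℝ) / 2) * Real.exp (-(1 / (4 * ε) * ‖y‖ ^ 2)) *
          Real.exp (-(1 * ‖y‖ ^ (2 * α))) := by
        rw [hsw]
        congr 2; ext y
        have := cosInt_gaussian hε y
        rw [hd] at this
        rw [one_div_mul_eq_div, ← this, cosInt, ← integral_mul_const]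
        congr 1; ext x; ring
    _ ≤ ((2 * Real.pi) ^ n)⁻¹ * ∫ y : EuclideanSpace ℝ (Fin n),
        (Real.pi / ε) ^ ((n : ℝ) / 2) * Real.exp (-(1 / (4 * ε) * ‖y‖ ^ 2)) := by
        refine mul_le_mul_of_nonneg_left (integral_mono_of_nonneg
          (Eventually.of_forall fun y => by positivity) (hg4.const_mul _)
          (Eventually.of_forall fun y => ?_)) (by positivity)
        refine mul_le_of_le_one_right (by positivity) (Real.exp_le_one_iff.2 ?_)
        simp only [Left.neg_nonpos_iff]; positivity
    _ = 1 := by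
        rw [integral_const_mul, hval, ← Real.mul_rpow (by positivity) (by positivity)]
        have : Real.pi / ε * (Real.pi / (1 / (4 * ε))) = (2 * Real.pi) ^ (2 : ℝ) := by
          rw [Real.rpow_two]; field_simp; ring
        rw [this, ← Real.rpow_mul (by positivity), ← Real.rpow_natCast]
        have h2 : (2 : ℝ) * ((n : ℝ) / 2) = n := by ring
        rw [h2]
        exact inv_mul_cancel₀ (by positivity)

/-- Fatou's lemma as the Gaussian flattens; this uses K ≥ 0. It is how integrability of K is
obtained, and the inequality suffices throughout. -/
theorem lintegral_kernel_one_le (hα₀ : 0 < α) (hα₁ : α < 1) :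
    ∫⁻ x : EuclideanSpace ℝ (Fin n), ENNReal.ofReal (kernel α 1 x) ≤ 1 := by
  have hk := continuous_kernel_one (n := n) hα₀
  have hn := kernel_nonneg (n := n) hα₀ hα₁ one_pos
  set ε : ℕ → ℝ := fun N => 1 / ((N : ℝ) + 1) with hε
  have hε0 : ∀ N, 0 < ε N := fun N => by simp only [hε]; positivity
  have hlim : ∀ x : EuclideanSpace ℝ (Fin n), Tendsto
      (fun N => ENNReal.ofReal (kernel α 1 x * Real.exp (-(ε N * ‖x‖ ^ 2)))) atTop
      (𝓝 (ENNReal.ofReal (kernel α 1 x))) := by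
    intro x
    have h := (tendsto_one_div_add_atTop_nhds_zero_nat (𝕜 := ℝ)).mul_const (‖x‖ ^ 2)
    have h2 := ((Real.continuous_exp.tendsto _).comp h.neg).const_mul (kernel α 1 x)
    refine ENNReal.tendsto_ofReal ?_
    simpa [hε] using h2
  calc ∫⁻ x : EuclideanSpace ℝ (Fin n), ENNReal.ofReal (kernel α 1 x)
      = ∫⁻ x : EuclideanSpace ℝ (Fin n), liminf
        (fun N => ENNReal.ofReal (kernel α 1 x * Real.exp (-(ε N * ‖x‖ ^ 2)))) atTop := by
        congr 1; ext x; rw [(hlim x).liminf_eq]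
    _ ≤ liminf (fun N => ∫⁻ x : EuclideanSpace ℝ (Fin n),
        ENNReal.ofReal (kernel α 1 x * Real.exp (-(ε N * ‖x‖ ^ 2)))) atTop :=
        lintegral_liminf_le fun N => by have := hk.measurable; fun_prop
    _ ≤ liminf (fun _ : ℕ => (1 : ℝ≥0∞)) atTop := by
        refine liminf_le_liminf (Eventually.of_forall fun N => ?_)
        have hb : Integrable fun x : EuclideanSpace ℝ (Fin n) =>
            kernel α 1 x * Real.exp (-(ε N * ‖x‖ ^ 2)) := by
          refine (integrable_exp_neg_mul_norm_sq (hε0 N)).bdd_mul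
            (c := kernel α 1 (0 : EuclideanSpace ℝ (Fin n)))
            hk.aestronglyMeasurable (Eventually.of_forall fun x => ?_)
          rw [Real.norm_eq_abs, abs_of_nonneg (hn x)]
          exact kernel_antitone hα₀ hα₁ one_pos (by simp)
        rw [← ofReal_integral_eq_lintegral_ofReal hb
          (Eventually.of_forall fun x => mul_nonneg (hn x) (Real.exp_pos _).le)]
        exact ENNReal.ofReal_le_one.2 (integral_kernel_mul_gaussian_le hα₀ (hε0 N))
    _ = 1 := by simp

theorem integrable_kernel_one (hα₀ : 0 < α) (hα₁ : α < 1) :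
    Integrable (kernel α 1 : EuclideanSpace ℝ (Fin n) → ℝ) := by
  refine ⟨(continuous_kernel_one hα₀).aestronglyMeasurable, ?_⟩
  rw [hasFiniteIntegral_iff_ofReal (Eventually.of_forall (kernel_nonneg hα₀ hα₁ one_pos))]
  exact (lintegral_kernel_one_le hα₀ hα₁).trans_lt ENNReal.one_lt_top

theorem integral_kernel_one_le (hα₀ : 0 < α) (hα₁ : α < 1) :
    ∫ x : EuclideanSpace ℝ (Fin n), kernel α 1 x ≤ 1 := by
  rw [integral_eq_lintegral_of_nonneg_ae (Eventually.of_forall (kernel_nonneg hα₀ hα₁ one_pos))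
    (continuous_kernel_one hα₀).aestronglyMeasurable]
  exact ENNReal.toReal_le_of_le_ofReal zero_le_one (by simpa using lintegral_kernel_one_le hα₀ hα₁)

end Kernel

/-! ### Fourier inversion and the L¹ moduli of continuity of the kernel. -/

theorem kernelIntegral_one_eq_fourierInv {n : ℕ} {α : ℝ} (w : EuclideanSpace ℝ (Fin n)) :
    kernelIntegral α 1 w =
      𝓕⁻ (fun v : EuclideanSpace ℝ (Fin n) =>
        ((Real.exp (-(‖(2 * Real.pi) • v‖ ^ (2 * α))) : ℝ) : ℂ)) w := by
  have h := Measure.integral_comp_smul (volume : Measure (EuclideanSpace ℝ (Fin n)))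
    (fun y => Complex.exp (Complex.I * ((inner ℝ w y : ℝ) : ℂ) - ((1 * ‖y‖ ^ (2 * α) : ℝ) : ℂ)))
    (2 * Real.pi)
  rw [finrank_euclideanSpace_fin, abs_of_pos (by positivity), Complex.real_smul] at h
  rw [kernelIntegral, ← h, Real.fourierInv_eq']
  congr 1
  ext v
  rw [smul_eq_mul, Complex.ofReal_exp, ← Complex.exp_add, real_inner_smul_right, real_inner_comm]
  congr 1
  push_cast
  ring

section Kernel

variable {n : ℕ} [NeZero n] {α : ℝ}

theorem cosInt_kernel_one (hα₀ : 0 < α) (hα₁ : α < 1) (η : EuclideanSpace ℝ (Fin n)) :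
    cosInt (kernel α 1) η = Real.exp (-(‖η‖ ^ (2 * α))) := by
  set f : EuclideanSpace ℝ (Fin n) → ℂ := fun v =>
    ((Real.exp (-(‖(2 * Real.pi) • v‖ ^ (2 * α))) : ℝ) : ℂ) with hf
  have h2α : 0 ≤ 2 * α := by positivity
  have hcont : Continuous f := by
    refine Complex.continuous_ofReal.comp (Real.continuous_exp.comp (Continuous.neg ?_))
    exact (by fun_prop : Continuous fun v : EuclideanSpace ℝ (Fin n) =>
      ‖(2 * Real.pi) • v‖).rpow_const fun _ => Or.inr h2α
  have hint : Integrable f := by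
    have h := (integrable_exp_neg_norm_rpow (E := EuclideanSpace ℝ (Fin n)) (a := 2 * α)
      (by positivity) one_pos).comp_smul (R := 2 * Real.pi) (by positivity)
    simp only [one_mul] at h
    exact h.ofReal
  have hinv : 𝓕⁻ f = fun w => ((kernel α 1 w : ℝ) : ℂ) := by
    ext w
    rw [ofReal_kernel, kernelIntegral_one_eq_fourierInv]
  have hk := integrable_kernel_one (n := n) hα₀ hα₁
  -- Inversion needs an integrable transform; up to reflection the transform is the kernel, whose
  -- integrability was proved from its sign.
  have hF : Integrable (𝓕 f) := by
    have : 𝓕 f = fun w => 𝓕⁻ f (-w) := by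
      ext w; rw [Real.fourierInv_eq_fourier_neg, neg_neg]
    rw [this, hinv]
    exact (hk.comp_neg).ofReal
  have key := congrFun (hcont.fourier_fourierInv_eq hint hF) ((2 * Real.pi)⁻¹ • η)
  rw [hinv, Real.fourier_eq'] at key
  have hi : Integrable fun v : EuclideanSpace ℝ (Fin n) =>
      Complex.exp (((-2 * Real.pi * inner ℝ v ((2 * Real.pi)⁻¹ • η) : ℝ) : ℂ) * Complex.I) •
        ((kernel α 1 v : ℝ) : ℂ) := by
    simp only [smul_eq_mul]
    refine hk.ofReal.bdd_mul (c := 1) (by fun_prop) (Eventually.of_forall fun v => ?_)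
    rw [Complex.norm_exp_ofReal_mul_I]
  have key2 := congrArg Complex.re key
  rw [← RCLike.re_eq_complex_re, ← integral_re hi] at key2
  have e1 : ‖(2 * Real.pi) • (2 * Real.pi)⁻¹ • η‖ = ‖η‖ := by
    rw [smul_smul, mul_inv_cancel₀ (by positivity), one_smul]
  rw [RCLike.re_eq_complex_re, hf] at key2
  simp only [Complex.ofReal_re, e1] at key2
  rw [← key2, cosInt]
  congr 1
  ext v
  rw [smul_eq_mul, Complex.re_mul_ofReal, Complex.exp_ofReal_mul_I_re,
    real_inner_smul_right, real_inner_comm, ← Real.cos_neg]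
  congr 2
  field_simp

/-- The one-dimensional marginals of K have characteristic function e^{-|ξ|^{2α}}, which is
integrable, so they have bounded densities. The argument avoids marginals: it majorises the
indicator of the slab by the transform of a Gaussian and applies Fubini. -/
theorem setIntegral_kernel_slab_le (hα₀ : 0 < α) (hα₁ : α < 1) : ∃ C : ℝ, 0 ≤ C ∧
    ∀ e : EuclideanSpace ℝ (Fin n), ‖e‖ = 1 → ∀ a : ℝ, 0 < a →
      ∫ x in {x | |inner ℝ x e| ≤ a}, kernel α 1 x ≤ C * a := by
  have hk := integrable_kernel_one (n := n) hα₀ hα₁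
  have hk0 := kernel_nonneg (n := n) hα₀ hα₁ one_pos
  have h1 := integrable_exp_neg_norm_rpow (E := ℝ) (a := 2 * α) (by positivity) one_pos
  refine ⟨2 * ∫ ξ : ℝ, Real.exp (-(1 * ‖ξ‖ ^ (2 * α))),
    mul_nonneg two_pos.le (integral_nonneg fun _ => (Real.exp_pos _).le), fun e he a ha => ?_⟩
  have hb : 0 < a ^ 2 / 2 := by positivity
  have hg := integrable_exp_neg_mul_norm_sq (E := ℝ) hb
  have hint : Integrable (Function.uncurry fun (x : EuclideanSpace ℝ (Fin n)) (ξ : ℝ) =>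
      Real.cos (inner ℝ (inner ℝ x e : ℝ) ξ) *
        (kernel α 1 x * Real.exp (-(a ^ 2 / 2 * ‖ξ‖ ^ 2)))) := by
    refine (hk.mul_prod hg).bdd_mul (c := 1) (by fun_prop) (Eventually.of_forall fun q => ?_)
    simpa using Real.abs_cos_le_one _
  -- The transform at s is (√(2π)/a) e^{-s²/(2a²)}, which is at least 1/(2a) for |s| ≤ a.
  have hmaj : ∀ s : ℝ, |s| ≤ a →
      1 ≤ 2 * a * cosInt (fun ξ : ℝ => Real.exp (-(a ^ 2 / 2 * ‖ξ‖ ^ 2))) s := by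
    intro s hs
    rw [cosInt_gaussian hb]
    have h2 : a⁻¹ ≤ (Real.pi / (a ^ 2 / 2)) ^ ((Module.finrank ℝ ℝ : ℝ) / 2) := by
      rw [Module.finrank_self, Nat.cast_one, ← Real.sqrt_eq_rpow]
      refine Real.le_sqrt_of_sq_le ?_
      rw [inv_pow, le_div_iff₀ hb]
      field_simp
      linarith [Real.pi_gt_three]
    have h3 : (1 : ℝ) / 2 ≤ Real.exp (-(‖s‖ ^ 2 / (4 * (a ^ 2 / 2)))) := by
      have h4 : ‖s‖ ^ 2 ≤ a ^ 2 := pow_le_pow_left₀ (norm_nonneg _) hs 2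
      have h5 : ‖s‖ ^ 2 / (4 * (a ^ 2 / 2)) ≤ 1 / 2 := by
        rw [div_le_div_iff₀ (by positivity) two_pos]; linarith
      linarith [Real.add_one_le_exp (-(‖s‖ ^ 2 / (4 * (a ^ 2 / 2))))]
    calc (1 : ℝ) = 2 * a * (a⁻¹ * (1 / 2)) := by field_simp
      _ ≤ _ := by gcongr
  have hpos : ∀ s : ℝ, 0 ≤ cosInt (fun ξ : ℝ => Real.exp (-(a ^ 2 / 2 * ‖ξ‖ ^ 2))) s := by
    intro s
    rw [cosInt_gaussian hb]; positivity
  have hinner : ∀ x : EuclideanSpace ℝ (Fin n),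
      ∫ ξ : ℝ, Real.cos (inner ℝ (inner ℝ x e : ℝ) ξ) *
        (kernel α 1 x * Real.exp (-(a ^ 2 / 2 * ‖ξ‖ ^ 2))) =
      kernel α 1 x * cosInt (fun ξ : ℝ => Real.exp (-(a ^ 2 / 2 * ‖ξ‖ ^ 2))) (inner ℝ x e) := by
    intro x
    rw [cosInt, ← integral_const_mul]
    congr 1; ext ξ; ring
  have hI := hint.integral_prod_left
  simp only [Function.uncurry, hinner] at hI
  have hms : MeasurableSet {x : EuclideanSpace ℝ (Fin n) | |inner ℝ x e| ≤ a} :=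
    measurableSet_le (by fun_prop) measurable_const
  calc ∫ x in {x | |inner ℝ x e| ≤ a}, kernel α 1 x
      ≤ ∫ x in {x : EuclideanSpace ℝ (Fin n) | |inner ℝ x e| ≤ a}, 2 * a * (kernel α 1 x *
          cosInt (fun ξ : ℝ => Real.exp (-(a ^ 2 / 2 * ‖ξ‖ ^ 2))) (inner ℝ x e)) := by
        refine setIntegral_mono_on hk.integrableOn (hI.const_mul _).integrableOn hms fun x hx => ?_
        have := mul_le_mul_of_nonneg_left (hmaj _ hx) (hk0 x)
        linarith
    _ ≤ ∫ x : EuclideanSpace ℝ (Fin n), 2 * a * (kernel α 1 x *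
          cosInt (fun ξ : ℝ => Real.exp (-(a ^ 2 / 2 * ‖ξ‖ ^ 2))) (inner ℝ x e)) :=
        setIntegral_le_integral (hI.const_mul _) (Eventually.of_forall fun x =>
          mul_nonneg (by positivity) (mul_nonneg (hk0 x) (hpos _)))
    _ = 2 * a * ∫ ξ : ℝ, Real.exp (-(a ^ 2 / 2 * ‖ξ‖ ^ 2)) * Real.exp (-(1 * ‖ξ‖ ^ (2 * α))) := by
        rw [integral_const_mul]
        simp only [← hinner]
        rw [integral_integral_swap hint]
        congr 2; ext ξ
        have hnorm : ‖ξ • e‖ = ‖ξ‖ := by rw [norm_smul, he, mul_one]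
        rw [one_mul, ← hnorm, ← cosInt_kernel_one hα₀ hα₁ (ξ • e), hnorm, cosInt,
          ← integral_const_mul]
        congr 1; ext x
        rw [real_inner_smul_left, real_inner_comm x e]
        have h6 : inner ℝ (inner ℝ x e : ℝ) ξ = ξ * inner ℝ x e := by simp
        rw [h6]
        ring
    _ ≤ 2 * a * ∫ ξ : ℝ, Real.exp (-(1 * ‖ξ‖ ^ (2 * α))) := by
        refine mul_le_mul_of_nonneg_left (integral_mono_of_nonneg
          (Eventually.of_forall fun ξ => by positivity) h1
          (Eventually.of_forall fun ξ => ?_)) (by positivity)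
        refine mul_le_of_le_one_left (Real.exp_pos _).le (Real.exp_le_one_iff.2 ?_)
        simp only [Left.neg_nonpos_iff]; positivity
    _ = _ := by ring

/-- By radial monotonicity the increment is nonnegative on the half-space H and nonpositive off it,
and its total integral is 0, so its L¹ norm is twice its integral over H. Shifting turns that
integral into the mass of H' = H + h minus the mass of H, hence at most the mass of a slab of
half-width |h|/2. -/
theorem integral_abs_kernel_translate_sub_le (hα₀ : 0 < α) (hα₁ : α < 1) : ∃ C : ℝ, 0 ≤ C ∧
    ∀ h : EuclideanSpace ℝ (Fin n), ∫ x, |kernel α 1 (x + h) - kernel α 1 x| ≤ C * ‖h‖ := by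
  obtain ⟨C, hC, hslab⟩ := setIntegral_kernel_slab_le (n := n) hα₀ hα₁
  refine ⟨C, hC, fun h => ?_⟩
  rcases eq_or_ne h 0 with rfl | hh
  · simp
  have hh0 : 0 < ‖h‖ := norm_pos_iff.2 hh
  have hk := integrable_kernel_one (n := n) hα₀ hα₁
  have hk0 := kernel_nonneg (n := n) hα₀ hα₁ one_pos
  have hkh : Integrable fun x : EuclideanSpace ℝ (Fin n) => kernel α 1 (x + h) :=
    hk.comp_add_right h
  set H : Set (EuclideanSpace ℝ (Fin n)) := {x | ‖x + h‖ ≤ ‖x‖} with hH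
  set H' : Set (EuclideanSpace ℝ (Fin n)) := {x | ‖x‖ ≤ ‖x - h‖} with hH'
  set S : Set (EuclideanSpace ℝ (Fin n)) := {x | |inner ℝ x (‖h‖⁻¹ • h)| ≤ ‖h‖ / 2} with hS
  have mH : MeasurableSet H := measurableSet_le (by fun_prop) (by fun_prop)
  have mH' : MeasurableSet H' := measurableSet_le (by fun_prop) (by fun_prop)
  have mS : MeasurableSet S := measurableSet_le (by fun_prop) (by fun_prop)
  have hsub : H' ⊆ H ∪ S := by
    intro x hx
    by_cases hxH : x ∈ H
    · exact Or.inl hxH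
    refine Or.inr ?_
    simp only [hH, hH', mem_ofPred_eq, not_le] at hx hxH
    have e1 := norm_sub_sq_real x h
    have e2 := norm_add_sq_real x h
    have l1 : ‖x‖ ^ 2 ≤ ‖x - h‖ ^ 2 := pow_le_pow_left₀ (norm_nonneg _) hx 2
    have l2 : ‖x‖ ^ 2 ≤ ‖x + h‖ ^ 2 := pow_le_pow_left₀ (norm_nonneg _) hxH.le 2
    simp only [hS, mem_ofPred_eq, real_inner_smul_right]
    rw [abs_mul, abs_of_pos (inv_pos.2 hh0), inv_mul_le_iff₀ hh0, abs_le]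
    constructor <;> nlinarith
  -- Writing D for the increment, |D| = 2·1_H D - D and ∫ D = 0.
  have e1 : ∫ x, |kernel α 1 (x + h) - kernel α 1 x| =
      2 * ∫ x in H, (kernel α 1 (x + h) - kernel α 1 x) := by
    have hz : ∫ x : EuclideanSpace ℝ (Fin n), (kernel α 1 (x + h) - kernel α 1 x) = 0 := by
      rw [integral_sub hkh hk, integral_add_right_eq_self (kernel α 1) h, sub_self]
    have hD : Integrable fun x : EuclideanSpace ℝ (Fin n) => kernel α 1 (x + h) - kernel α 1 x :=
      hkh.sub hk
    rw [← integral_indicator mH, ← integral_const_mul, ← sub_zero (∫ x, _ * _), ← hz,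
      ← integral_sub ((hD.indicator mH).const_mul 2) hD]
    congr 1; ext x
    by_cases hx : x ∈ H
    · rw [indicator_of_mem hx, abs_of_nonneg (sub_nonneg.2 (kernel_antitone hα₀ hα₁ one_pos hx))]
      ring
    · rw [indicator_of_notMem hx, abs_of_nonpos (sub_nonpos.2 (kernel_antitone hα₀ hα₁ one_pos
        (not_le.1 hx).le))]
      ring
  have e2 : ∫ x in H, kernel α 1 (x + h) = ∫ x in H', kernel α 1 x := by
    rw [← integral_indicator mH, ← integral_indicator mH',
      ← integral_add_right_eq_self (H'.indicator (kernel α 1)) h]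
    congr 1; ext x
    simp only [indicator, hH, hH', mem_ofPred_eq, add_sub_cancel_right]
  have e3 : ∫ x in H', kernel α 1 x ≤ (∫ x in H, kernel α 1 x) + ∫ x in S, kernel α 1 x := by
    rw [← integral_indicator mH, ← integral_indicator mH', ← integral_indicator mS,
      ← integral_add (hk.indicator mH) (hk.indicator mS)]
    refine integral_mono (hk.indicator mH') ((hk.indicator mH).add (hk.indicator mS)) fun x => ?_
    have p1 : 0 ≤ H.indicator (kernel α 1) x := indicator_nonneg (fun x _ => hk0 x) x
    have p2 : 0 ≤ S.indicator (kernel α 1) x := indicator_nonneg (fun x _ => hk0 x) x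
    by_cases hx : x ∈ H'
    · rw [indicator_of_mem hx]
      rcases hsub hx with hx' | hx'
      · simp only [indicator_of_mem hx']; linarith
      · simp only [indicator_of_mem hx']; linarith
    · rw [indicator_of_notMem hx]; exact add_nonneg p1 p2
  have e4 := hslab (‖h‖⁻¹ • h) (by rw [norm_smul, norm_inv, norm_norm, inv_mul_cancel₀ hh0.ne'])
    (‖h‖ / 2) (by positivity)
  rw [e1, integral_sub hkh.integrableOn hk.integrableOn, e2]
  linarith

/-- Here K_{1+h}(x) = R K(rx) with r ≤ 1 and R = r^n, and K(rx) ≥ K(x) by monotonicity. Splitting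
the difference as R(K(rx) - K(x)) - (1 - R)K(x) makes both pieces of known sign and of integral (1 -
R)∫K, and 1 - R is at most both 1 and nh/(2α). -/
theorem integral_abs_kernel_time_sub_le (hα₀ : 0 < α) (hα₁ : α < 1) {h : ℝ} (hh : 0 ≤ h) :
    ∫ x : EuclideanSpace ℝ (Fin n), |kernel α (1 + h) x - kernel α 1 x| ≤ 2 * (n / (2 * α)) * h ∧
    ∫ x : EuclideanSpace ℝ (Fin n), |kernel α (1 + h) x - kernel α 1 x| ≤ 2 := by
  have hu : 0 < 1 + h := by linarith
  have hk := integrable_kernel_one (n := n) hα₀ hα₁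
  have hk0 := kernel_nonneg (n := n) hα₀ hα₁ one_pos
  set r : ℝ := (1 + h) ^ (-(1 / (2 * α))) with hr
  set R : ℝ := (1 + h) ^ (-(n / (2 * α))) with hR
  have hr0 : 0 < r := Real.rpow_pos_of_pos hu _
  have hr1 : r ≤ 1 := Real.rpow_le_one_of_one_le_of_nonpos (by linarith) (by
    simp only [Left.neg_nonpos_iff]; positivity)
  have hR0 : 0 < R := Real.rpow_pos_of_pos hu _
  have hR1 : R ≤ 1 := Real.rpow_le_one_of_one_le_of_nonpos (by linarith) (by
    simp only [Left.neg_nonpos_iff]; positivity)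
  have hrn : r ^ n = R := by
    rw [hr, hR, ← Real.rpow_natCast, ← Real.rpow_mul hu.le]; congr 1; field_simp
  have hRlow : 1 - R ≤ n / (2 * α) * h := by
    have h1 : R = Real.exp (-(n / (2 * α) * Real.log (1 + h))) := by
      rw [hR, Real.rpow_def_of_pos hu]; congr 1; ring
    have h2 := Real.add_one_le_exp (-(n / (2 * α) * Real.log (1 + h)))
    have h3 : Real.log (1 + h) ≤ h := by linarith [Real.log_le_sub_one_of_pos hu]
    have h4 : n / (2 * α) * Real.log (1 + h) ≤ n / (2 * α) * h :=
      mul_le_mul_of_nonneg_left h3 (by positivity)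
    rw [← h1] at h2
    linarith
  have hkr : Integrable fun x : EuclideanSpace ℝ (Fin n) => kernel α 1 (r • x) :=
    hk.comp_smul hr0.ne'
  have hval := Measure.integral_comp_smul (volume : Measure (EuclideanSpace ℝ (Fin n)))
    (kernel α 1) r
  rw [finrank_euclideanSpace_fin, abs_of_pos (by positivity), smul_eq_mul, hrn] at hval
  have hI := integral_kernel_one_le (n := n) hα₀ hα₁
  have hI0 : 0 ≤ ∫ x : EuclideanSpace ℝ (Fin n), kernel α 1 x := integral_nonneg hk0
  have main : ∫ x : EuclideanSpace ℝ (Fin n), |kernel α (1 + h) x - kernel α 1 x| ≤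
      2 * (1 - R) := by
    calc _ ≤ ∫ x : EuclideanSpace ℝ (Fin n),
          (R * (kernel α 1 (r • x) - kernel α 1 x) + (1 - R) * kernel α 1 x) := by
          refine integral_mono_of_nonneg (Eventually.of_forall fun x => abs_nonneg _)
            (((hkr.sub hk).const_mul R).add (hk.const_mul (1 - R)))
            (Eventually.of_forall fun x => ?_)
          have hx : kernel α 1 x ≤ kernel α 1 (r • x) := by
            refine kernel_antitone hα₀ hα₁ one_pos ?_
            rw [norm_smul, Real.norm_eq_abs, abs_of_pos hr0]
            exact mul_le_of_le_one_left (norm_nonneg _) hr1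
          simp only
          rw [kernel_eq_scaling hα₀ hu, ← hr, ← hR, abs_le]
          have a1 := mul_nonneg hR0.le (sub_nonneg.2 hx)
          have a2 := mul_nonneg (sub_nonneg.2 hR1) (hk0 x)
          constructor <;> linarith
      _ = 2 * (1 - R) * ∫ x : EuclideanSpace ℝ (Fin n), kernel α 1 x := by
          have hs : Integrable fun x : EuclideanSpace ℝ (Fin n) =>
            kernel α 1 (r • x) - kernel α 1 x := hkr.sub hk
          rw [integral_add (hs.const_mul R) (hk.const_mul (1 - R)), integral_const_mul,
            integral_const_mul, integral_sub hkr hk, hval]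
          field_simp
          ring
      _ ≤ 2 * (1 - R) := mul_le_of_le_one_right (by linarith) hI
  constructor <;> linarith

end Kernel

/-! ### Young-type inequalities for kernels controlled in L¹ and L^∞. -/

section Convolution

variable {E : Type*} [MeasurableSpace E]

/-- `D` is measurable, `‖D‖₁ ≤ a` and `‖D‖_∞ ≤ a b`. -/
structure KernelBound (μ : Measure E) (D : E → ℝ) (a b : ℝ) : Prop where
  measurable : Measurable D
  lintegral_le : ∫⁻ x, ‖D x‖ₑ ∂μ ≤ ENNReal.ofReal a
  enorm_le : ∀ x, ‖D x‖ₑ ≤ ENNReal.ofReal (a * b)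

/-- Hölder applied to kf = k^{1-1/p} (k f^p)^{1/p}; this form covers p = 1 without a separate case.
-/
theorem lintegral_mul_le_weighted {μ : Measure E} {k f : E → ℝ≥0∞} (hk : Measurable k)
    (hf : Measurable f) {p : ℝ} (hp : 1 ≤ p) :
    ∫⁻ y, k y * f y ∂μ ≤
      (∫⁻ y, k y ∂μ) ^ (1 - 1 / p) * (∫⁻ y, k y * f y ^ p ∂μ) ^ (1 / p) := by
  have hp0 : 0 < p := by linarith
  have h1 : 0 ≤ 1 - 1 / p := by
    rw [sub_nonneg, div_le_one hp0]; exact hp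
  have h2 : 0 ≤ 1 / p := by positivity
  refine le_trans (le_of_eq ?_) (ENNReal.lintegral_mul_norm_pow_le hk.aemeasurable
    (hk.mul (hf.pow_const p)).aemeasurable h1 h2 (by ring))
  refine lintegral_congr fun y => ?_
  simp only [Pi.mul_apply]
  rw [ENNReal.mul_rpow_of_nonneg _ _ h2, ← ENNReal.rpow_mul, mul_one_div_cancel hp0.ne',
    ENNReal.rpow_one, ← mul_assoc, ← ENNReal.rpow_add_of_nonneg _ _ h1 h2]
  simp

variable [NormedAddCommGroup E] [BorelSpace E] {μ : Measure E} [μ.IsAddLeftInvariant]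
  [μ.IsNegInvariant]

theorem lintegral_enorm_sub_left {D : E → ℝ} (x : E) :
    ∫⁻ y, ‖D (x - y)‖ₑ ∂μ = ∫⁻ y, ‖D y‖ₑ ∂μ :=
  lintegral_sub_left_eq_self (fun y => ‖D y‖ₑ) x

/-- The L^p to L^∞ bound: the weighted Hölder inequality gives a^{1-1/p} (ab)^{1/p} = a b^{1/p}. -/
theorem KernelBound.lintegral_conv_le {D : E → ℝ} {a b p : ℝ} (h : KernelBound μ D a b)
    (ha : 0 ≤ a) (hb : 0 ≤ b) (hp : 1 ≤ p) {f : E → ℝ≥0∞} (hf : Measurable f) (x : E) :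
    ∫⁻ y, ‖D (x - y)‖ₑ * f y ∂μ ≤
      ENNReal.ofReal (a * b ^ (1 / p)) * (∫⁻ y, f y ^ p ∂μ) ^ (1 / p) := by
  have hp0 : 0 < p := by linarith
  have h1 : 0 ≤ 1 - 1 / p := by
    rw [sub_nonneg, div_le_one hp0]; exact hp
  have h2 : 0 ≤ 1 / p := by positivity
  have mD : Measurable fun y => ‖D (x - y)‖ₑ := by have := h.measurable; fun_prop
  refine (lintegral_mul_le_weighted mD hf hp).trans ?_
  rw [lintegral_enorm_sub_left]
  calc _ ≤ ENNReal.ofReal a ^ (1 - 1 / p) *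
        (ENNReal.ofReal (a * b) * ∫⁻ y, f y ^ p ∂μ) ^ (1 / p) := by
        gcongr
        · exact h.lintegral_le
        · rw [← lintegral_const_mul _ (hf.pow_const p)]
          exact lintegral_mono fun y => mul_le_mul_left (h.enorm_le _) _
    _ = _ := by
        rw [ENNReal.mul_rpow_of_nonneg _ _ h2, ENNReal.ofReal_mul ha,
          ENNReal.mul_rpow_of_nonneg _ _ h2, ENNReal.ofReal_mul ha,
          ENNReal.ofReal_rpow_of_nonneg hb h2, ← mul_assoc, ← mul_assoc,
          ← ENNReal.rpow_add_of_nonneg _ _ h1 h2]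
        simp

/-- The L^p to L^p bound: raise the weighted Hölder inequality to the power p and integrate in x by
Tonelli. -/
theorem KernelBound.lintegral_conv_rpow_le [SFinite μ] [SecondCountableTopology E]
    {D : E → ℝ} {a b p : ℝ} (h : KernelBound μ D a b) (ha : 0 ≤ a) (hp : 1 ≤ p)
    {f : E → ℝ≥0∞} (hf : Measurable f) :
    ∫⁻ x, (∫⁻ y, ‖D (x - y)‖ₑ * f y ∂μ) ^ p ∂μ ≤
      ENNReal.ofReal (a ^ p) * ∫⁻ y, f y ^ p ∂μ := by
  have hp0 : 0 < p := by linarith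
  have hD := h.measurable
  have mD : ∀ x, Measurable fun y => ‖D (x - y)‖ₑ := fun x => by fun_prop
  have hpow : ∀ x, (∫⁻ y, ‖D (x - y)‖ₑ * f y ∂μ) ^ p ≤
      ENNReal.ofReal a ^ (p - 1) * ∫⁻ y, ‖D (x - y)‖ₑ * f y ^ p ∂μ := by
    intro x
    refine (ENNReal.rpow_le_rpow (lintegral_mul_le_weighted (mD x) hf hp) hp0.le).trans ?_
    rw [ENNReal.mul_rpow_of_nonneg _ _ hp0.le, ← ENNReal.rpow_mul, ← ENNReal.rpow_mul,
      one_div_mul_cancel hp0.ne', ENNReal.rpow_one, lintegral_enorm_sub_left]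
    have : (1 - 1 / p) * p = p - 1 := by field_simp
    rw [this]
    have hp1 : 0 ≤ p - 1 := by linarith
    gcongr
    exact h.lintegral_le
  calc _ ≤ ∫⁻ x, ENNReal.ofReal a ^ (p - 1) * ∫⁻ y, ‖D (x - y)‖ₑ * f y ^ p ∂μ ∂μ :=
        lintegral_mono hpow
    _ = ENNReal.ofReal a ^ (p - 1) * ∫⁻ y, (∫⁻ x, ‖D (x - y)‖ₑ ∂μ) * f y ^ p ∂μ := by
        have m2 : Measurable fun q : E × E => ‖D (q.1 - q.2)‖ₑ * f q.2 ^ p := by fun_prop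
        rw [lintegral_const_mul _ (Measurable.lintegral_prod_right' m2),
          lintegral_lintegral_swap m2.aemeasurable]
        congr 1
        refine lintegral_congr fun y => ?_
        have m3 : Measurable fun x => ‖D (x - y)‖ₑ := by fun_prop
        exact lintegral_mul_const (f y ^ p) m3
    _ ≤ ENNReal.ofReal a ^ (p - 1) * ∫⁻ y, ENNReal.ofReal a * f y ^ p ∂μ := by
        gcongr with y
        rw [lintegral_sub_right_eq_self (fun x => ‖D x‖ₑ) y]
        exact h.lintegral_le
    _ = _ := by
        rw [lintegral_const_mul _ (hf.pow_const p), ← mul_assoc]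
        congr 1
        conv_lhs => rw [← ENNReal.rpow_one (ENNReal.ofReal a), ← ENNReal.rpow_mul, one_mul,
          ← ENNReal.rpow_add_of_nonneg _ _ (by linarith) zero_le_one, sub_add_cancel]
        rw [ENNReal.ofReal_rpow_of_nonneg ha hp0.le]

end Convolution

/-! ### Bounds for K_τ and its increments at every time scale. -/

section Kernel

/-- The parabolic dilation preserves the L¹ norm and multiplies the sup norm by τ^{-n/(2α)}. So a is
unchanged and only b is multiplied. -/
theorem KernelBound.rescale {n : ℕ} {α : ℝ} {g : EuclideanSpace ℝ (Fin n) → ℝ} {a b τ : ℝ}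
    (hg : KernelBound volume g a b) (hα₀ : 0 < α) (hτ : 0 < τ) :
    KernelBound volume
      (fun x => τ ^ (-(n / (2 * α))) * g (τ ^ (-(1 / (2 * α))) • x)) a
      (τ ^ (-(n / (2 * α))) * b) := by
  set r : ℝ := τ ^ (-(1 / (2 * α))) with hr
  set R : ℝ := τ ^ (-(n / (2 * α))) with hR
  have hr0 : 0 < r := Real.rpow_pos_of_pos hτ _
  have hR0 : 0 < R := Real.rpow_pos_of_pos hτ _
  have hrn : r ^ n = R := by
    rw [hr, hR, ← Real.rpow_natCast, ← Real.rpow_mul hτ.le]; congr 1; field_simp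
  have mg := hg.measurable
  refine ⟨by fun_prop, ?_, fun x => ?_⟩
  · have h1 : ∫⁻ x, ‖R * g (r • x)‖ₑ = ENNReal.ofReal R * ∫⁻ x, ‖g (r • x)‖ₑ := by
      rw [← lintegral_const_mul _ (by fun_prop)]
      refine lintegral_congr fun x => ?_
      rw [enorm_mul, Real.enorm_of_nonneg hR0.le]
    have h2 : ∫⁻ x, ‖g (r • x)‖ₑ =
        ∫⁻ x, ‖g x‖ₑ ∂(Measure.map (r • ·) (volume : Measure (EuclideanSpace ℝ (Fin n)))) := by
      rw [lintegral_map (by fun_prop) (by fun_prop)]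
    rw [h1, h2, Measure.map_addHaar_smul _ hr0.ne', lintegral_smul_measure, smul_eq_mul,
      finrank_euclideanSpace_fin, hrn, abs_of_pos (inv_pos.2 hR0), ← mul_assoc,
      ← ENNReal.ofReal_mul hR0.le, mul_inv_cancel₀ hR0.ne', ENNReal.ofReal_one, one_mul]
    exact hg.lintegral_le
  · rw [enorm_mul, Real.enorm_of_nonneg hR0.le]
    calc _ ≤ ENNReal.ofReal R * ENNReal.ofReal (a * b) := by gcongr; exact hg.enorm_le _
      _ = ENNReal.ofReal (a * (R * b)) := by
        rw [← ENNReal.ofReal_mul hR0.le]; congr 1; ring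

variable {n : ℕ} [NeZero n] {α : ℝ}

theorem kernelBound_kernel (hα₀ : 0 < α) (hα₁ : α < 1) : ∃ C : ℝ, 0 < C ∧ ∀ τ : ℝ, 0 < τ →
    KernelBound (volume : Measure (EuclideanSpace ℝ (Fin n))) (kernel α τ) C
      (τ ^ (-(n / (2 * α)))) := by
  set M := kernel α 1 (0 : EuclideanSpace ℝ (Fin n)) with hM
  have hk0 := kernel_nonneg (n := n) hα₀ hα₁ one_pos
  refine ⟨M + 1, by linarith [hk0 0], fun τ hτ => ?_⟩
  have h1 : KernelBound (volume : Measure (EuclideanSpace ℝ (Fin n))) (kernel α 1) (M + 1) 1 := by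
    refine ⟨(continuous_kernel_one hα₀).measurable, ?_, fun x => ?_⟩
    · simp only [Real.enorm_of_nonneg (hk0 _)]
      refine (lintegral_kernel_one_le hα₀ hα₁).trans ?_
      rw [← ENNReal.ofReal_one]
      exact ENNReal.ofReal_le_ofReal (by linarith [hk0 0])
    · rw [Real.enorm_of_nonneg (hk0 _)]
      refine ENNReal.ofReal_le_ofReal ?_
      have := kernel_antitone (n := n) hα₀ hα₁ one_pos (x := 0) (x' := x) (by simp)
      linarith
  have h2 := h1.rescale hα₀ hτ
  rw [mul_one] at h2
  convert h2 using 1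
  ext x
  exact kernel_eq_scaling hα₀ hτ x

theorem kernelBound_translate (hα₀ : 0 < α) (hα₁ : α < 1) : ∃ C : ℝ, 0 < C ∧ ∀ τ : ℝ, 0 < τ →
    ∀ h : EuclideanSpace ℝ (Fin n), KernelBound volume (fun x => kernel α τ (x + h) - kernel α τ x)
      (C * min 1 (τ ^ (-(1 / (2 * α))) * ‖h‖)) (τ ^ (-(n / (2 * α)))) := by
  obtain ⟨C₁, hC₁, h1⟩ := abs_kernel_sub_le (n := n) hα₀
  obtain ⟨C₂, hC₂, h2⟩ := integral_abs_kernel_translate_sub_le (n := n) hα₀ hα₁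
  set M := kernel α 1 (0 : EuclideanSpace ℝ (Fin n)) with hM
  have hk := integrable_kernel_one (n := n) hα₀ hα₁
  have hk0 := kernel_nonneg (n := n) hα₀ hα₁ one_pos
  have hkM : ∀ x, kernel α 1 x ≤ M := fun x =>
    kernel_antitone (n := n) hα₀ hα₁ one_pos (x := 0) (x' := x) (by simp)
  -- One constant dominates the four bounds used: Lipschitz in sup norm, Lipschitz in L¹, the sup M
  -- and the L¹ norm 2 of an increment.
  set C := C₁ + C₂ + M + 2 with hC
  have hC0 : 0 < C := by linarith [hk0 0]
  refine ⟨C, hC0, fun τ hτ h => ?_⟩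
  have key : ∀ v : EuclideanSpace ℝ (Fin n), KernelBound volume
      (fun x => kernel α 1 (x + v) - kernel α 1 x) (C * min 1 ‖v‖) 1 := by
    intro v
    have hkv : Integrable fun x : EuclideanSpace ℝ (Fin n) => kernel α 1 (x + v) :=
      hk.comp_add_right v
    have hkm := (continuous_kernel_one (n := n) hα₀).measurable
    refine ⟨by fun_prop, ?_, fun x => ?_⟩
    · have : ∫⁻ x, ‖kernel α 1 (x + v) - kernel α 1 x‖ₑ =
          ENNReal.ofReal (∫ x, |kernel α 1 (x + v) - kernel α 1 x|) :=
        (ofReal_integral_norm_eq_lintegral_enorm (hkv.sub hk)).symm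
      rw [this]
      refine ENNReal.ofReal_le_ofReal ?_
      rw [mul_min_of_nonneg _ _ hC0.le, mul_one]
      refine le_min ?_ ((h2 v).trans ?_)
      · calc ∫ x, |kernel α 1 (x + v) - kernel α 1 x| ≤
            ∫ x : EuclideanSpace ℝ (Fin n), (kernel α 1 (x + v) + kernel α 1 x) := by
              refine integral_mono (hkv.sub hk).abs (hkv.add hk) fun x => ?_
              simp only
              rw [abs_le]
              constructor <;> linarith [hk0 x, hk0 (x + v)]
          _ = 2 * ∫ x : EuclideanSpace ℝ (Fin n), kernel α 1 x := by
              rw [integral_add hkv hk, integral_add_right_eq_self (kernel α 1) v]; ring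
          _ ≤ C := by linarith [integral_kernel_one_le (n := n) hα₀ hα₁, hk0 0]
      · refine mul_le_mul_of_nonneg_right ?_ (norm_nonneg _)
        linarith [hk0 0]
    · rw [← ofReal_norm, Real.norm_eq_abs]
      refine ENNReal.ofReal_le_ofReal ?_
      rw [mul_one, mul_min_of_nonneg _ _ hC0.le, mul_one]
      refine le_min ?_ ((h1 _ _).trans ?_)
      · rw [abs_le]
        constructor <;> linarith [hk0 x, hk0 (x + v), hkM x, hkM (x + v)]
      · rw [add_sub_cancel_left]
        refine mul_le_mul_of_nonneg_right ?_ (norm_nonneg _)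
        linarith [hk0 0]
  have h3 := (key (τ ^ (-(1 / (2 * α))) • h)).rescale hα₀ hτ
  rw [mul_one, norm_smul, Real.norm_eq_abs, abs_of_pos (Real.rpow_pos_of_pos hτ _)] at h3
  convert h3 using 1
  ext x
  rw [kernel_eq_scaling hα₀ hτ, kernel_eq_scaling hα₀ hτ x, smul_add]
  ring

theorem kernelBound_time (hα₀ : 0 < α) (hα₁ : α < 1) : ∃ C : ℝ, 0 < C ∧ ∀ τ : ℝ, 0 < τ →
    ∀ h : ℝ, 0 ≤ h → KernelBound (volume : Measure (EuclideanSpace ℝ (Fin n)))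
      (fun x => kernel α (τ + h) x - kernel α τ x)
      (C * min 1 (h / τ)) (τ ^ (-(n / (2 * α)))) := by
  obtain ⟨C₁, hC₁, h1⟩ := abs_kernel_time_sub_le (n := n) hα₀
  set M := kernel α 1 (0 : EuclideanSpace ℝ (Fin n)) with hM
  have hk := integrable_kernel_one (n := n) hα₀ hα₁
  have hk0 := kernel_nonneg (n := n) hα₀ hα₁ one_pos
  have hkM : ∀ x, kernel α 1 x ≤ M := fun x =>
    kernel_antitone (n := n) hα₀ hα₁ one_pos (x := 0) (x' := x) (by simp)
  have hkm := (continuous_kernel_one (n := n) hα₀).measurable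
  have hnα : 0 ≤ 2 * (n / (2 * α)) := by positivity
  set C := C₁ + 2 * (n / (2 * α)) + M + 2 with hC
  have hC0 : 0 < C := by linarith [hk0 0]
  refine ⟨C, hC0, fun τ hτ h hh => ?_⟩
  have key : ∀ u : ℝ, 0 ≤ u → KernelBound (volume : Measure (EuclideanSpace ℝ (Fin n)))
      (fun x => kernel α (1 + u) x - kernel α 1 x) (C * min 1 u) 1 := by
    intro u hu
    have hu1 : 0 < 1 + u := by linarith
    set r : ℝ := (1 + u) ^ (-(1 / (2 * α))) with hr
    set R : ℝ := (1 + u) ^ (-(n / (2 * α))) with hR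
    have hr0 : 0 < r := Real.rpow_pos_of_pos hu1 _
    have hR0 : 0 < R := Real.rpow_pos_of_pos hu1 _
    have hR1 : R ≤ 1 := Real.rpow_le_one_of_one_le_of_nonpos (by linarith) (by
      simp only [Left.neg_nonpos_iff]; positivity)
    have hku : ∀ x : EuclideanSpace ℝ (Fin n), kernel α (1 + u) x = R * kernel α 1 (r • x) :=
      fun x => kernel_eq_scaling hα₀ hu1 x
    have hkr : Integrable fun x : EuclideanSpace ℝ (Fin n) => kernel α (1 + u) x := by
      simp only [hku]
      exact (hk.comp_smul hr0.ne').const_mul R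
    refine ⟨?_, ?_, fun x => ?_⟩
    · simp only [hku]; fun_prop
    · have : ∫⁻ x : EuclideanSpace ℝ (Fin n), ‖kernel α (1 + u) x - kernel α 1 x‖ₑ =
          ENNReal.ofReal (∫ x : EuclideanSpace ℝ (Fin n), |kernel α (1 + u) x - kernel α 1 x|) :=
        (ofReal_integral_norm_eq_lintegral_enorm (hkr.sub hk)).symm
      rw [this]
      refine ENNReal.ofReal_le_ofReal ?_
      rw [mul_min_of_nonneg _ _ hC0.le, mul_one]
      have h2 := integral_abs_kernel_time_sub_le (n := n) hα₀ hα₁ hu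
      refine le_min (h2.2.trans (by linarith [hk0 0])) (h2.1.trans ?_)
      refine mul_le_mul_of_nonneg_right ?_ hu
      linarith [hk0 0]
    · rw [← ofReal_norm, Real.norm_eq_abs]
      refine ENNReal.ofReal_le_ofReal ?_
      rw [mul_one, mul_min_of_nonneg _ _ hC0.le, mul_one]
      refine le_min ?_ ((h1 u hu x).trans ?_)
      · rw [hku, abs_le]
        have b1 : R * kernel α 1 (r • x) ≤ M :=
          (mul_le_of_le_one_left (hk0 _) hR1).trans (hkM _)
        have b2 := mul_nonneg hR0.le (hk0 (r • x))
        constructor <;> linarith [hk0 x, hkM x]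
      · refine mul_le_mul_of_nonneg_right ?_ hu
        linarith [hk0 0]
  have h3 := (key (h / τ) (by positivity)).rescale hα₀ hτ
  rw [mul_one] at h3
  convert h3 using 1
  ext x
  have : τ + h = τ * (1 + h / τ) := by field_simp
  rw [this, kernel_scaling hα₀ hτ (by positivity), kernel_eq_scaling hα₀ hτ x]
  ring

end Kernel

theorem measurable_kernel {n : ℕ} (α : ℝ) :
    Measurable fun q : ℝ × EuclideanSpace ℝ (Fin n) => kernel α q.1 q.2 := by
  have h : StronglyMeasurable fun r : (ℝ × EuclideanSpace ℝ (Fin n)) × EuclideanSpace ℝ (Fin n) =>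
      Complex.exp (Complex.I * ((inner ℝ r.1.2 r.2 : ℝ) : ℂ) -
        ((r.1.1 * ‖r.2‖ ^ (2 * α) : ℝ) : ℂ)) :=
    Measurable.stronglyMeasurable (by fun_prop)
  have h2 := (h.integral_prod_right' (ν := volume)).measurable.const_mul
    ((((2 * Real.pi) ^ n)⁻¹ : ℝ) : ℂ)
  exact Complex.measurable_re.comp h2

theorem measurable_kernel_comp {n : ℕ} {X : Type*} [MeasurableSpace X] (α : ℝ) {f : X → ℝ}
    {g : X → EuclideanSpace ℝ (Fin n)} (hf : Measurable f) (hg : Measurable g) :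
    Measurable fun x => kernel α (f x) (g x) := by
  have h := (measurable_kernel (n := n) α).comp (hf.prodMk hg)
  exact h

/-! ### Absolute convergence and continuity of the free solution. -/

section FreeSolution

variable {E : Type*} [MeasurableSpace E] [NormedAddCommGroup E] [BorelSpace E]
  {μ : Measure E} [μ.IsAddLeftInvariant] [μ.IsNegInvariant]

theorem KernelBound.lintegral_conv_le_eLpNorm {D : E → ℝ} {a b : ℝ} (h : KernelBound μ D a b)
    (ha : 0 ≤ a) (hb : 0 ≤ b) {p : ℝ≥0∞} (hp : 1 ≤ p) {f : E → ℝ} (hf : AEStronglyMeasurable f μ)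
    (x : E) : ∫⁻ y, ‖D (x - y) * f y‖ₑ ∂μ ≤
      ENNReal.ofReal (a * b ^ (1 / p.toReal)) * eLpNorm f p μ := by
  simp only [enorm_mul]
  rcases eq_or_ne p ∞ with rfl | hp'
  -- With the convention 1/∞.toReal = 1/0 = 0, the factor b^{1/p} is 1, as it should be for p = ∞.
  · rw [ENNReal.toReal_top, div_zero, Real.rpow_zero, mul_one, eLpNorm_exponent_top]
    calc _ ≤ ∫⁻ y, ‖D (x - y)‖ₑ * eLpNormEssSup f μ ∂μ := by
          refine lintegral_mono_ae ?_
          filter_upwards [enorm_ae_le_eLpNormEssSup f μ] with y hy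
          gcongr
      _ = (∫⁻ y, ‖D y‖ₑ ∂μ) * eLpNormEssSup f μ := by
          have mD := h.measurable
          have m : Measurable fun y => ‖D (x - y)‖ₑ := by fun_prop
          rw [lintegral_mul_const _ m, lintegral_enorm_sub_left]
      _ ≤ _ := by gcongr; exact h.lintegral_le
  · have hp0 : p ≠ 0 := (zero_lt_one.trans_le hp).ne'
    have hpr : 1 ≤ p.toReal := by
      rw [← ENNReal.toReal_one]; exact ENNReal.toReal_mono hp' hp
    have e : f =ᵐ[μ] hf.mk f := hf.ae_eq_mk
    rw [eLpNorm_congr_ae e, eLpNorm_eq_lintegral_rpow_enorm_toReal hp0 hp']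
    refine le_trans (le_of_eq (lintegral_congr_ae ?_)) (h.lintegral_conv_le ha hb hpr
      (f := fun y => ‖hf.mk f y‖ₑ) hf.stronglyMeasurable_mk.measurable.enorm x)
    filter_upwards [e] with y hy
    rw [hy]

theorem KernelBound.integrable_conv {D : E → ℝ} {a b : ℝ} (h : KernelBound μ D a b)
    (ha : 0 ≤ a) (hb : 0 ≤ b) {p : ℝ≥0∞} (hp : 1 ≤ p) {f : E → ℝ} (hf : MemLp f p μ)
    (x : E) : Integrable (fun y => D (x - y) * f y) μ := by
  have mD := h.measurable
  have m : Measurable fun y => D (x - y) := by fun_prop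
  refine ⟨m.aestronglyMeasurable.mul hf.1, ?_⟩
  exact (h.lintegral_conv_le_eLpNorm ha hb hp hf.1 x).trans_lt
    (ENNReal.mul_lt_top ENNReal.ofReal_lt_top hf.2)

theorem KernelBound.abs_integral_conv_le {D : E → ℝ} {a b : ℝ} (h : KernelBound μ D a b)
    (ha : 0 ≤ a) (hb : 0 ≤ b) {p : ℝ≥0∞} (hp : 1 ≤ p) {f : E → ℝ} (hf : MemLp f p μ)
    (x : E) : |∫ y, D (x - y) * f y ∂μ| ≤ a * b ^ (1 / p.toReal) * (eLpNorm f p μ).toReal := by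
  have h1 := h.lintegral_conv_le_eLpNorm ha hb hp hf.1 x
  have h2 : ‖∫ y, D (x - y) * f y ∂μ‖ₑ ≤
      ENNReal.ofReal (a * b ^ (1 / p.toReal)) * eLpNorm f p μ :=
    (enorm_integral_le_lintegral_enorm _).trans h1
  have h3 := ENNReal.toReal_mono (ENNReal.mul_lt_top ENNReal.ofReal_lt_top hf.2).ne h2
  rwa [toReal_enorm, Real.norm_eq_abs, ENNReal.toReal_mul, ENNReal.toReal_ofReal
    (mul_nonneg ha (Real.rpow_nonneg hb _))] at h3

end FreeSolution

section FreeSol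

variable {n : ℕ} [NeZero n] {α : ℝ}

theorem integrable_kernel_mul (hα₀ : 0 < α) (hα₁ : α < 1) {p : ℝ≥0∞} (hp : 1 ≤ p)
    {f : EuclideanSpace ℝ (Fin n) → ℝ} (hf : MemLp f p volume) {t : ℝ} (ht : 0 < t)
    (x : EuclideanSpace ℝ (Fin n)) : Integrable (fun y => kernel α t (x - y) * f y) volume := by
  obtain ⟨C, hC, h⟩ := kernelBound_kernel (n := n) hα₀ hα₁
  exact (h t ht).integrable_conv hC.le (Real.rpow_nonneg ht.le _) hp hf x

theorem abs_freeSol_sub_space_le (hα₀ : 0 < α) (hα₁ : α < 1) : ∃ C : ℝ, 0 < C ∧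
    ∀ p : ℝ≥0∞, 1 ≤ p → ∀ f : EuclideanSpace ℝ (Fin n) → ℝ, MemLp f p volume →
    ∀ t : ℝ, 0 < t → ∀ x x' : EuclideanSpace ℝ (Fin n),
      |freeSol α f (t, x) - freeSol α f (t, x')| ≤
        C * min 1 (t ^ (-(1 / (2 * α))) * ‖x - x'‖) *
          (t ^ (-(n / (2 * α)))) ^ (1 / p.toReal) * (eLpNorm f p volume).toReal := by
  obtain ⟨C, hC, h⟩ := kernelBound_translate (n := n) hα₀ hα₁
  refine ⟨C, hC, fun p hp f hf t ht x x' => ?_⟩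
  have h1 := (h t ht (x - x')).abs_integral_conv_le (by positivity) (Real.rpow_nonneg ht.le _)
    hp hf x'
  refine le_trans (le_of_eq ?_) h1
  rw [freeSol, freeSol, ← integral_sub (integrable_kernel_mul hα₀ hα₁ hp hf ht x)
    (integrable_kernel_mul hα₀ hα₁ hp hf ht x')]
  congr 2; ext y
  rw [← sub_mul]
  congr 3
  abel

theorem abs_freeSol_sub_time_le (hα₀ : 0 < α) (hα₁ : α < 1) : ∃ C : ℝ, 0 < C ∧
    ∀ p : ℝ≥0∞, 1 ≤ p → ∀ f : EuclideanSpace ℝ (Fin n) → ℝ, MemLp f p volume →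
    ∀ t t' : ℝ, 0 < t → 0 < t' → ∀ x : EuclideanSpace ℝ (Fin n),
      |freeSol α f (t, x) - freeSol α f (t', x)| ≤
        C * min 1 (|t - t'| / min t t') *
          ((min t t') ^ (-(n / (2 * α)))) ^ (1 / p.toReal) * (eLpNorm f p volume).toReal := by
  obtain ⟨C, hC, h⟩ := kernelBound_time (n := n) hα₀ hα₁
  refine ⟨C, hC, fun p hp f hf => ?_⟩
  have key : ∀ t t' : ℝ, 0 < t → t ≤ t' → ∀ x : EuclideanSpace ℝ (Fin n),
      |freeSol α f (t', x) - freeSol α f (t, x)| ≤ C * min 1 ((t' - t) / t) *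
        (t ^ (-(n / (2 * α)))) ^ (1 / p.toReal) * (eLpNorm f p volume).toReal := by
    intro t t' ht htt x
    have hm : 0 ≤ min 1 ((t' - t) / t) := le_min zero_le_one (div_nonneg (by linarith) ht.le)
    have h1 := (h t ht (t' - t) (by linarith)).abs_integral_conv_le (mul_nonneg hC.le hm)
      (Real.rpow_nonneg ht.le _) hp hf x
    refine le_trans (le_of_eq ?_) h1
    rw [freeSol, freeSol, ← integral_sub (integrable_kernel_mul hα₀ hα₁ hp hf (by linarith) x)
      (integrable_kernel_mul hα₀ hα₁ hp hf ht x)]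
    congr 2; ext y
    rw [← sub_mul, add_sub_cancel]
  intro t t' ht ht' x
  rcases le_total t t' with htt | htt
  · rw [abs_sub_comm, abs_sub_comm t t', abs_of_nonneg (sub_nonneg.2 htt), min_eq_left htt]
    exact key t t' ht htt x
  · rw [abs_of_nonneg (sub_nonneg.2 htt), min_eq_right htt]
    exact key t' t ht' htt x

/-- Pass from (t, x) to (t₀, x₀) through (t, x₀). The sum G of the space and time bounds is
continuous at (t₀, x₀) and vanishes there. -/
theorem continuousOn_freeSol (hα₀ : 0 < α) (hα₁ : α < 1) {p : ℝ≥0∞} (hp : 1 ≤ p)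
    {f : EuclideanSpace ℝ (Fin n) → ℝ} (hf : MemLp f p volume) :
    ContinuousOn (freeSol α f) (upperHalf n) := by
  obtain ⟨C, hC, hs⟩ := abs_freeSol_sub_space_le (n := n) hα₀ hα₁
  obtain ⟨C', hC', ht⟩ := abs_freeSol_sub_time_le (n := n) hα₀ hα₁
  rintro ⟨t₀, x₀⟩ hz₀
  have ht₀ : 0 < t₀ := hz₀.1
  refine ContinuousAt.continuousWithinAt ?_
  set N := (eLpNorm f p volume).toReal
  set G : ℝ × EuclideanSpace ℝ (Fin n) → ℝ := fun z =>
    C * min 1 (z.1 ^ (-(1 / (2 * α))) * ‖z.2 - x₀‖) *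
      (z.1 ^ (-(n / (2 * α)))) ^ (1 / p.toReal) * N +
    C' * min 1 (|z.1 - t₀| / min z.1 t₀) *
      ((min z.1 t₀) ^ (-(n / (2 * α)))) ^ (1 / p.toReal) * N with hG
  have hGc : ContinuousAt G (t₀, x₀) := by
    have hm : min t₀ t₀ ≠ 0 := by simpa using ht₀.ne'
    have c1 : ContinuousAt (fun z : ℝ × EuclideanSpace ℝ (Fin n) => z.1) (t₀, x₀) :=
      continuousAt_fst
    have c2 : ContinuousAt (fun z : ℝ × EuclideanSpace ℝ (Fin n) => min z.1 t₀) (t₀, x₀) := by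
      fun_prop
    have c3 : ContinuousAt (fun z : ℝ × EuclideanSpace ℝ (Fin n) => z.1 ^ (-(1 / (2 * α))))
        (t₀, x₀) := c1.rpow_const (Or.inl ht₀.ne')
    have c4 : ContinuousAt (fun z : ℝ × EuclideanSpace ℝ (Fin n) =>
        (z.1 ^ (-(n / (2 * α)))) ^ (1 / p.toReal)) (t₀, x₀) :=
      (c1.rpow_const (Or.inl ht₀.ne')).rpow_const (Or.inl (Real.rpow_pos_of_pos ht₀ _).ne')
    have c5 : ContinuousAt (fun z : ℝ × EuclideanSpace ℝ (Fin n) =>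
        ((min z.1 t₀) ^ (-(n / (2 * α)))) ^ (1 / p.toReal)) (t₀, x₀) :=
      (c2.rpow_const (Or.inl hm)).rpow_const
        (Or.inl (Real.rpow_pos_of_pos (lt_min ht₀ ht₀) _).ne')
    have c6 : ContinuousAt (fun z : ℝ × EuclideanSpace ℝ (Fin n) => |z.1 - t₀| / min z.1 t₀)
        (t₀, x₀) := ContinuousAt.div (by fun_prop) c2 hm
    have c7 : ContinuousAt (fun z : ℝ × EuclideanSpace ℝ (Fin n) => ‖z.2 - x₀‖) (t₀, x₀) := by
      fun_prop
    exact (((continuousAt_const.mul (continuousAt_const.min (c3.mul c7))).mul c4).mul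
      continuousAt_const).add (((continuousAt_const.mul (continuousAt_const.min c6)).mul c5).mul
      continuousAt_const)
  have hG0 : G (t₀, x₀) = 0 := by simp [hG]
  have hlim : Tendsto G (𝓝 (t₀, x₀)) (𝓝 0) := hG0 ▸ hGc.tendsto
  refine tendsto_iff_dist_tendsto_zero.2 (squeeze_zero' (Eventually.of_forall fun _ => dist_nonneg)
    ?_ hlim)
  have hev : ∀ᶠ z : ℝ × EuclideanSpace ℝ (Fin n) in 𝓝 (t₀, x₀), 0 < z.1 :=
    continuousAt_fst.eventually (lt_mem_nhds ht₀)
  filter_upwards [hev] with z hz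
  have a1 := hs p hp f hf z.1 hz z.2 x₀
  have a2 := ht p hp f hf z.1 t₀ hz ht₀ x₀
  rw [Real.dist_eq]
  exact (abs_sub_le _ (freeSol α f (z.1, x₀)) _).trans (add_le_add a1 a2)

end FreeSol

/-! ### Power integrals in time. -/

section TimeIntegrals

theorem lintegral_Ioc_rpow {c σ : ℝ} (hc : c < 1) (hσ : 0 < σ) :
    ∫⁻ τ in Ioc 0 σ, ENNReal.ofReal (τ ^ (-c)) = ENNReal.ofReal (σ ^ (1 - c) / (1 - c)) := by
  have hi : IntegrableOn (fun τ : ℝ => τ ^ (-c)) (Ioc 0 σ) :=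
    (intervalIntegrable_iff_integrableOn_Ioc_of_le hσ.le).1
      (intervalIntegral.intervalIntegrable_rpow' (by linarith))
  rw [← ofReal_integral_eq_lintegral_ofReal hi, ← intervalIntegral.integral_of_le hσ.le,
    integral_rpow (Or.inl (by linarith)), Real.zero_rpow (by linarith), sub_zero, neg_add_eq_sub]
  filter_upwards [ae_restrict_mem measurableSet_Ioc] with s hs using Real.rpow_nonneg hs.1.le _

theorem lintegral_Ioi_rpow {c σ : ℝ} (hc : 1 < c) (hσ : 0 < σ) :
    ∫⁻ τ in Ioi σ, ENNReal.ofReal (τ ^ (-c)) = ENNReal.ofReal (σ ^ (1 - c) / (c - 1)) := by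
  have hi := integrableOn_Ioi_rpow_of_lt (a := -c) (by linarith) hσ
  rw [← ofReal_integral_eq_lintegral_ofReal hi, integral_Ioi_rpow_of_lt (by linarith) hσ]
  · congr 1
    rw [neg_add_eq_sub, ← neg_sub c 1, neg_div_neg_eq, neg_sub]
  filter_upwards [ae_restrict_mem measurableSet_Ioi] with s hs using
    Real.rpow_nonneg (hσ.trans hs).le _

/-- Split at τ = σ. The condition e·r < 1 gives integrability near 0, the condition (κ + e)·r > 1
gives it at infinity, and both halves scale like σ^{1-er}. -/
theorem lintegral_min_rpow_le {κ e r : ℝ} (hr : 0 < r) (her : e * r < 1)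
    (hκ : 1 < (κ + e) * r) : ∃ C : ℝ, 0 < C ∧ ∀ σ : ℝ, 0 < σ →
      (∫⁻ τ in Ioi (0 : ℝ), ENNReal.ofReal (min 1 ((σ / τ) ^ κ) * τ ^ (-e)) ^ r) ^ (1 / r) ≤
        ENNReal.ofReal (C * σ ^ (1 / r - e)) := by
  have hA : 0 < 1 / (1 - e * r) + 1 / ((κ + e) * r - 1) := by
    have h1 : 0 < 1 - e * r := by linarith
    have h2 : 0 < (κ + e) * r - 1 := by linarith
    positivity
  refine ⟨(1 / (1 - e * r) + 1 / ((κ + e) * r - 1)) ^ (1 / r), Real.rpow_pos_of_pos hA _,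
    fun σ hσ => ?_⟩
  have near : ∫⁻ τ in Ioc 0 σ, ENNReal.ofReal (min 1 ((σ / τ) ^ κ) * τ ^ (-e)) ^ r ≤
      ENNReal.ofReal (σ ^ (1 - e * r) / (1 - e * r)) := by
    rw [← lintegral_Ioc_rpow her hσ]
    refine setLIntegral_mono' measurableSet_Ioc fun τ hτ => ?_
    have hτ0 : 0 ≤ τ ^ (-e) := Real.rpow_nonneg hτ.1.le _
    have : τ ^ (-(e * r)) = (τ ^ (-e)) ^ r := by rw [← Real.rpow_mul hτ.1.le, neg_mul]
    rw [this, ← ENNReal.ofReal_rpow_of_nonneg hτ0 hr.le]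
    gcongr
    exact mul_le_of_le_one_left hτ0 (min_le_left _ _)
  have far : ∫⁻ τ in Ioi σ, ENNReal.ofReal (min 1 ((σ / τ) ^ κ) * τ ^ (-e)) ^ r ≤
      ENNReal.ofReal (σ ^ (1 - e * r) / ((κ + e) * r - 1)) := by
    have h1 : ENNReal.ofReal (σ ^ (1 - e * r) / ((κ + e) * r - 1)) =
        ENNReal.ofReal (σ ^ (κ * r)) * ∫⁻ τ in Ioi σ, ENNReal.ofReal (τ ^ (-((κ + e) * r))) := by
      rw [lintegral_Ioi_rpow hκ hσ, ← ENNReal.ofReal_mul (Real.rpow_nonneg hσ.le _),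
        ← mul_div_assoc,
        ← Real.rpow_add hσ]
      congr 3; ring
    rw [h1, ← lintegral_const_mul _ (by fun_prop)]
    refine setLIntegral_mono' measurableSet_Ioi fun τ hτ => ?_
    have hτ0 : 0 < τ := hσ.trans hτ
    have h2 : σ ^ (κ * r) * τ ^ (-((κ + e) * r)) = ((σ / τ) ^ κ * τ ^ (-e)) ^ r := by
      rw [Real.mul_rpow (by positivity) (by positivity), Real.div_rpow hσ.le hτ0.le,
        Real.div_rpow (by positivity) (by positivity), ← Real.rpow_mul hσ.le,
        ← Real.rpow_mul hτ0.le, ← Real.rpow_mul hτ0.le, div_mul_eq_mul_div, mul_div_assoc,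
        ← Real.rpow_sub hτ0]
      congr 2; ring
    rw [← ENNReal.ofReal_mul (by positivity), h2,
      ← ENNReal.ofReal_rpow_of_nonneg (by positivity) hr.le]
    gcongr
    exact min_le_right _ _
  have total : ∫⁻ τ in Ioi (0 : ℝ), ENNReal.ofReal (min 1 ((σ / τ) ^ κ) * τ ^ (-e)) ^ r ≤
      ENNReal.ofReal ((1 / (1 - e * r) + 1 / ((κ + e) * r - 1)) * σ ^ (1 - e * r)) := by
    rw [← Ioc_union_Ioi_eq_Ioi hσ.le]
    refine (lintegral_union_le _ _ _).trans ((add_le_add near far).trans (le_of_eq ?_))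
    have h1 : 0 < 1 - e * r := by linarith
    have h2 : 0 < (κ + e) * r - 1 := by linarith
    rw [← ENNReal.ofReal_add (by positivity) (by positivity)]
    congr 1; ring
  refine (ENNReal.rpow_le_rpow total (by positivity)).trans (le_of_eq ?_)
  rw [ENNReal.ofReal_rpow_of_nonneg (by positivity) (by positivity),
    Real.mul_rpow hA.le (by positivity), ← Real.rpow_mul hσ.le]
  congr 3; field_simp

theorem setLIntegral_Iio_sub_left (t : ℝ) (φ : ℝ → ℝ≥0∞) :
    ∫⁻ s in Iio t, φ (t - s) = ∫⁻ τ in Ioi (0 : ℝ), φ τ := by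
  rw [← lintegral_indicator measurableSet_Iio, ← lintegral_indicator measurableSet_Ioi,
    ← lintegral_sub_left_eq_self (fun τ => (Ioi (0 : ℝ)).indicator φ τ) t]
  refine lintegral_congr fun s => ?_
  simp only [indicator, mem_Iio, mem_Ioi, sub_pos]

end TimeIntegrals

/-! ### Duhamel-type integrals against the mixed norm. -/

section Mixed

variable {n : ℕ}

/-- The spatial norm `‖F(s, ·)‖_p`. -/
def spatialNorm (p : ℝ) (F : ℝ × EuclideanSpace ℝ (Fin n) → ℝ) (s : ℝ) : ℝ≥0∞ :=
  (∫⁻ y, ‖F (s, y)‖ₑ ^ p) ^ (1 / p)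

theorem measurable_spatialNorm {p : ℝ} {F : ℝ × EuclideanSpace ℝ (Fin n) → ℝ} (hF : Measurable F) :
    Measurable (spatialNorm p F) :=
  (Measurable.lintegral_prod_right' (f := fun z => ‖F z‖ₑ ^ p) (by fun_prop)).pow_const _

theorem mixedNorm_eq {p q : ℝ} (F : ℝ × EuclideanSpace ℝ (Fin n) → ℝ) :
    mixedNorm p q F =
      (∫⁻ t in Ioi (0 : ℝ), spatialNorm p F t ^ q) ^ (1 / q) := by
  rw [mixedNorm]
  congr 1
  refine lintegral_congr fun t => ?_
  rw [spatialNorm, ← ENNReal.rpow_mul]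
  congr 1; ring

theorem volume_restrict_prod_univ (I : Set ℝ) :
    (volume : Measure (ℝ × EuclideanSpace ℝ (Fin n))).restrict (I ×ˢ univ) =
      (volume.restrict I).prod volume := by
  rw [Measure.volume_eq_prod, ← Measure.prod_restrict, Measure.restrict_univ]

/-- Young in space at each time s, then Hölder in time with exponents r and q. Afterwards each
estimate only asks for the L^r norm of a scalar weight w. -/
theorem lintegral_slab_le {p q r : ℝ} (hp : 1 ≤ p) (hr : r.HolderConjugate q)
    {F : ℝ × EuclideanSpace ℝ (Fin n) → ℝ} (hF : Measurable F) {I : Set ℝ}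
    (hI : MeasurableSet I) (hI0 : I ⊆ Ioi 0) {D : ℝ → EuclideanSpace ℝ (Fin n) → ℝ}
    (hD : Measurable (Function.uncurry D)) {w : ℝ → ℝ} (hw : Measurable w)
    (h : ∀ s ∈ I, ∃ a b, 0 ≤ a ∧ 0 ≤ b ∧ KernelBound volume (D s) a b ∧ a * b ^ (1 / p) ≤ w s)
    (x : EuclideanSpace ℝ (Fin n)) :
    ∫⁻ z in I ×ˢ univ, ‖D z.1 (x - z.2) * F z‖ₑ ≤
      (∫⁻ s in I, ENNReal.ofReal (w s) ^ r) ^ (1 / r) * mixedNorm p q F := by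
  have hDx : Measurable fun z : ℝ × EuclideanSpace ℝ (Fin n) => D z.1 (x - z.2) :=
    hD.comp (by fun_prop : Measurable fun z : ℝ × EuclideanSpace ℝ (Fin n) => (z.1, x - z.2))
  have hg := measurable_spatialNorm (p := p) hF
  have hq : 0 < q := hr.symm.pos
  rw [volume_restrict_prod_univ, lintegral_prod _ (by fun_prop)]
  calc ∫⁻ s in I, ∫⁻ y, ‖D s (x - y) * F (s, y)‖ₑ
      ≤ ∫⁻ s in I, ENNReal.ofReal (w s) * spatialNorm p F s := by
        refine setLIntegral_mono' hI fun s hs => ?_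
        obtain ⟨a, b, ha, hb, hK, hle⟩ := h s hs
        simp only [enorm_mul]
        refine (hK.lintegral_conv_le ha hb hp (f := fun y => ‖F (s, y)‖ₑ) (by fun_prop) x).trans ?_
        rw [← spatialNorm]
        gcongr
    _ ≤ (∫⁻ s in I, ENNReal.ofReal (w s) ^ r) ^ (1 / r) *
        (∫⁻ s in I, spatialNorm p F s ^ q) ^ (1 / q) :=
        ENNReal.lintegral_mul_le_Lp_mul_Lq (volume.restrict I) hr
          (f := fun s => ENNReal.ofReal (w s)) (by fun_prop) hg.aemeasurable
    _ ≤ _ := by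
        rw [mixedNorm_eq]
        gcongr

theorem integrableOn_slab {p q r : ℝ} (hp : 1 ≤ p) (hr : r.HolderConjugate q)
    {F : ℝ × EuclideanSpace ℝ (Fin n) → ℝ} (hF : Measurable F) (hN : mixedNorm p q F < ∞)
    {I : Set ℝ} (hI : MeasurableSet I) (hI0 : I ⊆ Ioi 0)
    {D : ℝ → EuclideanSpace ℝ (Fin n) → ℝ}
    (hD : Measurable (Function.uncurry D)) {w : ℝ → ℝ} (hw : Measurable w)
    (h : ∀ s ∈ I, ∃ a b, 0 ≤ a ∧ 0 ≤ b ∧ KernelBound volume (D s) a b ∧ a * b ^ (1 / p) ≤ w s)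
    (x : EuclideanSpace ℝ (Fin n)) {B : ℝ} (hB0 : 0 ≤ B)
    (hB : (∫⁻ s in I, ENNReal.ofReal (w s) ^ r) ^ (1 / r) ≤ ENNReal.ofReal B) :
    IntegrableOn (fun z => D z.1 (x - z.2) * F z) (I ×ˢ univ) ∧
      |∫ z in I ×ˢ univ, D z.1 (x - z.2) * F z| ≤ B * (mixedNorm p q F).toReal := by
  have hDx : Measurable fun z : ℝ × EuclideanSpace ℝ (Fin n) => D z.1 (x - z.2) :=
    hD.comp (by fun_prop : Measurable fun z : ℝ × EuclideanSpace ℝ (Fin n) => (z.1, x - z.2))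
  have h1 : ∫⁻ z in I ×ˢ univ, ‖D z.1 (x - z.2) * F z‖ₑ ≤ ENNReal.ofReal B * mixedNorm p q F :=
    (lintegral_slab_le hp hr hF hI hI0 hD hw h x).trans (by gcongr)
  have h2 : ENNReal.ofReal B * mixedNorm p q F < ∞ := ENNReal.mul_lt_top ENNReal.ofReal_lt_top hN
  refine ⟨⟨(hDx.mul hF).aestronglyMeasurable, h1.trans_lt h2⟩, ?_⟩
  have h3 := ENNReal.toReal_mono h2.ne ((enorm_integral_le_lintegral_enorm _).trans h1)
  rwa [toReal_enorm, Real.norm_eq_abs, ENNReal.toReal_mul, ENNReal.toReal_ofReal hB0] at h3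

theorem duhamel_eq_setIntegral {α : ℝ} {F : ℝ × EuclideanSpace ℝ (Fin n) → ℝ} {t : ℝ} (ht : 0 ≤ t)
    {x : EuclideanSpace ℝ (Fin n)} (h : DuhamelConverges α F (t, x)) :
    duhamel α F (t, x) = ∫ w in Ioo 0 t ×ˢ univ, kernel α (t - w.1) (x - w.2) * F w := by
  rw [duhamel, intervalIntegral.integral_of_le ht, integral_Ioc_eq_integral_Ioo,
    volume_restrict_prod_univ]
  rw [DuhamelConverges, IntegrableOn, volume_restrict_prod_univ] at h
  exact (integral_prod _ h).symm

/-- Reduces to Borel F. The values of `duhamel` agree at every point, since for almost every s the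
slices agree almost everywhere. -/
theorem exists_measurable_representative {α p q : ℝ} {F : ℝ × EuclideanSpace ℝ (Fin n) → ℝ}
    (hF : AEStronglyMeasurable F (volume.restrict (upperHalf n))) :
    ∃ F' : ℝ × EuclideanSpace ℝ (Fin n) → ℝ, Measurable F' ∧
      mixedNorm p q F' = mixedNorm p q F ∧
      ∀ z ∈ upperHalf n, duhamel α F' z = duhamel α F z ∧
        (DuhamelConverges α F' z ↔ DuhamelConverges α F z) := by
  have he := hF.ae_eq_mk
  have he' : ∀ᵐ w ∂((volume.restrict (Ioi (0 : ℝ))).prod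
      (volume : Measure (EuclideanSpace ℝ (Fin n)))), F w = hF.mk F w := by
    rw [← volume_restrict_prod_univ]; exact he
  have hs := Measure.ae_ae_of_ae_prod he'
  refine ⟨hF.mk F, hF.stronglyMeasurable_mk.measurable, ?_, fun z hz => ⟨?_, ?_⟩⟩
  · rw [mixedNorm, mixedNorm]
    congr 1
    refine lintegral_congr_ae ?_
    filter_upwards [hs] with s hs
    congr 1
    refine lintegral_congr_ae ?_
    filter_upwards [hs] with y hy
    rw [hy]
  · have hz0 : 0 < z.1 := hz.1
    rw [duhamel, duhamel, intervalIntegral.integral_of_le hz0.le,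
      intervalIntegral.integral_of_le hz0.le]
    refine integral_congr_ae ?_
    filter_upwards [ae_restrict_of_ae_restrict_of_subset Ioc_subset_Ioi_self hs] with s hs
    refine integral_congr_ae ?_
    filter_upwards [hs] with y hy
    rw [hy]
  · refine integrable_congr ?_
    have hsub : Ioo 0 z.1 ×ˢ (univ : Set (EuclideanSpace ℝ (Fin n))) ⊆ upperHalf n :=
      prod_mono Ioo_subset_Ioi_self subset_rfl
    filter_upwards [ae_restrict_of_ae_restrict_of_subset hsub he] with w hw
    rw [hw]

end Mixed

/-! ### The subcritical case: Hölder continuity of the Duhamel integral. -/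

section Holder

theorem lintegral_weight_le {r C B t : ℝ} (hr : 0 < r) (hC : 0 ≤ C) {I : Set ℝ} (hI : I ⊆ Iio t)
    {φ : ℝ → ℝ} (hφ : Measurable φ)
    (hB : (∫⁻ τ in Ioi (0 : ℝ), ENNReal.ofReal (φ τ) ^ r) ^ (1 / r) ≤ ENNReal.ofReal B) :
    (∫⁻ s in I, ENNReal.ofReal (C * φ (t - s)) ^ r) ^ (1 / r) ≤ ENNReal.ofReal (C * B) := by
  have h1 : ∫⁻ s in I, ENNReal.ofReal (C * φ (t - s)) ^ r ≤
      ENNReal.ofReal C ^ r * ∫⁻ τ in Ioi (0 : ℝ), ENNReal.ofReal (φ τ) ^ r := by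
    rw [← setLIntegral_Iio_sub_left t, ← lintegral_const_mul _ (by fun_prop)]
    refine (lintegral_mono_set hI).trans (le_of_eq ?_)
    refine lintegral_congr fun s => ?_
    rw [ENNReal.ofReal_mul hC, ENNReal.mul_rpow_of_nonneg _ _ hr.le]
  refine (ENNReal.rpow_le_rpow h1 (by positivity)).trans ?_
  rw [ENNReal.mul_rpow_of_nonneg _ _ (by positivity), ← ENNReal.rpow_mul,
    mul_one_div_cancel hr.ne', ENNReal.rpow_one, ENNReal.ofReal_mul hC]
  gcongr

theorem kernel_weight_rpow {n : ℕ} {α p τ : ℝ} (hτ : 0 < τ) :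
    (τ ^ (-(n / (2 * α)))) ^ (1 / p) = τ ^ (-(n / (2 * α * p))) := by
  rw [← Real.rpow_mul hτ.le]; congr 1; ring

theorem exponent_eq {n : ℕ} {α p q r : ℝ} (hα₀ : 0 < α) (hr : r.HolderConjugate q) :
    exponent n α p q = 2 * α * (1 / r - n / (2 * α * p)) := by
  have h := hr.inv_add_inv_eq_one
  have h2 : 1 / r = 1 - 1 / q := by rw [one_div, one_div]; linarith
  have h3 : 2 * α * (n / (2 * α * p)) = n / p := by
    rw [← mul_div_assoc, mul_div_mul_left _ _ (by positivity)]
  rw [exponent, h2, mul_sub, h3]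
  ring

variable {n : ℕ} [NeZero n] {α p q r : ℝ}

theorem duhamelConverges_of_subcritical (hα₀ : 0 < α) (hα₁ : α < 1) (hp : 1 ≤ p)
    (hr : r.HolderConjugate q) (he : n / (2 * α * p) < 1 / r)
    {F : ℝ × EuclideanSpace ℝ (Fin n) → ℝ} (hF : Measurable F) (hN : mixedNorm p q F < ∞)
    {t : ℝ} (ht : 0 < t) (x : EuclideanSpace ℝ (Fin n)) : DuhamelConverges α F (t, x) := by
  obtain ⟨C, hC, hK⟩ := kernelBound_kernel (n := n) hα₀ hα₁
  have hr1 := hr.lt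
  have he0 : 0 ≤ n / (2 * α * p) := by positivity
  -- With σ = t the factor min(1, t/τ) equals 1 on 0 < τ < t, so it only serves to make the weight
  -- integrable at infinity. Any κ ≥ 1 meets the far condition, because r > 1.
  obtain ⟨C', hC', hI⟩ := lintegral_min_rpow_le (κ := 1) (e := n / (2 * α * p)) hr.pos
    (by rwa [lt_div_iff₀ hr.pos] at he) (by nlinarith)
  refine (integrableOn_slab hp hr hF hN measurableSet_Ioo Ioo_subset_Ioi_self
    (D := fun s => kernel α (t - s))
    (w := fun s => C * (min 1 ((t / (t - s)) ^ (1 : ℝ)) * (t - s) ^ (-(n / (2 * α * p)))))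
    ((measurable_kernel α).comp (by fun_prop : Measurable fun z : ℝ × EuclideanSpace ℝ (Fin n) =>
      (t - z.1, z.2))) (by fun_prop) (fun s hs => ?_) x
    (B := C * (C' * t ^ (1 / r - n / (2 * α * p)))) (by positivity)
    (lintegral_weight_le hr.pos hC.le (I := Ioo 0 t)
      (φ := fun τ => min 1 ((t / τ) ^ (1 : ℝ)) * τ ^ (-(n / (2 * α * p)))) (fun s hs => hs.2)
      (by fun_prop) (hI t ht))).1
  have hτ : 0 < t - s := sub_pos.2 hs.2
  refine ⟨C, _, hC.le, Real.rpow_nonneg hτ.le _, hK _ hτ, ?_⟩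
  rw [kernel_weight_rpow hτ, Real.rpow_one, min_eq_left, one_mul]
  rw [one_le_div hτ]; linarith [hs.1]

/-- On (0, t) the kernel increment is used, and on [t, t') the kernel itself. Both have weight
min(1, σ/τ) τ^{-e} with σ = t' - t, where τ is t - s on the first interval and t' - s on the second,
so both yield the same power of σ. -/
theorem abs_duhamel_sub_time_le (hα₀ : 0 < α) (hα₁ : α < 1) (hp : 1 ≤ p)
    (hr : r.HolderConjugate q) (he : n / (2 * α * p) < 1 / r) :
    ∃ C : ℝ, 0 < C ∧ ∀ F : ℝ × EuclideanSpace ℝ (Fin n) → ℝ, Measurable F →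
      mixedNorm p q F < ∞ → ∀ t t' : ℝ, 0 < t → 0 < t' → ∀ x : EuclideanSpace ℝ (Fin n),
      |duhamel α F (t, x) - duhamel α F (t', x)| ≤
        C * |t - t'| ^ (1 / r - n / (2 * α * p)) * (mixedNorm p q F).toReal := by
  obtain ⟨C₁, hC₁, hK₁⟩ := kernelBound_kernel (n := n) hα₀ hα₁
  obtain ⟨C₂, hC₂, hK₂⟩ := kernelBound_time (n := n) hα₀ hα₁
  have hr1 := hr.lt
  set e : ℝ := n / (2 * α * p) with hedef
  have he0 : 0 ≤ e := by positivity
  obtain ⟨C', hC', hI⟩ := lintegral_min_rpow_le (κ := 1) (e := e) hr.pos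
    (by rwa [lt_div_iff₀ hr.pos] at he) (by nlinarith)
  refine ⟨(C₁ + C₂) * C', by positivity, fun F hF hN => ?_⟩
  have key : ∀ t t' : ℝ, 0 < t → t < t' → ∀ x : EuclideanSpace ℝ (Fin n),
      |duhamel α F (t', x) - duhamel α F (t, x)| ≤
        (C₁ + C₂) * C' * (t' - t) ^ (1 / r - e) * (mixedNorm p q F).toReal := by
    intro t t' ht htt x
    have hh : 0 < t' - t := sub_pos.2 htt
    have ht' : 0 < t' := ht.trans htt
    have c := duhamelConverges_of_subcritical hα₀ hα₁ hp hr he hF hN ht x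
    have c' := duhamelConverges_of_subcritical hα₀ hα₁ hp hr he hF hN ht' x
    have e1 : Ioo 0 t' ×ˢ (univ : Set (EuclideanSpace ℝ (Fin n))) =
        Ioo 0 t ×ˢ univ ∪ Ico t t' ×ˢ univ := by
      rw [← union_prod, Ioo_union_Ico_eq_Ioo ht htt.le]
    have hdisj : Disjoint (Ioo 0 t ×ˢ (univ : Set (EuclideanSpace ℝ (Fin n))))
        (Ico t t' ×ˢ univ) := by
      rw [disjoint_left]
      rintro z ⟨hz, -⟩ ⟨hz', -⟩
      exact absurd hz.2 (not_lt.2 hz'.1)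
    have cl : IntegrableOn (fun w : ℝ × EuclideanSpace ℝ (Fin n) =>
        kernel α (t' - w.1) (x - w.2) * F w) (Ioo 0 t ×ˢ univ) :=
      c'.mono_set (by rw [e1]; exact subset_union_left)
    have cr : IntegrableOn (fun w : ℝ × EuclideanSpace ℝ (Fin n) =>
        kernel α (t' - w.1) (x - w.2) * F w) (Ico t t' ×ˢ univ) :=
      c'.mono_set (by rw [e1]; exact subset_union_right)
    have hsplit : duhamel α F (t', x) - duhamel α F (t, x) =
        (∫ w in Ioo 0 t ×ˢ univ, (kernel α (t' - w.1) (x - w.2) - kernel α (t - w.1) (x - w.2)) *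
          F w) + ∫ w in Ico t t' ×ˢ univ, kernel α (t' - w.1) (x - w.2) * F w := by
      rw [duhamel_eq_setIntegral ht.le c, duhamel_eq_setIntegral ht'.le c', e1,
        setIntegral_union hdisj (measurableSet_Ico.prod MeasurableSet.univ) cl cr]
      simp only [sub_mul]
      rw [integral_sub cl c]
      ring
    have b1 := (integrableOn_slab hp hr hF hN measurableSet_Ioo Ioo_subset_Ioi_self (I := Ioo 0 t)
      (D := fun s y => kernel α (t' - s) y - kernel α (t - s) y)
      (w := fun s => C₂ * (min 1 (((t' - t) / (t - s)) ^ (1 : ℝ)) * (t - s) ^ (-e)))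
      (((measurable_kernel α).comp (by fun_prop : Measurable fun z : ℝ × EuclideanSpace ℝ (Fin n) =>
        (t' - z.1, z.2))).sub ((measurable_kernel α).comp (by fun_prop :
        Measurable fun z : ℝ × EuclideanSpace ℝ (Fin n) => (t - z.1, z.2)))) (by fun_prop)
      (fun s hs => by
        have hτ : 0 < t - s := sub_pos.2 hs.2
        have hm : 0 ≤ min 1 ((t' - t) / (t - s)) := le_min zero_le_one (by positivity)
        have hkb := hK₂ _ hτ (t' - t) hh.le
        have e2 : t - s + (t' - t) = t' - s := by ring
        rw [e2] at hkb
        refine ⟨_, _, mul_nonneg hC₂.le hm, Real.rpow_nonneg hτ.le _, hkb, ?_⟩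
        rw [kernel_weight_rpow hτ, Real.rpow_one, mul_assoc]) x
      (B := C₂ * (C' * (t' - t) ^ (1 / r - e))) (by positivity)
      (lintegral_weight_le hr.pos hC₂.le (I := Ioo 0 t)
        (φ := fun τ => min 1 (((t' - t) / τ) ^ (1 : ℝ)) * τ ^ (-e)) (fun s hs => hs.2)
        (by fun_prop) (hI _ hh))).2
    have b2 := (integrableOn_slab hp hr hF hN measurableSet_Ico
      (fun s hs => ht.trans_le hs.1) (I := Ico t t')
      (D := fun s => kernel α (t' - s))
      (w := fun s => C₁ * (min 1 (((t' - t) / (t' - s)) ^ (1 : ℝ)) * (t' - s) ^ (-e)))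
      ((measurable_kernel α).comp (by fun_prop : Measurable fun z : ℝ × EuclideanSpace ℝ (Fin n) =>
        (t' - z.1, z.2))) (by fun_prop)
      (fun s hs => by
        have hτ : 0 < t' - s := sub_pos.2 hs.2
        refine ⟨C₁, _, hC₁.le, Real.rpow_nonneg hτ.le _, hK₁ _ hτ, ?_⟩
        rw [kernel_weight_rpow hτ, Real.rpow_one, min_eq_left, one_mul]
        rw [one_le_div hτ]; linarith [hs.1]) x
      (B := C₁ * (C' * (t' - t) ^ (1 / r - e))) (by positivity)
      (lintegral_weight_le hr.pos hC₁.le (I := Ico t t')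
        (φ := fun τ => min 1 (((t' - t) / τ) ^ (1 : ℝ)) * τ ^ (-e)) (fun s hs => hs.2)
        (by fun_prop) (hI _ hh))).2
    rw [hsplit]
    refine (abs_add_le _ _).trans ((add_le_add b1 b2).trans (le_of_eq ?_))
    ring
  intro t t' ht ht' x
  rcases lt_trichotomy t t' with h | h | h
  · rw [abs_sub_comm, abs_sub_comm t t', abs_of_pos (sub_pos.2 h)]
    exact key t t' ht h x
  · subst h
    rw [sub_self, abs_zero]; positivity
  · rw [abs_of_pos (sub_pos.2 h)]
    exact key t' t ht' h x

/-- Common to both ranges of θ, which differ only in the majorant φ chosen for the weight of a space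
increment. -/
theorem abs_duhamel_sub_space_le_of_weight (hα₀ : 0 < α) (hα₁ : α < 1) (hp : 1 ≤ p)
    (hr : r.HolderConjugate q) (he : n / (2 * α * p) < 1 / r) : ∃ C : ℝ, 0 < C ∧
    ∀ F : ℝ × EuclideanSpace ℝ (Fin n) → ℝ, Measurable F → mixedNorm p q F < ∞ →
    ∀ t : ℝ, 0 < t → ∀ x x' : EuclideanSpace ℝ (Fin n), ∀ (φ : ℝ → ℝ) (B : ℝ), Measurable φ →
      0 ≤ B →
      (∀ τ, 0 < τ → τ < t →
        min 1 (τ ^ (-(1 / (2 * α))) * ‖x - x'‖) * τ ^ (-(n / (2 * α * p))) ≤ φ τ) →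
      (∫⁻ τ in Ioi (0 : ℝ), ENNReal.ofReal (φ τ) ^ r) ^ (1 / r) ≤ ENNReal.ofReal B →
      |duhamel α F (t, x) - duhamel α F (t, x')| ≤ C * B * (mixedNorm p q F).toReal := by
  obtain ⟨C, hC, hK⟩ := kernelBound_translate (n := n) hα₀ hα₁
  refine ⟨C, hC, fun F hF hN t ht x x' φ B hφ hB hle hint => ?_⟩
  have c := duhamelConverges_of_subcritical hα₀ hα₁ hp hr he hF hN ht x
  have c' := duhamelConverges_of_subcritical hα₀ hα₁ hp hr he hF hN ht x'
  have b := (integrableOn_slab hp hr hF hN measurableSet_Ioo Ioo_subset_Ioi_self (I := Ioo 0 t)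
    (D := fun s y => kernel α (t - s) (y + (x - x')) - kernel α (t - s) y)
    (w := fun s => C * φ (t - s))
    (((measurable_kernel α).comp (by fun_prop : Measurable fun z : ℝ × EuclideanSpace ℝ (Fin n) =>
      (t - z.1, z.2 + (x - x')))).sub ((measurable_kernel α).comp (by fun_prop :
      Measurable fun z : ℝ × EuclideanSpace ℝ (Fin n) => (t - z.1, z.2)))) (by fun_prop)
    (fun s hs => by
      have hτ : 0 < t - s := sub_pos.2 hs.2
      have hm : 0 ≤ min 1 ((t - s) ^ (-(1 / (2 * α))) * ‖x - x'‖) :=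
        le_min zero_le_one (by positivity)
      refine ⟨_, _, mul_nonneg hC.le hm, Real.rpow_nonneg hτ.le _, hK _ hτ (x - x'), ?_⟩
      rw [kernel_weight_rpow hτ, mul_assoc]
      exact mul_le_mul_of_nonneg_left (hle _ hτ (by linarith [hs.1])) hC.le) x'
    (B := C * B) (by positivity)
    (lintegral_weight_le hr.pos hC.le (I := Ioo 0 t) (fun s hs => hs.2) hφ hint)).2
  refine le_trans (le_of_eq ?_) b
  rw [duhamel_eq_setIntegral ht.le c, duhamel_eq_setIntegral ht.le c', ← integral_sub c c']
  congr 2; ext w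
  rw [← sub_mul]
  congr 3
  abel

theorem abs_duhamel_sub_space_le_of_lt_one (hα₀ : 0 < α) (hα₁ : α < 1) (hp : 1 ≤ p)
    (hr : r.HolderConjugate q) (he : n / (2 * α * p) < 1 / r)
    (hθ : exponent n α p q < 1) : ∃ C : ℝ, 0 < C ∧
    ∀ F : ℝ × EuclideanSpace ℝ (Fin n) → ℝ, Measurable F → mixedNorm p q F < ∞ →
    ∀ t : ℝ, 0 < t → ∀ x x' : EuclideanSpace ℝ (Fin n),
      |duhamel α F (t, x) - duhamel α F (t, x')| ≤
        C * ‖x - x'‖ ^ exponent n α p q * (mixedNorm p q F).toReal := by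
  obtain ⟨C, hC, hK⟩ := abs_duhamel_sub_space_le_of_weight hα₀ hα₁ hp hr he
  rw [exponent_eq hα₀ hr] at *
  set e : ℝ := n / (2 * α * p) with hedef
  have h2α : 0 < 2 * α := by positivity
  -- The far condition with κ = 1/(2α) is exactly θ < 1.
  have hκ : 1 < (1 / (2 * α) + e) * r := by
    have h1 : 1 / r - e < 1 / (2 * α) := by rw [lt_div_iff₀ h2α]; linarith
    have h2 : 1 / r < 1 / (2 * α) + e := by linarith
    rwa [div_lt_iff₀ hr.pos] at h2
  obtain ⟨C', hC', hI⟩ := lintegral_min_rpow_le (κ := 1 / (2 * α)) (e := e) hr.pos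
    (by rwa [lt_div_iff₀ hr.pos] at he) hκ
  refine ⟨C * C', by positivity, fun F hF hN t ht x x' => ?_⟩
  rcases eq_or_ne x x' with rfl | hx
  · rw [sub_self, abs_zero]; positivity
  have hx0 : 0 < ‖x - x'‖ := norm_pos_iff.2 (sub_ne_zero.2 hx)
  -- The parabolic choice σ = |x - x'|^{2α} turns (σ/τ)^{1/(2α)} into the ratio of the kernel bound,
  -- and σ^{1/r-e} into |x - x'|^θ.
  have hσ : 0 < ‖x - x'‖ ^ (2 * α) := Real.rpow_pos_of_pos hx0 _
  have b := hK F hF hN t ht x x'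
    (fun τ => min 1 ((‖x - x'‖ ^ (2 * α) / τ) ^ (1 / (2 * α))) * τ ^ (-e)) _ (by fun_prop)
    (by positivity)
    (fun τ hτ _ => by
      rw [Real.div_rpow hσ.le hτ.le, ← Real.rpow_mul hx0.le, mul_one_div_cancel h2α.ne',
        Real.rpow_one, Real.rpow_neg hτ.le, inv_mul_eq_div])
    (hI _ hσ)
  rw [← Real.rpow_mul hx0.le, ← mul_assoc] at b
  exact b

/-- The inequality min(1, u) ≤ u^γ extracts |x - x'|^γ at the price of a stronger singularity
τ^{-e'} with e' = e + γ/(2α), still in L^r near 0 because γ < θ. Large τ is excluded by t ≤ T,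
whence the dependence on T. -/
theorem abs_duhamel_sub_space_le_of_lt_exponent (hα₀ : 0 < α) (hα₁ : α < 1) (hp : 1 ≤ p)
    (hr : r.HolderConjugate q) (he : n / (2 * α * p) < 1 / r) {γ : ℝ} (hγ₀ : 0 < γ) (hγ₁ : γ ≤ 1)
    (hγ : γ < exponent n α p q) {T : ℝ} (hT : 0 < T) : ∃ C : ℝ, 0 < C ∧
    ∀ F : ℝ × EuclideanSpace ℝ (Fin n) → ℝ, Measurable F → mixedNorm p q F < ∞ →
    ∀ t : ℝ, 0 < t → t ≤ T → ∀ x x' : EuclideanSpace ℝ (Fin n),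
      |duhamel α F (t, x) - duhamel α F (t, x')| ≤
        C * ‖x - x'‖ ^ γ * (mixedNorm p q F).toReal := by
  obtain ⟨C, hC, hK⟩ := abs_duhamel_sub_space_le_of_weight hα₀ hα₁ hp hr he
  rw [exponent_eq hα₀ hr] at hγ
  set e : ℝ := n / (2 * α * p) with hedef
  have he0 : 0 ≤ e := by positivity
  have h2α : 0 < 2 * α := by positivity
  have hr1 := hr.lt
  set e' : ℝ := γ / (2 * α) + e with he'def
  have he'0 : 0 ≤ e' := by positivity
  have he' : e' * r < 1 := by
    have h1 : γ / (2 * α) < 1 / r - e := by rw [div_lt_iff₀ h2α]; linarith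
    have h2 : e' < 1 / r := by linarith
    rwa [lt_div_iff₀ hr.pos] at h2
  obtain ⟨C', hC', hI⟩ := lintegral_min_rpow_le (κ := 1) (e := e') hr.pos he' (by nlinarith)
  refine ⟨C * (C' * T ^ (1 / r - e')), by positivity, fun F hF hN t ht htT x x' => ?_⟩
  have hint : (∫⁻ τ in Ioi (0 : ℝ), ENNReal.ofReal
      (‖x - x'‖ ^ γ * (min 1 ((T / τ) ^ (1 : ℝ)) * τ ^ (-e'))) ^ r) ^ (1 / r) ≤
      ENNReal.ofReal (‖x - x'‖ ^ γ * (C' * T ^ (1 / r - e'))) := by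
    -- Used only to pull the constant |x - x'|^γ out of the norm; the reflection at t = 0 is undone
    -- on the next lines.
    have := lintegral_weight_le (t := 0) hr.pos
      (by positivity : 0 ≤ ‖x - x'‖ ^ γ) (I := Iio 0) subset_rfl
      (φ := fun τ => min 1 ((T / τ) ^ (1 : ℝ)) * τ ^ (-e')) (by fun_prop) (hI T hT)
    rwa [setLIntegral_Iio_sub_left 0 (fun τ => ENNReal.ofReal
      (‖x - x'‖ ^ γ * (min 1 ((T / τ) ^ (1 : ℝ)) * τ ^ (-e'))) ^ r)] at this
  have b := hK F hF hN t ht x x' _ _ (by fun_prop) (by positivity)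
    (fun τ hτ hτt => by
      have h1 : min 1 ((T / τ) ^ (1 : ℝ)) = 1 := by
        rw [Real.rpow_one, min_eq_left]
        rw [one_le_div hτ]; linarith
      have h2 : min 1 (τ ^ (-(1 / (2 * α))) * ‖x - x'‖) ≤
          (τ ^ (-(1 / (2 * α))) * ‖x - x'‖) ^ γ := by
        rcases le_total 1 (τ ^ (-(1 / (2 * α))) * ‖x - x'‖) with h | h
        · exact (min_le_left _ _).trans (Real.one_le_rpow h hγ₀.le)
        · exact (min_le_right _ _).trans
            (Real.self_le_rpow_of_le_one (by positivity) h hγ₁)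
      have h3 : ‖x - x'‖ ^ γ * (1 * τ ^ (-e')) =
          (τ ^ (-(1 / (2 * α))) * ‖x - x'‖) ^ γ * τ ^ (-e) := by
        rw [Real.mul_rpow (by positivity) (norm_nonneg _), ← Real.rpow_mul hτ.le, one_mul,
          mul_right_comm, ← Real.rpow_add hτ, mul_comm]
        congr 2
        rw [he'def]; ring
      rw [h1, h3]
      gcongr) hint
  refine b.trans (le_of_eq ?_)
  ring

end Holder

/-! ### Three-factor Hölder, reflection and the logarithmic integral. -/

section Auxiliary

theorem lintegral_mul_three_rpow_le {ι : Type*} [MeasurableSpace ι] {μ : Measure ι}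
    {f g h : ι → ℝ≥0∞} (hf : AEMeasurable f μ) (hg : AEMeasurable g μ) (hh : AEMeasurable h μ)
    {a b c : ℝ} (ha : 0 ≤ a) (hb : 0 ≤ b) (hc : 0 ≤ c) (habc : a + b + c = 1) :
    ∫⁻ x, f x ^ a * g x ^ b * h x ^ c ∂μ ≤
      (∫⁻ x, f x ∂μ) ^ a * (∫⁻ x, g x ∂μ) ^ b * (∫⁻ x, h x ∂μ) ^ c := by
  have key := ENNReal.lintegral_prod_norm_pow_le (μ := μ) (Finset.univ : Finset (Fin 3))
    (f := ![f, g, h]) (p := ![a, b, c])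
    (by intro i _; fin_cases i <;> assumption)
    (by simp [Fin.sum_univ_three, habc])
    (by intro i _; fin_cases i <;> assumption)
  simpa [Fin.prod_univ_three] using key

theorem setLIntegral_sub_left_le {t : ℝ} {I J : Set ℝ} (hI : MeasurableSet I)
    (hJ : MeasurableSet J) (h : ∀ s ∈ I, t - s ∈ J) (f : ℝ → ℝ≥0∞) :
    ∫⁻ s in I, f (t - s) ≤ ∫⁻ τ in J, f τ := by
  rw [← lintegral_indicator hI, ← lintegral_indicator hJ,
    ← lintegral_sub_left_eq_self (fun τ => J.indicator f τ) t]
  refine lintegral_mono fun s => ?_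
  by_cases hs : s ∈ I
  · rw [indicator_of_mem hs, indicator_of_mem (h s hs)]
  · rw [indicator_of_notMem hs]; exact zero_le

theorem lintegral_Icc_inv {δ t : ℝ} (hδ : 0 < δ) (hδt : δ ≤ t) :
    ∫⁻ τ in Icc δ t, ENNReal.ofReal τ⁻¹ = ENNReal.ofReal (Real.log (t / δ)) := by
  have hi : IntervalIntegrable (fun τ : ℝ => τ⁻¹) volume δ t := by
    refine (intervalIntegrable_inv_iff).2 (Or.inr ?_)
    rw [uIcc_of_le hδt]
    exact fun h => absurd h.1 (not_le.2 hδ)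
  have hi' : IntegrableOn (fun τ : ℝ => τ⁻¹) (Ioc δ t) :=
    (intervalIntegrable_iff_integrableOn_Ioc_of_le hδt).1 hi
  rw [← restrict_Ioc_eq_restrict_Icc, ← ofReal_integral_eq_lintegral_ofReal hi',
    ← intervalIntegral.integral_of_le hδt, integral_inv_of_pos hδ (hδ.trans_le hδt)]
  filter_upwards [ae_restrict_mem measurableSet_Ioc] with s hs using
    inv_nonneg.2 (hδ.trans hs.1).le

end Auxiliary

/-! ### The critical case: near and far contributions and the auxiliary potential. -/

section Potential

variable {n : ℕ}

/-- `(|K_τ| ∗ |F(s, ·)|)(x)`. -/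
def convNorm (α : ℝ) (F : ℝ × EuclideanSpace ℝ (Fin n) → ℝ) (τ s : ℝ)
    (x : EuclideanSpace ℝ (Fin n)) : ℝ≥0∞ :=
  ∫⁻ y, ‖kernel α τ (x - y)‖ₑ * ‖F (s, y)‖ₑ

/-- The weight `τ^{-1/2}` on `(0, T]`. -/
def timeWeight (T τ : ℝ) : ℝ≥0∞ :=
  (Ioc 0 T).indicator (fun τ => ENNReal.ofReal (τ ^ (-(1 / 2 : ℝ)))) τ

/-- The potential that controls the contribution of times close to `t` in `S_α F (t, x)`. -/
def potential (α p q T : ℝ) (F : ℝ × EuclideanSpace ℝ (Fin n) → ℝ)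
    (z : ℝ × EuclideanSpace ℝ (Fin n)) : ℝ≥0∞ :=
  ∫⁻ s in Ioi (0 : ℝ), (convNorm α F (z.1 - s) s z.2 / spatialNorm p F s) ^ p *
    (spatialNorm p F s ^ q * timeWeight T (z.1 - s))

theorem measurable_timeWeight (T : ℝ) : Measurable (timeWeight T) :=
  Measurable.indicator (by fun_prop) measurableSet_Ioc

theorem lintegral_timeWeight {T : ℝ} (hT : 0 < T) :
    ∫⁻ τ, timeWeight T τ = ENNReal.ofReal (2 * T ^ (1 / 2 : ℝ)) := by
  simp only [timeWeight]
  rw [lintegral_indicator measurableSet_Ioc, lintegral_Ioc_rpow (by norm_num) hT]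
  congr 1
  norm_num
  ring

variable {α p q r C T : ℝ} {F : ℝ × EuclideanSpace ℝ (Fin n) → ℝ}

theorem measurable_convNorm (hF : Measurable F) :
    Measurable fun w : (ℝ × ℝ) × EuclideanSpace ℝ (Fin n) => convNorm α F w.1.1 w.1.2 w.2 := by
  have h1 : Measurable fun w : ((ℝ × ℝ) × EuclideanSpace ℝ (Fin n)) × EuclideanSpace ℝ (Fin n) =>
      kernel α w.1.1.1 (w.1.2 - w.2) := measurable_kernel_comp α (by fun_prop) (by fun_prop)
  exact Measurable.lintegral_prod_right' (f := fun
    w : ((ℝ × ℝ) × EuclideanSpace ℝ (Fin n)) × EuclideanSpace ℝ (Fin n) =>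
      ‖kernel α w.1.1.1 (w.1.2 - w.2)‖ₑ * ‖F (w.1.1.2, w.2)‖ₑ) (by fun_prop)

theorem measurable_convNorm_comp {X : Type*} [MeasurableSpace X] (hF : Measurable F) {f g : X → ℝ}
    {h : X → EuclideanSpace ℝ (Fin n)} (hf : Measurable f) (hg : Measurable g)
    (hh : Measurable h) : Measurable fun x => convNorm α F (f x) (g x) (h x) := by
  have h' := (measurable_convNorm (α := α) hF).comp ((hf.prodMk hg).prodMk hh)
  exact h'

theorem measurable_potential_integrand (hF : Measurable F) :
    Measurable fun w : (ℝ × EuclideanSpace ℝ (Fin n)) × ℝ =>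
      (convNorm α F (w.1.1 - w.2) w.2 w.1.2 / spatialNorm p F w.2) ^ p *
        (spatialNorm p F w.2 ^ q * timeWeight T (w.1.1 - w.2)) := by
  have h1 : Measurable fun w : (ℝ × EuclideanSpace ℝ (Fin n)) × ℝ =>
      convNorm α F (w.1.1 - w.2) w.2 w.1.2 :=
    measurable_convNorm_comp hF (by fun_prop) (by fun_prop) (by fun_prop)
  have h2 := measurable_spatialNorm (p := p) hF
  have h3 := measurable_timeWeight T
  fun_prop

theorem measurable_potential (hF : Measurable F) : Measurable (potential α p q T F) :=
  Measurable.lintegral_prod_right' (measurable_potential_integrand hF)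

theorem mixedNorm_rpow_eq (hq : 0 < q) :
    ∫⁻ s in Ioi (0 : ℝ), spatialNorm p F s ^ q = mixedNorm p q F ^ q := by
  rw [mixedNorm_eq, ← ENNReal.rpow_mul, one_div_mul_cancel hq.ne', ENNReal.rpow_one]

theorem convNorm_le
    (hK : ∀ τ : ℝ, 0 < τ → KernelBound (volume : Measure (EuclideanSpace ℝ (Fin n)))
      (kernel α τ) C (τ ^ (-(n / (2 * α)))))
    (hC : 0 ≤ C) (hp : 1 ≤ p) (hF : Measurable F) {τ : ℝ} (hτ : 0 < τ) (s : ℝ)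
    (x : EuclideanSpace ℝ (Fin n)) : convNorm α F τ s x ≤
      ENNReal.ofReal (C * τ ^ (-(n / (2 * α * p)))) * spatialNorm p F s := by
  have h := (hK τ hτ).lintegral_conv_le hC (Real.rpow_nonneg hτ.le _) hp
    (f := fun y => ‖F (s, y)‖ₑ) (by fun_prop) x
  rwa [kernel_weight_rpow hτ] at h

theorem lintegral_convNorm_div_rpow_le
    (hK : ∀ τ : ℝ, 0 < τ → KernelBound (volume : Measure (EuclideanSpace ℝ (Fin n)))
      (kernel α τ) C (τ ^ (-(n / (2 * α)))))
    (hC : 0 ≤ C) (hp : 1 ≤ p) (hF : Measurable F) {τ : ℝ}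
    (hτ : 0 < τ) (s : ℝ) : ∫⁻ x, (convNorm α F τ s x / spatialNorm p F s) ^ p ≤
      ENNReal.ofReal (C ^ p) := by
  have hp0 : 0 < p := by linarith
  have h := (hK τ hτ).lintegral_conv_rpow_le hC hp (f := fun y => ‖F (s, y)‖ₑ) (by fun_prop)
  have hg : ∫⁻ y, ‖F (s, y)‖ₑ ^ p = spatialNorm p F s ^ p := by
    rw [spatialNorm, ← ENNReal.rpow_mul, one_div_mul_cancel hp0.ne', ENNReal.rpow_one]
  rw [hg] at h
  have mG : Measurable fun x => convNorm α F τ s x :=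
    measurable_convNorm_comp hF measurable_const measurable_const measurable_id
  simp only [ENNReal.div_rpow_of_nonneg _ _ hp0.le]
  simp only [div_eq_mul_inv]
  rw [lintegral_mul_const _ (by fun_prop), ← div_eq_mul_inv]
  exact ENNReal.div_le_of_le_mul h

/-- Tonelli: the normalised convolution has p-th power integral at most C^p in x, the time weight
has integral 2√T in t, and what remains is ‖F‖^q. -/
theorem lintegral_potential_le
    (hK : ∀ τ : ℝ, 0 < τ → KernelBound (volume : Measure (EuclideanSpace ℝ (Fin n)))
      (kernel α τ) C (τ ^ (-(n / (2 * α)))))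
    (hC : 0 ≤ C) (hp : 1 ≤ p) (hq : 0 < q) (hF : Measurable F)
    (hT : 0 < T) : ∫⁻ z, potential α p q T F z ≤
      ENNReal.ofReal (C ^ p * (2 * T ^ (1 / 2 : ℝ))) * mixedNorm p q F ^ q := by
  have hg := measurable_spatialNorm (p := p) hF
  have hw := measurable_timeWeight T
  have hm := measurable_potential_integrand (α := α) (p := p) (q := q) (T := T) hF
  rw [Measure.volume_eq_prod, lintegral_prod _ (measurable_potential hF).aemeasurable]
  calc ∫⁻ t, ∫⁻ x, potential α p q T F (t, x)
      = ∫⁻ t, ∫⁻ s in Ioi (0 : ℝ), ∫⁻ x, (convNorm α F (t - s) s x / spatialNorm p F s) ^ p *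
          (spatialNorm p F s ^ q * timeWeight T (t - s)) := by
        refine lintegral_congr fun t => ?_
        have hc : Measurable fun w : EuclideanSpace ℝ (Fin n) × ℝ => ((t, w.1), w.2) := by fun_prop
        have hmc := hm.comp hc
        exact lintegral_lintegral_swap hmc.aemeasurable
    _ ≤ ∫⁻ t, ∫⁻ s in Ioi (0 : ℝ), ENNReal.ofReal (C ^ p) *
          (spatialNorm p F s ^ q * timeWeight T (t - s)) := by
        refine lintegral_mono fun t => lintegral_mono fun s => ?_
        have mG : Measurable fun x => convNorm α F (t - s) s x :=
          measurable_convNorm_comp hF measurable_const measurable_const measurable_id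
        simp only
        rw [lintegral_mul_const _ (by fun_prop)]
        by_cases h : t - s ∈ Ioc 0 T
        · gcongr
          exact lintegral_convNorm_div_rpow_le hK hC hp hF h.1 s
        · have : timeWeight T (t - s) = 0 := indicator_of_notMem h _
          simp [this]
    _ = ∫⁻ s in Ioi (0 : ℝ), ∫⁻ t, ENNReal.ofReal (C ^ p) *
          (spatialNorm p F s ^ q * timeWeight T (t - s)) :=
        lintegral_lintegral_swap (Measurable.aemeasurable (by fun_prop))
    _ = ∫⁻ s in Ioi (0 : ℝ), ENNReal.ofReal (C ^ p * (2 * T ^ (1 / 2 : ℝ))) *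
          spatialNorm p F s ^ q := by
        refine lintegral_congr fun s => ?_
        rw [lintegral_const_mul _ (by fun_prop), lintegral_const_mul _ (by fun_prop),
          lintegral_sub_right_eq_self (timeWeight T) s, lintegral_timeWeight hT,
          ENNReal.ofReal_mul (by positivity : 0 ≤ C ^ p)]
        ring
    _ = _ := by rw [lintegral_const_mul _ (by fun_prop), mixedNorm_rpow_eq hq]

/-- At the critical exponent the r-th power of the weight is C^r/τ, whose integral over [δ, t] is
the source of the logarithm. -/
theorem lintegral_convNorm_far_le
    (hK : ∀ τ : ℝ, 0 < τ → KernelBound (volume : Measure (EuclideanSpace ℝ (Fin n)))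
      (kernel α τ) C (τ ^ (-(n / (2 * α)))))
    (hC : 0 ≤ C) (hp : 1 ≤ p) (hr : r.HolderConjugate q)
    (he : n / (2 * α * p) = 1 / r) (hF : Measurable F) {t δ : ℝ} (hδ : 0 < δ) (hδt : δ ≤ t)
    (x : EuclideanSpace ℝ (Fin n)) :
    ∫⁻ s in Ioc 0 (t - δ), convNorm α F (t - s) s x ≤
      ENNReal.ofReal (C * Real.log (t / δ) ^ (1 / r)) * mixedNorm p q F := by
  have hg := measurable_spatialNorm (p := p) hF
  have hr0 := hr.pos
  have hq0 : 0 < q := hr.symm.pos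
  have hlog : 0 ≤ Real.log (t / δ) := Real.log_nonneg ((one_le_div hδ).2 hδt)
  calc ∫⁻ s in Ioc 0 (t - δ), convNorm α F (t - s) s x
      ≤ ∫⁻ s in Ioc 0 (t - δ), ENNReal.ofReal (C * (t - s) ^ (-(1 / r))) * spatialNorm p F s := by
        refine setLIntegral_mono' measurableSet_Ioc fun s hs => ?_
        rw [← he]
        exact convNorm_le hK hC hp hF (by linarith [hs.2]) s x
    _ ≤ (∫⁻ s in Ioc 0 (t - δ), ENNReal.ofReal (C * (t - s) ^ (-(1 / r))) ^ r) ^ (1 / r) *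
        (∫⁻ s in Ioc 0 (t - δ), spatialNorm p F s ^ q) ^ (1 / q) :=
        ENNReal.lintegral_mul_le_Lp_mul_Lq _ hr
          (f := fun s => ENNReal.ofReal (C * (t - s) ^ (-(1 / r)))) (by fun_prop) hg.aemeasurable
    _ ≤ (ENNReal.ofReal (C ^ r * Real.log (t / δ))) ^ (1 / r) *
        (mixedNorm p q F ^ q) ^ (1 / q) := by
        gcongr
        · calc ∫⁻ s in Ioc 0 (t - δ), ENNReal.ofReal (C * (t - s) ^ (-(1 / r))) ^ r
              ≤ ∫⁻ τ in Icc δ t, ENNReal.ofReal (C * τ ^ (-(1 / r))) ^ r :=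
                setLIntegral_sub_left_le measurableSet_Ioc measurableSet_Icc
                  (fun s hs => ⟨by linarith [hs.2], by linarith [hs.1]⟩)
                  (fun τ => ENNReal.ofReal (C * τ ^ (-(1 / r))) ^ r)
            _ = ∫⁻ τ in Icc δ t, ENNReal.ofReal (C ^ r) * ENNReal.ofReal τ⁻¹ := by
                refine setLIntegral_congr_fun measurableSet_Icc fun τ hτ => ?_
                have hτ0 : 0 < τ := hδ.trans_le hτ.1
                rw [ENNReal.ofReal_rpow_of_nonneg (by positivity) hr0.le,
                  Real.mul_rpow hC (by positivity), ← Real.rpow_mul hτ0.le,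
                  ENNReal.ofReal_mul (by positivity), neg_mul, one_div_mul_cancel hr0.ne',
                  Real.rpow_neg_one]
            _ = _ := by
                rw [lintegral_const_mul _ (by fun_prop), lintegral_Icc_inv hδ hδt,
                  ENNReal.ofReal_mul (by positivity)]
        · rw [← mixedNorm_rpow_eq hq0]
          exact lintegral_mono_set Ioc_subset_Ioi_self
    _ = _ := by
        rw [← ENNReal.rpow_mul, mul_one_div_cancel hq0.ne', ENNReal.rpow_one,
          ENNReal.ofReal_rpow_of_nonneg (by positivity) (by positivity),
          Real.mul_rpow (by positivity) hlog, ← Real.rpow_mul hC, mul_one_div_cancel hr0.ne',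
          Real.rpow_one]

/-- With g the spatial norm and v = `convNorm`/g, write v = v^{1-p/m} v^{p/m}, m = p + q, and use v
≤ C τ^{-1/r} only in the first factor. The second factor joins g^{q/m} to form the integrand of the
potential. The gain is a power of τ slightly less singular than τ^{-1/r}. -/
theorem convNorm_le_near_factors
    (hK : ∀ τ : ℝ, 0 < τ → KernelBound (volume : Measure (EuclideanSpace ℝ (Fin n)))
      (kernel α τ) C (τ ^ (-(n / (2 * α)))))
    (hC : 0 ≤ C) (hp : 1 ≤ p) (hr : r.HolderConjugate q)
    (he : n / (2 * α * p) = 1 / r) (hF : Measurable F) {τ : ℝ} (hτ : 0 < τ) (hτT : τ ≤ T) {s : ℝ}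
    (hs : spatialNorm p F s ≠ ∞) (x : EuclideanSpace ℝ (Fin n)) :
    convNorm α F τ s x ≤ ENNReal.ofReal (C ^ (1 - p / (p + q))) *
      (ENNReal.ofReal (τ ^ (-(1 - (p / r + 1 / 2) / (p + q) * r))) ^ (1 / r) *
        ((convNorm α F τ s x / spatialNorm p F s) ^ p *
          (spatialNorm p F s ^ q * timeWeight T τ)) ^ (1 / (p + q)) *
        (spatialNorm p F s ^ q) ^ (1 / q - 1 / (p + q))) := by
  have hr0 := hr.pos
  have hq0 : 0 < q := hr.symm.pos
  have hp0 : 0 < p := by linarith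
  have hm0 : 0 < p + q := by linarith
  set m := p + q with hm
  set g := spatialNorm p F s with hg
  set v := convNorm α F τ s x / g with hv
  have hle := convNorm_le hK hC hp hF hτ s x
  have hvle : v ≤ ENNReal.ofReal (C * τ ^ (-(1 / r))) := by
    rw [← he]; exact ENNReal.div_le_of_le_mul hle
  have hG : convNorm α F τ s x = v * g := by
    -- For g = 0 the quotient says nothing, but the pointwise bound already makes the convolution
    -- vanish.
    rcases eq_or_ne g 0 with h0 | h0
    · rw [h0, mul_zero]
      have : convNorm α F τ s x ≤ 0 := by
        refine hle.trans (le_of_eq ?_)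
        rw [← hg, h0, mul_zero]
      exact le_antisymm this zero_le
    · rw [hv, ENNReal.div_mul_cancel h0 hs]
  have h1 : 0 ≤ 1 - p / m := by
    rw [sub_nonneg, div_le_one hm0]; linarith
  have h2 : 0 ≤ p / m := by positivity
  have h3 : 0 ≤ q / m := by positivity
  have h4 : 0 ≤ 1 - q / m := by
    rw [sub_nonneg, div_le_one hm0]; linarith
  have hv' : v ≤ ENNReal.ofReal (C * τ ^ (-(1 / r))) ^ (1 - p / m) * v ^ (p / m) := by
    calc v = v ^ (1 - p / m) * v ^ (p / m) := by
          rw [← ENNReal.rpow_add_of_nonneg _ _ h1 h2]; simp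
      _ ≤ _ := by gcongr
  have hwt : timeWeight T τ = ENNReal.ofReal (τ ^ (-(1 / 2 : ℝ))) :=
    indicator_of_mem (show τ ∈ Ioc 0 T from ⟨hτ, hτT⟩) _
  have hmul : (v ^ p * (g ^ q * timeWeight T τ)) ^ (1 / m) =
      v ^ (p / m) * g ^ (q / m) * ENNReal.ofReal (τ ^ (-(1 / 2 : ℝ) * (1 / m))) := by
    have hm1 : 0 ≤ 1 / m := by positivity
    rw [hwt, ENNReal.mul_rpow_of_nonneg _ _ hm1, ENNReal.mul_rpow_of_nonneg _ _ hm1,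
      ← ENNReal.rpow_mul, ← ENNReal.rpow_mul, ENNReal.ofReal_rpow_of_nonneg (by positivity) hm1,
      ← Real.rpow_mul hτ.le, mul_one_div, mul_one_div, mul_assoc]
  have hgg : (g ^ q) ^ (1 / q - 1 / m) = g ^ (1 - q / m) := by
    rw [← ENNReal.rpow_mul]; congr 1; field_simp
  have hg1 : g ^ (q / m) * g ^ (1 - q / m) = g := by
    rw [← ENNReal.rpow_add_of_nonneg _ _ h3 h4]; simp
  have hreal : ENNReal.ofReal (C * τ ^ (-(1 / r))) ^ (1 - p / m) =
      ENNReal.ofReal (C ^ (1 - p / m)) *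
        (ENNReal.ofReal (τ ^ (-(1 - (p / r + 1 / 2) / m * r))) ^ (1 / r) *
          ENNReal.ofReal (τ ^ (-(1 / 2 : ℝ) * (1 / m)))) := by
    rw [ENNReal.ofReal_rpow_of_nonneg (by positivity) h1,
      ENNReal.ofReal_rpow_of_nonneg (by positivity) (by positivity), ← ENNReal.ofReal_mul
      (by positivity), ← ENNReal.ofReal_mul (by positivity), Real.mul_rpow hC (by positivity),
      ← Real.rpow_mul hτ.le, ← Real.rpow_mul hτ.le, ← Real.rpow_add hτ]
    congr 3
    field_simp
    ring
  rw [hmul, hgg]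
  calc convNorm α F τ s x = v * g := hG
    _ ≤ (ENNReal.ofReal (C * τ ^ (-(1 / r))) ^ (1 - p / m) * v ^ (p / m)) * g := by gcongr
    _ = (ENNReal.ofReal (C * τ ^ (-(1 / r))) ^ (1 - p / m) * v ^ (p / m)) *
        (g ^ (q / m) * g ^ (1 - q / m)) := by rw [hg1]
    _ = _ := by rw [hreal]; ring

/-- Hölder with exponents 1/r, 1/(p+q) and 1/q - 1/(p+q), which sum to 1. The gained power of τ is
integrable up to 0 and produces the positive power of δ. -/
theorem lintegral_convNorm_near_le
    (hK : ∀ τ : ℝ, 0 < τ → KernelBound (volume : Measure (EuclideanSpace ℝ (Fin n)))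
      (kernel α τ) C (τ ^ (-(n / (2 * α)))))
    (hC : 0 ≤ C) (hp : 1 ≤ p) (hr : r.HolderConjugate q)
    (he : n / (2 * α * p) = 1 / r) (hF : Measurable F) (hN : mixedNorm p q F < ∞) {t δ : ℝ}
    (hδ : 0 < δ) (hδt : δ ≤ t) (htT : t ≤ T) (x : EuclideanSpace ℝ (Fin n)) :
    ∫⁻ s in Ioo (t - δ) t, convNorm α F (t - s) s x ≤
      ENNReal.ofReal (C ^ (1 - p / (p + q)) *
        ((1 / ((p / r + 1 / 2) / (p + q) * r)) ^ (1 / r) * δ ^ ((p / r + 1 / 2) / (p + q)))) *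
        (potential α p q T F (t, x) ^ (1 / (p + q)) *
          (mixedNorm p q F ^ q) ^ (1 / q - 1 / (p + q))) := by
  have hr0 := hr.pos
  have hq0 : 0 < q := hr.symm.pos
  have hp0 : 0 < p := by linarith
  have hm0 : 0 < p + q := by linarith
  have hg := measurable_spatialNorm (p := p) hF
  have hw := measurable_timeWeight T
  set m := p + q with hm
  set a := (p / r + 1 / 2) / m with ha
  have ha0 : 0 < a := by positivity
  have hsub : Ioo (t - δ) t ⊆ Ioi (0 : ℝ) := fun s hs => by
    have := hs.1; simp only [mem_Ioi]; linarith
  -- Recovering the convolution from v·g needs g finite, which holds for almost every s as g^q is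
  -- integrable.
  have hfin : ∀ᵐ s ∂(volume.restrict (Ioo (t - δ) t)), spatialNorm p F s ≠ ∞ := by
    have h1 : ∫⁻ s in Ioi (0 : ℝ), spatialNorm p F s ^ q ≠ ∞ := by
      rw [mixedNorm_rpow_eq hq0]
      exact (ENNReal.rpow_lt_top_of_nonneg hq0.le hN.ne).ne
    filter_upwards [ae_restrict_of_ae_restrict_of_subset hsub
      (ae_lt_top (by fun_prop) h1)] with s hs htop
    rw [htop, ENNReal.top_rpow_of_pos hq0] at hs
    exact lt_irrefl _ hs
  have hpm : Measurable fun s => (convNorm α F (t - s) s x / spatialNorm p F s) ^ p *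
      (spatialNorm p F s ^ q * timeWeight T (t - s)) := by
    have hc : Measurable fun s : ℝ => ((t, x), s) := by fun_prop
    have hmc := (measurable_potential_integrand (α := α) (p := p) (q := q) (T := T) hF).comp hc
    exact hmc
  have hexp : 0 ≤ 1 / q - 1 / m := by
    rw [sub_nonneg]
    exact one_div_le_one_div_of_le hq0 (by linarith)
  calc ∫⁻ s in Ioo (t - δ) t, convNorm α F (t - s) s x
      ≤ ∫⁻ s in Ioo (t - δ) t, ENNReal.ofReal (C ^ (1 - p / m)) *
        (ENNReal.ofReal ((t - s) ^ (-(1 - a * r))) ^ (1 / r) *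
        ((convNorm α F (t - s) s x / spatialNorm p F s) ^ p *
          (spatialNorm p F s ^ q * timeWeight T (t - s))) ^ (1 / m) *
        (spatialNorm p F s ^ q) ^ (1 / q - 1 / m)) := by
        refine lintegral_mono_ae ?_
        filter_upwards [hfin, ae_restrict_mem measurableSet_Ioo] with s hs hsI
        exact convNorm_le_near_factors hK hC hp hr he hF (by linarith [hsI.2])
          (by linarith [hsI.1]) hs x
    _ ≤ ENNReal.ofReal (C ^ (1 - p / m)) *
        ((∫⁻ s in Ioo (t - δ) t, ENNReal.ofReal ((t - s) ^ (-(1 - a * r)))) ^ (1 / r) *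
        (∫⁻ s in Ioo (t - δ) t, (convNorm α F (t - s) s x / spatialNorm p F s) ^ p *
          (spatialNorm p F s ^ q * timeWeight T (t - s))) ^ (1 / m) *
        (∫⁻ s in Ioo (t - δ) t, spatialNorm p F s ^ q) ^ (1 / q - 1 / m)) := by
        rw [lintegral_const_mul _ (by fun_prop)]
        gcongr
        refine lintegral_mul_three_rpow_le (Measurable.aemeasurable (by fun_prop))
          hpm.aemeasurable (Measurable.aemeasurable (by fun_prop)) (by positivity)
          (by positivity) hexp ?_
        have := hr.inv_add_inv_eq_one
        rw [one_div, one_div, one_div]; linarith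
    _ ≤ ENNReal.ofReal (C ^ (1 - p / m)) *
        (ENNReal.ofReal ((1 / (a * r)) ^ (1 / r) * δ ^ a) *
        potential α p q T F (t, x) ^ (1 / m) *
        (mixedNorm p q F ^ q) ^ (1 / q - 1 / m)) := by
        gcongr
        · calc (∫⁻ s in Ioo (t - δ) t, ENNReal.ofReal ((t - s) ^ (-(1 - a * r)))) ^ (1 / r)
              ≤ (∫⁻ τ in Ioc 0 δ, ENNReal.ofReal (τ ^ (-(1 - a * r)))) ^ (1 / r) := by
                refine ENNReal.rpow_le_rpow ?_ (by positivity)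
                exact setLIntegral_sub_left_le measurableSet_Ioo measurableSet_Ioc
                  (fun s hs => ⟨by linarith [hs.2], by linarith [hs.1]⟩)
                  (fun τ => ENNReal.ofReal (τ ^ (-(1 - a * r))))
            _ = _ := by
                have har : 0 < a * r := by positivity
                rw [lintegral_Ioc_rpow (by linarith) hδ, sub_sub_cancel,
                  ENNReal.ofReal_rpow_of_nonneg (by positivity) (by positivity),
                  div_eq_mul_one_div, Real.mul_rpow (by positivity) (by positivity),
                  ← Real.rpow_mul hδ.le, mul_assoc, mul_one_div_cancel hr0.ne', mul_one, mul_comm]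
        · exact lintegral_mono_set hsub
        · rw [← mixedNorm_rpow_eq hq0]
          exact lintegral_mono_set hsub
    _ = _ := by
        rw [ENNReal.ofReal_mul (by positivity : 0 ≤ C ^ (1 - p / m))]
        ring

end Potential

/-! ### The critical case: exponential integrability. -/

section Critical

variable {n : ℕ} {α p q r C T : ℝ} {F : ℝ × EuclideanSpace ℝ (Fin n) → ℝ}

theorem lintegral_convNorm_le_of_split
    (hK : ∀ τ : ℝ, 0 < τ → KernelBound (volume : Measure (EuclideanSpace ℝ (Fin n)))
      (kernel α τ) C (τ ^ (-(n / (2 * α)))))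
    (hC : 0 ≤ C) (hp : 1 ≤ p) (hr : r.HolderConjugate q)
    (he : n / (2 * α * p) = 1 / r) (hF : Measurable F) (hN : mixedNorm p q F < ∞)
    (hN0 : 0 < mixedNorm p q F) {t δ : ℝ}
    (hδ : 0 < δ) (hδt : δ ≤ t) (htT : t ≤ T) (x : EuclideanSpace ℝ (Fin n))
    (hP : potential α p q T F (t, x) ≠ ∞) :
    ∫⁻ s in Ioo 0 t, convNorm α F (t - s) s x ≤ ENNReal.ofReal ((mixedNorm p q F).toReal *
      (C * Real.log (t / δ) ^ (1 / r) +
        C ^ (1 - p / (p + q)) * (1 / ((p / r + 1 / 2) / (p + q) * r)) ^ (1 / r) *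
        (δ ^ (p / r + 1 / 2) *
          ((potential α p q T F (t, x)).toReal / (mixedNorm p q F).toReal ^ q)) ^
            (1 / (p + q)))) := by
  have hr0 := hr.pos
  have hq0 : 0 < q := hr.symm.pos
  have hp0 : 0 < p := by linarith
  have hm0 : 0 < p + q := by linarith
  have h1 := lintegral_convNorm_far_le hK hC hp hr he hF hδ hδt x
  have h2 := lintegral_convNorm_near_le hK hC hp hr he hF hN hδ hδt htT x
  have hlog : 0 ≤ Real.log (t / δ) := Real.log_nonneg ((one_le_div hδ).2 hδt)
  set N := (mixedNorm p q F).toReal with hNdef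
  set P := (potential α p q T F (t, x)).toReal with hPdef
  have hNe : mixedNorm p q F = ENNReal.ofReal N := (ENNReal.ofReal_toReal hN.ne).symm
  have hPe : potential α p q T F (t, x) = ENNReal.ofReal P := (ENNReal.ofReal_toReal hP).symm
  have hNpos : 0 < N := ENNReal.toReal_pos hN0.ne' hN.ne
  have hP0 : 0 ≤ P := ENNReal.toReal_nonneg
  have hexp : 0 ≤ 1 / q - 1 / (p + q) := by
    rw [sub_nonneg]
    exact one_div_le_one_div_of_le hq0 (by linarith)
  have hsub : Ioo 0 t ⊆ Ioc 0 (t - δ) ∪ Ioo (t - δ) t := fun s hs => by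
    rcases le_or_gt s (t - δ) with h | h
    · exact Or.inl ⟨hs.1, h⟩
    · exact Or.inr ⟨h, hs.2⟩
  refine (lintegral_mono_set hsub).trans ((lintegral_union_le _ _ _).trans
    ((add_le_add h1 h2).trans (le_of_eq ?_)))
  rw [hNe, hPe, ENNReal.ofReal_rpow_of_nonneg hNpos.le hq0.le,
    ENNReal.ofReal_rpow_of_nonneg hP0 (by positivity),
    ENNReal.ofReal_rpow_of_nonneg (by positivity) hexp, ← ENNReal.ofReal_mul (by positivity),
    ← ENNReal.ofReal_mul (by positivity), ← ENNReal.ofReal_mul (by positivity),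
    ← ENNReal.ofReal_add (by positivity) (by positivity)]
  congr 1
  have e1 : (δ ^ (p / r + 1 / 2) * (P / N ^ q)) ^ (1 / (p + q)) =
      δ ^ ((p / r + 1 / 2) / (p + q)) * (P ^ (1 / (p + q)) / N ^ (q / (p + q))) := by
    rw [Real.mul_rpow (by positivity) (by positivity), ← Real.rpow_mul hδ.le,
      Real.div_rpow hP0 (by positivity), ← Real.rpow_mul hNpos.le, mul_one_div, mul_one_div]
  have e2 : (N ^ q) ^ (1 / q - 1 / (p + q)) = N / N ^ (q / (p + q)) := by
    rw [← Real.rpow_mul hNpos.le, mul_sub, mul_one_div_cancel hq0.ne', mul_one_div,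
      Real.rpow_sub hNpos, Real.rpow_one]
  rw [e1, e2]
  ring

/-- Choose δ to balance the two contributions. With σ = p/r + 1/2 and u the normalised potential,
δ^σ u = 1 makes the near part constant and log(t/δ) equal to (1/σ) log(t^σ u). -/
theorem lintegral_convNorm_le_log
    (hK : ∀ τ : ℝ, 0 < τ → KernelBound (volume : Measure (EuclideanSpace ℝ (Fin n)))
      (kernel α τ) C (τ ^ (-(n / (2 * α)))))
    (hC : 0 < C) (hp : 1 ≤ p) (hr : r.HolderConjugate q)
    (he : n / (2 * α * p) = 1 / r) : ∃ A : ℝ, 0 < A ∧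
    ∀ T : ℝ, ∀ F : ℝ × EuclideanSpace ℝ (Fin n) → ℝ, Measurable F → mixedNorm p q F < ∞ →
    0 < mixedNorm p q F → ∀ t : ℝ, 0 < t → t ≤ T → ∀ x : EuclideanSpace ℝ (Fin n),
    potential α p q T F (t, x) ≠ ∞ →
    ∫⁻ s in Ioo 0 t, convNorm α F (t - s) s x ≤ ENNReal.ofReal ((mixedNorm p q F).toReal *
      (A * (1 + Real.log (max 1 (t ^ (p / r + 1 / 2) *
        ((potential α p q T F (t, x)).toReal / (mixedNorm p q F).toReal ^ q)))) ^ (1 / r))) := by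
  have hr0 := hr.pos
  have hq0 : 0 < q := hr.symm.pos
  have hp0 : 0 < p := by linarith
  have hm0 : 0 < p + q := by linarith
  set σ := p / r + 1 / 2 with hσ
  have hσ0 : 0 < σ := by positivity
  set C₁ := C ^ (1 - p / (p + q)) * (1 / (σ / (p + q) * r)) ^ (1 / r) with hC₁
  have hC₁0 : 0 < C₁ := by positivity
  refine ⟨C * (1 / σ) ^ (1 / r) + C₁, by positivity,
    fun T F hF hN hN0 t ht htT x hP => ?_⟩
  have key := fun δ (hδ : 0 < δ) (hδt : δ ≤ t) =>
    lintegral_convNorm_le_of_split hK hC.le hp hr he hF hN hN0 hδ hδt htT x hP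
  set N := (mixedNorm p q F).toReal with hNdef
  set u := (potential α p q T F (t, x)).toReal / N ^ q with hu
  have hN' : 0 ≤ N := ENNReal.toReal_nonneg
  have hu0 : 0 ≤ u := by positivity
  set L := Real.log (max 1 (t ^ σ * u)) with hL
  have hL0 : 0 ≤ L := Real.log_nonneg (le_max_left _ _)
  have hone : 1 ≤ (1 + L) ^ (1 / r) := Real.one_le_rpow (by linarith) (by positivity)
  have hLle : L ^ (1 / r) ≤ (1 + L) ^ (1 / r) :=
    Real.rpow_le_rpow hL0 (by linarith) (by positivity)
  -- If t^σ u ≤ 1 the balancing δ would exceed t (or not exist, when u = 0). Then δ = t is used: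
  -- there is no far part and the near part is bounded.
  rcases le_total (t ^ σ * u) 1 with h | h
  · refine (key t ht le_rfl).trans (ENNReal.ofReal_le_ofReal ?_)
    refine mul_le_mul_of_nonneg_left ?_ hN'
    have h1 : (t ^ σ * u) ^ (1 / (p + q)) ≤ 1 :=
      Real.rpow_le_one (by positivity) h (by positivity)
    rw [div_self ht.ne', Real.log_one, Real.zero_rpow (by positivity), mul_zero, zero_add]
    calc C₁ * (t ^ σ * u) ^ (1 / (p + q)) ≤ C₁ * 1 := by gcongr
      _ ≤ (C * (1 / σ) ^ (1 / r) + C₁) * (1 + L) ^ (1 / r) := by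
        gcongr
        have : 0 ≤ C * (1 / σ) ^ (1 / r) := by positivity
        linarith
  · have hupos : 0 < u := by
      rcases hu0.eq_or_lt with h0 | h0
      · rw [← h0, mul_zero] at h; linarith
      · exact h0
    set δ := u ^ (-(1 / σ)) with hδ
    have hδ0 : 0 < δ := by positivity
    have hδσ : δ ^ σ * u = 1 := by
      rw [hδ, ← Real.rpow_mul hu0, neg_mul, one_div_mul_cancel hσ0.ne', Real.rpow_neg_one,
        inv_mul_cancel₀ hupos.ne']
    have hδt : δ ≤ t := by
      rw [← Real.rpow_le_rpow_iff hδ0.le ht.le hσ0]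
      refine le_of_mul_le_mul_right ?_ hupos
      rwa [hδσ]
    have hlog : Real.log (t / δ) = 1 / σ * L := by
      have h1 : (t / δ) ^ σ = t ^ σ * u := by
        rw [Real.div_rpow ht.le hδ0.le, div_eq_iff (by positivity), mul_assoc, mul_comm u, hδσ,
          mul_one]
      rw [hL, max_eq_right h, ← h1, Real.log_rpow (by positivity)]
      field_simp
    refine (key δ hδ0 hδt).trans (ENNReal.ofReal_le_ofReal ?_)
    refine mul_le_mul_of_nonneg_left ?_ hN'
    rw [hδσ, Real.one_rpow, mul_one, hlog, Real.mul_rpow (by positivity) hL0, add_mul, mul_assoc]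
    refine add_le_add (by gcongr) ?_
    exact le_mul_of_one_le_right hC₁0.le hone

theorem duhamel_bounds_of_lintegral_lt_top (hF : Measurable F) {t : ℝ} (ht : 0 < t)
    (x : EuclideanSpace ℝ (Fin n))
    (h : ∫⁻ s in Ioo 0 t, convNorm α F (t - s) s x < ∞) :
    DuhamelConverges α F (t, x) ∧
      ‖duhamel α F (t, x)‖ₑ ≤ ∫⁻ s in Ioo 0 t, convNorm α F (t - s) s x := by
  have hm : Measurable fun w : ℝ × EuclideanSpace ℝ (Fin n) =>
      kernel α (t - w.1) (x - w.2) * F w :=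
    (measurable_kernel_comp α (by fun_prop) (by fun_prop)).mul hF
  have he : ∫⁻ w in Ioo 0 t ×ˢ univ, ‖kernel α (t - w.1) (x - w.2) * F w‖ₑ =
      ∫⁻ s in Ioo 0 t, convNorm α F (t - s) s x := by
    rw [volume_restrict_prod_univ, lintegral_prod _ hm.enorm.aemeasurable]
    simp only [enorm_mul, convNorm]
  have hconv : DuhamelConverges α F (t, x) :=
    ⟨hm.aestronglyMeasurable, by
      rw [HasFiniteIntegral]; exact he.trans_lt h⟩
  refine ⟨hconv, ?_⟩
  rw [duhamel_eq_setIntegral ht.le hconv, ← he]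
  exact enorm_integral_le_lintegral_enorm _

theorem aestronglyMeasurable_duhamel (hF : Measurable F) :
    AEStronglyMeasurable (duhamel α F) (volume.restrict (upperHalf n)) := by
  have h1 : Measurable fun w : ((ℝ × EuclideanSpace ℝ (Fin n)) × ℝ) × EuclideanSpace ℝ (Fin n) =>
      kernel α (w.1.1.1 - w.1.2) (w.1.1.2 - w.2) * F (w.1.2, w.2) :=
    (measurable_kernel_comp α (by fun_prop) (by fun_prop)).mul (by fun_prop)
  have h2 : StronglyMeasurable fun w : (ℝ × EuclideanSpace ℝ (Fin n)) × ℝ =>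
      ∫ y, kernel α (w.1.1 - w.2) (w.1.2 - y) * F (w.2, y) :=
    h1.stronglyMeasurable.integral_prod_right' (ν := volume)
  have hset : MeasurableSet {w : (ℝ × EuclideanSpace ℝ (Fin n)) × ℝ | w.2 ∈ Ioc 0 w.1.1} :=
    (measurableSet_lt measurable_const measurable_snd).inter
      (measurableSet_le measurable_snd (by fun_prop))
  have h3 := (h2.indicator hset).integral_prod_right' (ν := volume)
  refine ⟨_, h3, ?_⟩
  filter_upwards [ae_restrict_mem (measurableSet_Ioi.prod MeasurableSet.univ)] with z hz
  have hz0 : 0 < z.1 := hz.1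
  rw [duhamel, intervalIntegral.integral_of_le hz0.le, ← integral_indicator measurableSet_Ioc]
  rfl

/-- For r₀ = t₀^{1/(2α)} the time condition reads |t - t₀| < t₀, so the parabolic ball is a cylinder
over (0, 2t₀). -/
theorem parabolicBall_eq {t₀ : ℝ} (hα₀ : 0 < α) (ht₀ : 0 < t₀) (x₀ : EuclideanSpace ℝ (Fin n)) :
    parabolicBall α (t₀ ^ (1 / (2 * α))) t₀ x₀ =
      Ioo 0 (2 * t₀) ×ˢ Metric.ball x₀ (t₀ ^ (1 / (2 * α))) := by
  have h : (t₀ ^ (1 / (2 * α))) ^ (2 * α) = t₀ := by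
    rw [← Real.rpow_mul ht₀.le, one_div_mul_cancel (by positivity), Real.rpow_one]
  ext z
  simp only [parabolicBall, upperHalf, mem_ofPred_eq, mem_prod, mem_Ioi, mem_univ, and_true, h,
    mem_Ioo, Metric.mem_ball, dist_eq_norm, abs_lt]
  constructor
  · rintro ⟨h1, ⟨h2, h3⟩, h4⟩
    exact ⟨⟨h1, by linarith⟩, h4⟩
  · rintro ⟨⟨h1, h2⟩, h3⟩
    exact ⟨h1, ⟨by linarith, by linarith⟩, h3⟩

theorem volume_real_parabolicBall [NeZero n] {t₀ : ℝ} (hα₀ : 0 < α) (ht₀ : 0 < t₀)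
    (x₀ : EuclideanSpace ℝ (Fin n)) :
    volume.real (parabolicBall α (t₀ ^ (1 / (2 * α))) t₀ x₀) =
      2 * t₀ * (t₀ ^ (n / (2 * α)) *
        volume.real (Metric.ball (0 : EuclideanSpace ℝ (Fin n)) 1)) := by
  have h : (t₀ ^ (1 / (2 * α))) ^ n = t₀ ^ (n / (2 * α)) := by
    rw [← Real.rpow_natCast, ← Real.rpow_mul ht₀.le]; congr 1; field_simp
  rw [parabolicBall_eq hα₀ ht₀, measureReal_def, Measure.volume_eq_prod, Measure.prod_prod,
    Real.volume_Ioo, Measure.addHaar_ball _ _ (by positivity), finrank_euclideanSpace_fin,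
    ENNReal.toReal_mul, ENNReal.toReal_mul, ENNReal.toReal_ofReal (by linarith),
    ENNReal.toReal_ofReal (by positivity), h, sub_zero, measureReal_def]

/-- The power r cancels the exponent 1/r on the logarithm, so the exponential is linear in W. -/
theorem exp_rpow_div_le {A N W y : ℝ} (hA : 0 < A) (hN : 0 < N) (hr : 0 < r) (hW : 1 ≤ W)
    (hy0 : 0 ≤ y) (hy : y ≤ N * (A * (1 + Real.log W) ^ (1 / r))) :
    Real.exp ((y / (A * N)) ^ r) ≤ Real.exp 1 * W := by
  have hL := Real.log_nonneg hW
  have h1 : y / (A * N) ≤ (1 + Real.log W) ^ (1 / r) := by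
    rw [div_le_iff₀ (by positivity)]; linarith
  have h2 : (y / (A * N)) ^ r ≤ 1 + Real.log W := by
    refine (Real.rpow_le_rpow (by positivity) h1 hr.le).trans (le_of_eq ?_)
    rw [← Real.rpow_mul (by linarith), one_div_mul_cancel hr.ne', Real.rpow_one]
  calc _ ≤ Real.exp (1 + Real.log W) := Real.exp_le_exp.2 h2
    _ = _ := by rw [Real.exp_add, Real.exp_log (by linarith)]

/-- Almost everywhere finiteness of the potential gives the convergence, and its integral bounds the
exponential mean. Integrability is stated separately because the integral of a non-integrable
function is 0 by convention. -/
theorem exp_integrability_of_critical [NeZero n] (hα₀ : 0 < α) (hα₁ : α < 1) (hp : 1 ≤ p)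
    (hr : r.HolderConjugate q) (he : n / (2 * α * p) = 1 / r) :
    ∃ C A : ℝ, 0 < C ∧ 0 < A ∧ ∀ F : ℝ × EuclideanSpace ℝ (Fin n) → ℝ, Measurable F →
      mixedNorm p q F < ∞ → 0 < mixedNorm p q F → ∀ t₀ : ℝ, 0 < t₀ →
      ∀ x₀ : EuclideanSpace ℝ (Fin n),
      (∀ᵐ z ∂(volume.restrict (parabolicBall α (t₀ ^ (1 / (2 * α))) t₀ x₀)),
        DuhamelConverges α F z) ∧
      IntegrableOn (fun z => Real.exp ((|duhamel α F z| / (C * (mixedNorm p q F).toReal)) ^ r))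
        (parabolicBall α (t₀ ^ (1 / (2 * α))) t₀ x₀) volume ∧
      (volume.real (parabolicBall α (t₀ ^ (1 / (2 * α))) t₀ x₀))⁻¹ *
        (∫ z in parabolicBall α (t₀ ^ (1 / (2 * α))) t₀ x₀,
          Real.exp ((|duhamel α F z| / (C * (mixedNorm p q F).toReal)) ^ r)) ≤ A := by
  obtain ⟨K, hK0, hK⟩ := kernelBound_kernel (n := n) hα₀ hα₁
  obtain ⟨C, hC, hlog⟩ := lintegral_convNorm_le_log hK hK0 hp hr he
  have hr0 := hr.pos
  have hq0 : 0 < q := hr.symm.pos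
  have hp0 : 0 < p := by linarith
  set ω := volume.real (Metric.ball (0 : EuclideanSpace ℝ (Fin n)) 1) with hω
  have hω0 : 0 < ω := ENNReal.toReal_pos (Metric.measure_ball_pos _ _ one_pos).ne'
    measure_ball_lt_top.ne
  -- The term 1 comes from the volume of the ball, the other from the integral of the potential
  -- divided by that volume.
  set M := Real.exp 1 * (1 + 2 * K ^ p * 2 ^ ((n : ℝ) / (2 * α)) / ω) with hM
  refine ⟨C, M, hC, by positivity, fun F hF hN hN0 t₀ ht₀ x₀ => ?_⟩
  set B := parabolicBall α (t₀ ^ (1 / (2 * α))) t₀ x₀ with hB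
  set T := 2 * t₀ with hT
  have hT0 : 0 < T := by positivity
  set σ := p / r + 1 / 2 with hσ
  set N := (mixedNorm p q F).toReal with hNdef
  have hNe : mixedNorm p q F = ENNReal.ofReal N := (ENNReal.ofReal_toReal hN.ne).symm
  have hNpos : 0 < N := ENNReal.toReal_pos hN0.ne' hN.ne
  have hBeq := parabolicBall_eq (n := n) hα₀ ht₀ x₀
  have hBm : MeasurableSet B := by
    rw [hB, hBeq]; exact measurableSet_Ioo.prod measurableSet_ball
  have hBsub : B ⊆ upperHalf n := fun z hz => hz.1
  have hBvol : volume.real B = T * (t₀ ^ (n / (2 * α)) * ω) := volume_real_parabolicBall hα₀ ht₀ x₀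
  have hBpos : 0 < volume.real B := by rw [hBvol]; positivity
  have hBfin : volume B ≠ ∞ := fun h => by
    rw [measureReal_def, h, ENNReal.toReal_top] at hBpos
    exact lt_irrefl _ hBpos
  have hpot := lintegral_potential_le hK hK0.le hp hq0 hF hT0
  have hpotm := measurable_potential (α := α) (p := p) (q := q) (T := T) hF
  have hpotfin : ∀ᵐ z, potential α p q T F z < ∞ := by
    refine ae_lt_top hpotm (hpot.trans_lt (ENNReal.mul_lt_top ENNReal.ofReal_lt_top ?_)).ne
    exact ENNReal.rpow_lt_top_of_nonneg hq0.le hN.ne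
  have hgood : ∀ᵐ z ∂(volume.restrict B), DuhamelConverges α F z ∧
      ENNReal.ofReal (Real.exp ((|duhamel α F z| / (C * N)) ^ r)) ≤
        ENNReal.ofReal (Real.exp 1) * (1 + ENNReal.ofReal (T ^ σ / N ^ q) *
          potential α p q T F z) := by
    filter_upwards [ae_restrict_of_ae hpotfin, ae_restrict_mem hBm] with z hz hzB
    obtain ⟨t, x⟩ := z
    rw [hB, hBeq] at hzB
    have ht : 0 < t := hzB.1.1
    have htT : t ≤ T := hzB.1.2.le
    have h1 := hlog T F hF hN hN0 t ht htT x hz.ne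
    obtain ⟨hconv, hdu⟩ := duhamel_bounds_of_lintegral_lt_top (α := α) hF ht x
      (h1.trans_lt ENNReal.ofReal_lt_top)
    refine ⟨hconv, ?_⟩
    set P := (potential α p q T F (t, x)).toReal with hPdef
    have hPe : potential α p q T F (t, x) = ENNReal.ofReal P := (ENNReal.ofReal_toReal hz.ne).symm
    have hP0 : 0 ≤ P := ENNReal.toReal_nonneg
    set W := max 1 (t ^ σ * (P / N ^ q)) with hW
    have hW1 : 1 ≤ W := le_max_left _ _
    have hbd : |duhamel α F (t, x)| ≤ N * (C * (1 + Real.log W) ^ (1 / r)) := by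
      have h2 := hdu.trans h1
      rw [← ofReal_norm, Real.norm_eq_abs] at h2
      have := Real.log_nonneg hW1
      exact (ENNReal.ofReal_le_ofReal_iff (by positivity)).1 h2
    have h3 := exp_rpow_div_le hC hNpos hr0 hW1 (abs_nonneg _) hbd
    rw [hPe, ← ENNReal.ofReal_mul (by positivity), ← ENNReal.ofReal_one,
      ← ENNReal.ofReal_add zero_le_one (by positivity), ← ENNReal.ofReal_mul (by positivity)]
    refine ENNReal.ofReal_le_ofReal (h3.trans ?_)
    gcongr
    refine max_le (by linarith [show 0 ≤ T ^ σ / N ^ q * P by positivity]) ?_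
    calc t ^ σ * (P / N ^ q) ≤ T ^ σ * (P / N ^ q) := by gcongr
      _ = T ^ σ / N ^ q * P := by ring
      _ ≤ _ := by linarith
  have hnα : p / r = n / (2 * α) := by
    rw [div_eq_mul_one_div p r, ← he]; field_simp
  -- Criticality gives p/r = n/(2α), so the powers add up to T^{1+n/(2α)}, the scaling of the volume
  -- of the ball. Hence the final constant does not depend on t₀.
  have hTpow : T ^ σ * T ^ (1 / 2 : ℝ) = T * (2 ^ ((n : ℝ) / (2 * α)) * t₀ ^ (n / (2 * α))) := by
    have : σ + 1 / 2 = 1 + n / (2 * α) := by rw [hσ, hnα]; ring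
    rw [← Real.rpow_add hT0, this, Real.rpow_add hT0, Real.rpow_one, hT,
      Real.mul_rpow zero_le_two ht₀.le]
  have htotal : ∫⁻ z in B, ENNReal.ofReal (Real.exp ((|duhamel α F z| / (C * N)) ^ r)) ≤
      ENNReal.ofReal (M * volume.real B) := by
    calc _ ≤ ∫⁻ z in B, ENNReal.ofReal (Real.exp 1) * (1 + ENNReal.ofReal (T ^ σ / N ^ q) *
          potential α p q T F z) := lintegral_mono_ae (hgood.mono fun z hz => hz.2)
      _ = ENNReal.ofReal (Real.exp 1) * (volume B + ENNReal.ofReal (T ^ σ / N ^ q) *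
          ∫⁻ z in B, potential α p q T F z) := by
          rw [lintegral_const_mul _ (by fun_prop), lintegral_add_left measurable_const,
            lintegral_const_mul _ hpotm, setLIntegral_const, one_mul]
      _ ≤ ENNReal.ofReal (Real.exp 1) * (ENNReal.ofReal (volume.real B) +
          ENNReal.ofReal (T ^ σ / N ^ q) * (ENNReal.ofReal (K ^ p * (2 * T ^ (1 / 2 : ℝ))) *
            ENNReal.ofReal N ^ q)) := by
          gcongr
          · exact (ofReal_measureReal hBfin).ge
          · rw [← hNe]
            exact (setLIntegral_le_lintegral _ _).trans hpot
      _ = ENNReal.ofReal (M * volume.real B) := by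
          rw [ENNReal.ofReal_rpow_of_nonneg hNpos.le hq0.le,
            ← ENNReal.ofReal_mul (by positivity), ← ENNReal.ofReal_mul (by positivity),
            ← ENNReal.ofReal_add (by positivity) (by positivity),
            ← ENNReal.ofReal_mul (by positivity)]
          congr 1
          have e1 : T ^ σ / N ^ q * (K ^ p * (2 * T ^ (1 / 2 : ℝ)) * N ^ q) =
              2 * K ^ p * (T ^ σ * T ^ (1 / 2 : ℝ)) := by
            field_simp
          rw [e1, hTpow, hBvol, hM]
          field_simp
  have hmeas : AEStronglyMeasurable
      (fun z => Real.exp ((|duhamel α F z| / (C * N)) ^ r)) (volume.restrict B) := by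
    have h1 := ((aestronglyMeasurable_duhamel (α := α) hF).mono_measure
      (Measure.restrict_mono hBsub le_rfl)).aemeasurable
    have h2 : Measurable fun y : ℝ => Real.exp ((|y| / (C * N)) ^ r) := by fun_prop
    exact (h2.comp_aemeasurable h1).aestronglyMeasurable
  have hnn : 0 ≤ᵐ[volume.restrict B] fun z => Real.exp ((|duhamel α F z| / (C * N)) ^ r) :=
    Eventually.of_forall fun z => (Real.exp_pos _).le
  refine ⟨hgood.mono fun z hz => hz.1, ⟨hmeas, ?_⟩, ?_⟩
  · rw [hasFiniteIntegral_iff_ofReal hnn]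
    exact htotal.trans_lt ENNReal.ofReal_lt_top
  · rw [integral_eq_lintegral_of_nonneg_ae hnn hmeas, inv_mul_le_iff₀ hBpos,
      mul_comm (volume.real B)]
    exact ENNReal.toReal_le_of_le_ofReal (by positivity) htotal

end Critical

end FracDissipative

end

/-! ### Assembly of the three statements. -/

theorem theorem1p2 (n : ℕ) (hn : 1 ≤ n) (α : ℝ) (hα₀ : 0 < α) (hα₁ : α < 1) :
    -- (i)
    (∀ p : ℝ≥0∞, 1 ≤ p → ∀ f : EuclideanSpace ℝ (Fin n) → ℝ, MemLp f p volume →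
      (∀ t : ℝ, 0 < t → ∀ x : EuclideanSpace ℝ (Fin n),
        Integrable (fun y => FracDissipative.kernel α t (x - y) * f y) volume) ∧
      ContinuousOn (FracDissipative.freeSol α f) (FracDissipative.upperHalf n)) ∧
    -- (ii)
    (∀ p q : ℝ, 1 ≤ p → 1 < q → n / p + 2 * α / q = 2 * α →
      ∃ C A : ℝ, 0 < C ∧ 0 < A ∧
        ∀ F : ℝ × EuclideanSpace ℝ (Fin n) → ℝ, FracDissipative.MemMixed p q F →
          0 < FracDissipative.mixedNorm p q F →
          ∀ t₀ : ℝ, 0 < t₀ → ∀ x₀ : EuclideanSpace ℝ (Fin n), ∀ r₀ : ℝ,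
            r₀ = t₀ ^ (1 / (2 * α)) →
            (∀ᵐ z ∂(volume.restrict (FracDissipative.parabolicBall α r₀ t₀ x₀)),
              FracDissipative.DuhamelConverges α F z) ∧
            IntegrableOn
              (fun z => Real.exp ((|FracDissipative.duhamel α F z| /
                (C * (FracDissipative.mixedNorm p q F).toReal)) ^ (q / (q - 1))))
              (FracDissipative.parabolicBall α r₀ t₀ x₀) volume ∧
            (volume.real (FracDissipative.parabolicBall α r₀ t₀ x₀))⁻¹ *
              (∫ z in FracDissipative.parabolicBall α r₀ t₀ x₀,
                Real.exp ((|FracDissipative.duhamel α F z| /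
                  (C * (FracDissipative.mixedNorm p q F).toReal)) ^ (q / (q - 1)))) ≤ A) ∧
    -- (iii)
    (∀ p q : ℝ, 1 ≤ p → 1 < q → n / p + 2 * α / q < 2 * α →
      (∀ F : ℝ × EuclideanSpace ℝ (Fin n) → ℝ, FracDissipative.MemMixed p q F →
        ∀ z ∈ FracDissipative.upperHalf n, FracDissipative.DuhamelConverges α F z) ∧
      (FracDissipative.exponent n α p q < 1 →
        ∃ C : ℝ, 0 < C ∧
          ∀ F : ℝ × EuclideanSpace ℝ (Fin n) → ℝ, FracDissipative.MemMixed p q F →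
            ∀ z ∈ FracDissipative.upperHalf n, ∀ z₀ ∈ FracDissipative.upperHalf n,
              |FracDissipative.duhamel α F z - FracDissipative.duhamel α F z₀| ≤
                C * (|z.1 - z₀.1| ^ (FracDissipative.exponent n α p q / (2 * α)) +
                    ‖z.2 - z₀.2‖ ^ FracDissipative.exponent n α p q) *
                  (FracDissipative.mixedNorm p q F).toReal) ∧
      (1 ≤ FracDissipative.exponent n α p q →
        ∀ γ : ℝ, 0 < γ → γ < 1 → ∀ T : ℝ, 0 < T →
        ∃ C : ℝ, 0 < C ∧
          ∀ F : ℝ × EuclideanSpace ℝ (Fin n) → ℝ, FracDissipative.MemMixed p q F →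
            ∀ z ∈ FracDissipative.upperHalf n, ∀ z₀ ∈ FracDissipative.upperHalf n,
              z.1 ≤ T → z₀.1 ≤ T →
              |FracDissipative.duhamel α F z - FracDissipative.duhamel α F z₀| ≤
                C * (|z.1 - z₀.1| ^ (FracDissipative.exponent n α p q / (2 * α)) +
                    ‖z.2 - z₀.2‖ ^ γ) *
                  (FracDissipative.mixedNorm p q F).toReal)) := by
  have : NeZero n := ⟨by omega⟩
  refine ⟨fun p hp f hf => ⟨fun t ht x =>
    FracDissipative.integrable_kernel_mul hα₀ hα₁ hp hf ht x,
    FracDissipative.continuousOn_freeSol hα₀ hα₁ hp hf⟩, fun p q hp hq hcrit => ?_,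
    fun p q hp hq hsub => ?_⟩
  · have hr : (q / (q - 1)).HolderConjugate q := (Real.HolderConjugate.conjExponent hq).symm
    have he : n / (2 * α * p) = 1 / (q / (q - 1)) := by
      have h := FracDissipative.exponent_eq (n := n) (p := p) hα₀ hr
      rw [FracDissipative.exponent] at h
      -- The critical relation is θ = 0, and α > 0 can be divided out.
      have h2 : 2 * α * (1 / (q / (q - 1)) - n / (2 * α * p)) = 0 := by linarith
      rcases mul_eq_zero.1 h2 with h3 | h3
      · linarith
      · linarith
    obtain ⟨C, A, hC, hA, hmain⟩ := FracDissipative.exp_integrability_of_critical hα₀ hα₁ hp hr he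
    refine ⟨C, A, hC, hA, fun F hF hF0 t₀ ht₀ x₀ r₀ hr₀ => ?_⟩
    subst hr₀
    obtain ⟨F', hF', hnorm, hdu⟩ :=
      FracDissipative.exists_measurable_representative (α := α) (p := p) (q := q) hF.1
    obtain ⟨h1, h2, h3⟩ := hmain F' hF' (hnorm ▸ hF.2) (hnorm ▸ hF0) t₀ ht₀ x₀
    have hBm : MeasurableSet (FracDissipative.parabolicBall α (t₀ ^ (1 / (2 * α))) t₀ x₀) := by
      rw [FracDissipative.parabolicBall_eq hα₀ ht₀]
      exact measurableSet_Ioo.prod measurableSet_ball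
    have hcongr : EqOn (fun z => Real.exp ((|FracDissipative.duhamel α F' z| /
          (C * (FracDissipative.mixedNorm p q F').toReal)) ^ (q / (q - 1))))
        (fun z => Real.exp ((|FracDissipative.duhamel α F z| /
          (C * (FracDissipative.mixedNorm p q F).toReal)) ^ (q / (q - 1))))
        (FracDissipative.parabolicBall α (t₀ ^ (1 / (2 * α))) t₀ x₀) := fun z hz => by
      simp only [hnorm, (hdu z hz.1).1]
    refine ⟨?_, h2.congr_fun hcongr hBm, ?_⟩
    · filter_upwards [h1, ae_restrict_mem hBm] with z hz hzB
      exact (hdu z hzB.1).2.1 hz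
    · rwa [setIntegral_congr_fun hBm hcongr] at h3
  · have hr : (q / (q - 1)).HolderConjugate q := (Real.HolderConjugate.conjExponent hq).symm
    have hexp := FracDissipative.exponent_eq (n := n) (p := p) hα₀ hr
    have he : n / (2 * α * p) < 1 / (q / (q - 1)) := by
      have h := hexp
      rw [FracDissipative.exponent] at h
      have h2 : 0 < 2 * α * (1 / (q / (q - 1)) - n / (2 * α * p)) := by linarith
      have h3 := pos_of_mul_pos_right h2 (by positivity)
      linarith
    have hexp' : FracDissipative.exponent n α p q / (2 * α) =
        1 / (q / (q - 1)) - n / (2 * α * p) := by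
      rw [hexp]; field_simp
    obtain ⟨C₁, hC₁, htime⟩ := FracDissipative.abs_duhamel_sub_time_le hα₀ hα₁ hp hr he
    -- Shared by both ranges of θ: pass through (t, x₀), using the given space bound and then the
    -- time bound, for a Borel representative of F.
    have combine : ∀ C₂ β : ℝ, 0 < C₂ → ∀ F : ℝ × EuclideanSpace ℝ (Fin n) → ℝ,
        FracDissipative.MemMixed p q F → ∀ z ∈ FracDissipative.upperHalf n,
        ∀ z₀ ∈ FracDissipative.upperHalf n,
        (∀ F' : ℝ × EuclideanSpace ℝ (Fin n) → ℝ, Measurable F' →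
          FracDissipative.mixedNorm p q F' < ∞ →
          |FracDissipative.duhamel α F' (z.1, z.2) - FracDissipative.duhamel α F' (z.1, z₀.2)| ≤
            C₂ * ‖z.2 - z₀.2‖ ^ β * (FracDissipative.mixedNorm p q F').toReal) →
        |FracDissipative.duhamel α F z - FracDissipative.duhamel α F z₀| ≤
          (C₁ + C₂) * (|z.1 - z₀.1| ^ (FracDissipative.exponent n α p q / (2 * α)) +
            ‖z.2 - z₀.2‖ ^ β) * (FracDissipative.mixedNorm p q F).toReal := by
      intro C₂ β hC₂ F hF z hz z₀ hz₀ hspace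
      obtain ⟨F', hF', hnorm, hdu⟩ :=
        FracDissipative.exists_measurable_representative (α := α) (p := p) (q := q) hF.1
      have h1 := hspace F' hF' (hnorm ▸ hF.2)
      have h2 := htime F' hF' (hnorm ▸ hF.2) z.1 z₀.1 hz.1 hz₀.1 z₀.2
      rw [hnorm] at h1 h2
      rw [← (hdu z hz).1, ← (hdu z₀ hz₀).1, hexp']
      refine (abs_sub_le _ (FracDissipative.duhamel α F' (z.1, z₀.2)) _).trans
        ((add_le_add h1 h2).trans ?_)
      rw [← add_mul]
      refine mul_le_mul_of_nonneg_right ?_ ENNReal.toReal_nonneg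
      have a1 : 0 ≤ ‖z.2 - z₀.2‖ ^ β := by positivity
      have a2 : 0 ≤ |z.1 - z₀.1| ^ (1 / (q / (q - 1)) - n / (2 * α * p)) := by positivity
      nlinarith [mul_nonneg hC₁.le a1, mul_nonneg hC₂.le a2]
    refine ⟨fun F hF z hz => ?_, fun hθ => ?_, fun hθ γ hγ₀ hγ₁ T hT => ?_⟩
    · obtain ⟨F', hF', hnorm, hdu⟩ :=
        FracDissipative.exists_measurable_representative (α := α) (p := p) (q := q) hF.1
      exact (hdu z hz).2.1 (FracDissipative.duhamelConverges_of_subcritical hα₀ hα₁ hp hr he hF'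
        (hnorm ▸ hF.2) hz.1 z.2)
    · obtain ⟨C₂, hC₂, hspace⟩ :=
        FracDissipative.abs_duhamel_sub_space_le_of_lt_one hα₀ hα₁ hp hr he hθ
      exact ⟨C₁ + C₂, by positivity, fun F hF z hz z₀ hz₀ => combine C₂ _ hC₂ F hF z hz z₀ hz₀
        fun F' hF' hN => hspace F' hF' hN z.1 hz.1 z.2 z₀.2⟩
    · obtain ⟨C₂, hC₂, hspace⟩ := FracDissipative.abs_duhamel_sub_space_le_of_lt_exponent hα₀ hα₁ hp
        hr he hγ₀ hγ₁.le (hγ₁.trans_le hθ) hT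
      exact ⟨C₁ + C₂, by positivity, fun F hF z hz z₀ hz₀ hzT _ =>
        combine C₂ _ hC₂ F hF z hz z₀ hz₀
        fun F' hF' hN => hspace F' hF' hN z.1 hz.1 hzT z.2 z₀.2⟩
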